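/- **Theorem (numerical precession of Störmer–Verlet).** Let $X:\mathbb R\to\mathbb R^2$ be a solution of the Kepler problem $\ddot X=-X/|X|^3$ whose orbit is an ellipse with semimajor axis $a$ and semiminor axis $b$, $0<b<a$. Let $T$ be its (minimal) period, $\mathbb L=X_1\dot X_2-\dot X_1X_2$ its angular momentum, and let $$R(x,v)=|v|^2x-\langle x,v\rangle v-\frac{x}{|x|}$$ be the Laplace–Runge–Lenz (LRL) vector. The change in angle of the LRL vector of a numerical solution, or of a solution of a perturbed Kepler problem, over a time interval of length $T$ is called its precession rate. Then the precession rate of the Störmer–Verlet method with step size $h$ is $$-\operatorname{sgn}(\mathbb L)\,\frac{\pi}{24}\left(15\frac{a^3}{b^6}-3\frac{a}{b^4}\right)h^2+\mathcal O(h^4)\qquad(h\to0^+).$$ Precisely, for every $K$ there are $C$ and $h_0>0$ such that for $0<h<h_0$ the following rates differ from the leading term by at most $Ch^4$: 1. *The numerical solution.* Let $(x_k)_{k\ge0}$ satisfy $\frac{x_{k+1}-2x_k+x_{k-1}}{h^2}=-\frac{x_k}{|x_k|^3}$ for $k\ge1$, with discrete momentum $p_k=\frac{x_{k+1}-x_k}{h}+\frac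 h2\frac{x_k}{|x_k|^3}$, and suppose $|x_0-X(0)|\le Kh^2$ and $|p_0-\dot X(0)|\le Kh^2$. Let $\omega_n$ be the sum over $k<n$ of the signed angles (in $(-\pi,\pi]$) from $R(x_k,p_k)$ to $R(x_{k+1},p_{k+1})$. The precession rate is the value at time $T$ of the piecewise linear function of time that takes the value $\omega_n$ at time $nh$ (so it is $\omega_N$ if $T=Nh$). 2. *The modified Lagrangian.* Let $x:[0,T]\to\mathbb R^2\setminus\{0\}$ be a $C^2$ solution of the Euler–Lagrange equation of the modified Lagrangian of second order accuracy of the method, $$\mathcal L_{\mathrm{mod},2}(x,\dot x)=\frac12|\dot x|^2+\frac1{|x|}+\frac{h^2}{24}\left(\frac1{|x|^4}-2\frac{|\dot x|^2}{|x|^3}+6\frac{\langle x,\dot x\rangle^2}{|x|^5}\right),$$ with $|x(0)-X(0)|\le Kh^2$ and $|\dot x(0)-\dot X(0)|\le Kh^2$. The precession rate is $\theta(T)-\theta(0)$, where $\theta$ is any continuous angle of $R(x(t),\dot x(t))$ on $[0,T]$. -/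

import Mathlib

open scoped RealInnerProductSpace

noncomputable section

/-- The Euclidean plane. -/
abbrev Plane : Type := EuclideanSpace ℝ (Fin 2)

/-- Rotation by a right angle, counterclockwise. -/
def rotPlane (u : Plane) : Plane := !₂[-u 1, u 0]

/-- The Kepler force field `f(x) = -x / |x|³`. -/
def keplerForce (x : Plane) : Plane := -((‖x‖ ^ 3)⁻¹ • x)

/-- `X` is a (collision-free, global) solution of `x'' = -x / |x|³`, with velocity `V`. -/
structure IsKeplerSolution (X V : ℝ → Plane) : Prop where
  ne_zero : ∀ t, X t ≠ 0
  hasDerivAt_pos : ∀ t, HasDerivAt X (V t) t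
  hasDerivAt_vel : ∀ t, HasDerivAt V (keplerForce (X t)) t

/-- `S` is an ellipse with semimajor axis `a` and semiminor axis `b`
(`c` is the centre and `u` the direction of the major axis). -/
def IsEllipse (S : Set Plane) (a b : ℝ) : Prop :=
  0 < b ∧ b ≤ a ∧ ∃ c u : Plane, ‖u‖ = 1 ∧
    S = {p | (⟪p - c, u⟫ / a) ^ 2 + (⟪p - c, rotPlane u⟫ / b) ^ 2 = 1}

/-- `T` is the (smallest positive) period of `X`. -/
def IsMinimalPeriod (X : ℝ → Plane) (T : ℝ) : Prop :=
  IsLeast {τ : ℝ | 0 < τ ∧ Function.Periodic X τ} T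

/-- The angular momentum `x₁ v₂ - v₁ x₂`. -/
def angularMomentum (x v : Plane) : ℝ := x 0 * v 1 - v 0 * x 1

/-- The Laplace-Runge-Lenz vector `|v|² x - ⟨x, v⟩ v - x / |x|`. -/
def lrlVector (x v : Plane) : Plane := ‖v‖ ^ 2 • x - ⟪x, v⟫ • v - ‖x‖⁻¹ • x

/-- The signed angle in `(-π, π]` from `u` to `w`, i.e. the argument of `conj u * w`. -/
def signedAngle (u w : Plane) : ℝ :=
  Complex.arg ⟨u 0 * w 0 + u 1 * w 1, u 0 * w 1 - u 1 * w 0⟩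

/-! ### The Störmer-Verlet method -/

/-- `(x_{k+1} - 2 x_k + x_{k-1}) / h² = f(x_k)` for all `k ≥ 1`. -/
def IsStormerVerlet (h : ℝ) (x : ℕ → Plane) : Prop :=
  ∀ k : ℕ, (h ^ 2)⁻¹ • (x (k + 2) - (2 : ℝ) • x (k + 1) + x k) = keplerForce (x (k + 1))

/-- The discrete momentum `p_k = (x_{k+1} - x_k) / h - (h / 2) f(x_k)`; on solutions of the
method it equals the central difference `(x_{k+1} - x_{k-1}) / (2 h)` for `k ≥ 1`. -/
def svMomentum (h : ℝ) (x : ℕ → Plane) (k : ℕ) : Plane :=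
  h⁻¹ • (x (k + 1) - x k) - (h / 2) • keplerForce (x k)

/-- The Laplace-Runge-Lenz vector of the numerical solution after `k` steps. -/
def svLrl (h : ℝ) (x : ℕ → Plane) (k : ℕ) : Plane := lrlVector (x k) (svMomentum h x k)

/-- The angle through which the Laplace-Runge-Lenz vector has turned after `n` steps. -/
def svAngle (h : ℝ) (x : ℕ → Plane) (n : ℕ) : ℝ :=
  ∑ k ∈ Finset.range n, signedAngle (svLrl h x k) (svLrl h x (k + 1))

/-- The angle through which the Laplace-Runge-Lenz vector of the numerical solution has turned
at time `T`, interpolated linearly in time between grid points (so it is `svAngle h x N`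
if `T = N h`). -/
def svPrecession (h : ℝ) (x : ℕ → Plane) (T : ℝ) : ℝ :=
  svAngle h x ⌊T / h⌋₊ +
    (T / h - ⌊T / h⌋₊) * (svAngle h x (⌊T / h⌋₊ + 1) - svAngle h x ⌊T / h⌋₊)

/-! ### The modified Lagrangian -/

/-- The modified Lagrangian of second order accuracy of the Störmer-Verlet method. -/
def svModLagrangian (h : ℝ) (x v : Plane) : ℝ :=
  1 / 2 * ‖v‖ ^ 2 + 1 / ‖x‖ +
    h ^ 2 / 24 * (1 / ‖x‖ ^ 4 - 2 * (‖v‖ ^ 2 / ‖x‖ ^ 3) + 6 * (⟪x, v⟫ ^ 2 / ‖x‖ ^ 5))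

/-- `x` is a twice continuously differentiable, collision-free curve on `[0, T]` with velocity `v`
that satisfies the Euler-Lagrange equation `d/dt (∂L/∂v) = ∂L/∂x`. -/
structure IsEulerLagrangeSolution (L : Plane → Plane → ℝ) (T : ℝ) (x v : ℝ → Plane) : Prop where
  ne_zero : ∀ t ∈ Set.Icc 0 T, x t ≠ 0
  hasDeriv : ∀ t ∈ Set.Icc 0 T, HasDerivWithinAt x (v t) (Set.Icc 0 T) t
  contDiffOn_vel : ContDiffOn ℝ 1 v (Set.Icc 0 T)
  eulerLagrange : ∀ t ∈ Set.Icc 0 T,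
    HasDerivWithinAt (fun s => gradient (fun w => L (x s) w) (v s))
      (gradient (fun y => L y (v t)) (x t)) (Set.Icc 0 T) t

/-- `θ` is a continuous angle on `[0, T]` of the Laplace-Runge-Lenz vector along `(x, v)`. -/
def IsLrlAngle (T : ℝ) (x v : ℝ → Plane) (θ : ℝ → ℝ) : Prop :=
  ContinuousOn θ (Set.Icc 0 T) ∧ ∀ t ∈ Set.Icc 0 T,
    lrlVector (x t) (v t) = ‖lrlVector (x t) (v t)‖ • !₂[Real.cos (θ t), Real.sin (θ t)]

end

/-! Write `u × w` for `angularMomentum u w` and let `m` be the LRL vector of the Kepler orbit. A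
vector `R` with `R - m = O(h²)` makes with `m` the signed angle `(m × R)/|m|² + O(h⁴)`
(`abs_signedAngle_sub_le`), so it suffices to follow the scalar `m × R`. In the plane `m × R(x, v) =
-(x × v)⟪m, v⟫ - (m × x)/|x|` (`angularMomentum_lrlVector`), and along any curve the last quotient
has derivative `(x × x')⟪m, x⟫/|x|³`. For Kepler motion the two terms balance; what a perturbation
leaves over is the precession.

A Störmer-Verlet step is kick, drift, kick. Kicks are central and drifts are straight, so angular
momentum is conserved exactly, and the change of `m × R` in a step is exactly the error of the
trapezoidal rule along the drift for `u(x) = ⟪m, x⟫/|x|³` times the angular momentum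
(`IsStormerVerlet.svLrl_succ_sub`). This error is `(z × p)(h³/12) D²u(z)[p, p] + O(h⁵)` at the
middle of the drift (`exists_trapezoid_defect_bound`). Second order convergence and the midpoint
rule turn the sum over the steps into `(L h²/12) ∫ D²u(X)[V, V] dt + O(h⁴)`.

For the modified Lagrangian, let `P = ∂L/∂v`; then `ℓ = x × P` is conserved, and `-ℓ⟪m, P⟫ - (m ×
x)/|x|` has derivative `(h²/12)(x × v) D²u(x)[v, v] + O(h⁴)`
(`IsEulerLagrangeSolution.hasDerivWithinAt_lrl`). It differs from `m × R` by `h²` times a function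
of the state, up to `O(h⁴)`, and the state returns to within `O(h²)` after a period. Both rates are
thus given by the same integral.

The integral is explicit (`exists_primitive_dipoleHessian`): `D²u(X)[V, V] = (Du(X)[V])' - 2⟪m,
X⟫/|X|⁶`, the boundary term is periodic, and with the polar angle `φ' = L/|X|²` and the orbit
equation `|X|(1 + c) = L²`, `c = ⟪m, X⟫/|X|`, there remains `-(2/L⁷) ∫ c(1 + c)³ dφ` over one full
turn. The shape of the ellipse gives `L² = b²/a` and `|m|² = 1 - b²/a²`
(`IsEllipse.conic_parameters`). -/

/-! ### Elementary estimates -/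

/-- A function that starts at `0` and whose derivative is `O(s ^ n)` is `O(s ^ (n + 1))`. -/
theorem norm_le_mul_pow_of_norm_deriv_le {F : Type*} [NormedAddCommGroup F] [NormedSpace ℝ F]
    {e e' : ℝ → F} {C S : ℝ} {n : ℕ} (hC : 0 ≤ C) (hS : 0 ≤ S)
    (he : ∀ s ∈ Set.Icc 0 S, HasDerivAt e (e' s) s)
    (hb : ∀ s ∈ Set.Icc 0 S, ‖e' s‖ ≤ C * s ^ n) (h0 : e 0 = 0) :
    ‖e S‖ ≤ C * S ^ (n + 1) := by
  have h := norm_image_sub_le_of_norm_deriv_le_segment' (f := e) (f' := e') (a := 0) (b := S)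
    (C := C * S ^ n) (fun s hs => (he s hs).hasDerivWithinAt)
    (fun s hs => (hb s ⟨hs.1, hs.2.le⟩).trans
      (mul_le_mul_of_nonneg_left (pow_le_pow_left₀ hs.1 hs.2.le n) hC)) S ⟨hS, le_rfl⟩
  rw [h0, sub_zero, sub_zero] at h
  rw [pow_succ, ← mul_assoc]
  exact h

/-- A function that is `C¹` at the points of a compact set is uniformly Lipschitz near it. -/
theorem IsCompact.exists_norm_sub_le {E F : Type*} [NormedAddCommGroup E] [NormedSpace ℝ E]
    [NormedAddCommGroup F] [NormedSpace ℝ F] {g : E → F} {O : Set E} (hO : IsCompact O)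
    (hg : ∀ y ∈ O, ContDiffAt ℝ 1 g y) :
    ∃ δ > 0, ∃ M ≥ 0, ∀ y ∈ O, ∀ z w, ‖z - y‖ < δ → ‖w - y‖ < δ → ‖g z - g w‖ ≤ M * ‖z - w‖ := by
  refine hO.induction_on (p := fun O => ∃ δ > 0, ∃ M ≥ 0, ∀ y ∈ O, ∀ z w, ‖z - y‖ < δ →
    ‖w - y‖ < δ → ‖g z - g w‖ ≤ M * ‖z - w‖) ?_ ?_ ?_ ?_
  · exact ⟨1, one_pos, 0, le_rfl, fun y hy => hy.elim⟩
  · rintro s t hst ⟨δ, hδ, M, hM, H⟩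
    exact ⟨δ, hδ, M, hM, fun y hy => H y (hst hy)⟩
  · rintro s t ⟨δ, hδ, M, hM, H⟩ ⟨δ', hδ', M', hM', H'⟩
    refine ⟨min δ δ', lt_min hδ hδ', max M M', hM.trans (le_max_left _ _), ?_⟩
    rintro y (hy | hy) z w hz hw
    · exact (H y hy z w (hz.trans_le (min_le_left _ _)) (hw.trans_le (min_le_left _ _))).trans
        (mul_le_mul_of_nonneg_right (le_max_left _ _) (norm_nonneg _))
    · exact (H' y hy z w (hz.trans_le (min_le_right _ _)) (hw.trans_le (min_le_right _ _))).trans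
        (mul_le_mul_of_nonneg_right (le_max_right _ _) (norm_nonneg _))
  · intro y hy
    obtain ⟨K, t, ht, hK⟩ := (hg y hy).exists_lipschitzOnWith
    obtain ⟨ε, hε, hεt⟩ := Metric.mem_nhds_iff.1 ht
    refine ⟨Metric.ball y (ε / 2), mem_nhdsWithin_of_mem_nhds (Metric.ball_mem_nhds _ (half_pos hε)),
      ε / 2, half_pos hε, K, K.2, fun y' hy' z w hz hw => ?_⟩
    rw [← dist_eq_norm] at hz hw ⊢
    rw [← dist_eq_norm]
    have key : ∀ z, dist z y' < ε / 2 → z ∈ t := fun z hz => hεt <| by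
      rw [Metric.mem_ball] at hy' ⊢
      linarith [dist_triangle z y' y]
    exact hK.dist_le_mul _ (key z hz) _ (key w hw)

/-- A function that is `C²` at the points of a compact set has uniformly bounded second
symmetric differences near it. -/
theorem IsCompact.exists_norm_symm_diff_le {E F : Type*} [NormedAddCommGroup E] [NormedSpace ℝ E]
    [NormedAddCommGroup F] [NormedSpace ℝ F] {g : E → F} {O : Set E} (hO : IsCompact O)
    (hg : ∀ y ∈ O, ContDiffAt ℝ 2 g y) :
    ∃ δ > 0, ∃ M ≥ 0, ∀ y ∈ O, ∀ z d, ‖z - y‖ < δ → ‖d‖ < δ →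
      ‖g (z + d) + g (z - d) - (2 : ℝ) • g z‖ ≤ M * ‖d‖ ^ 2 := by
  refine hO.induction_on (p := fun O => ∃ δ > 0, ∃ M ≥ 0, ∀ y ∈ O, ∀ z d, ‖z - y‖ < δ → ‖d‖ < δ →
      ‖g (z + d) + g (z - d) - (2 : ℝ) • g z‖ ≤ M * ‖d‖ ^ 2) ?_ ?_ ?_ ?_
  · exact ⟨1, one_pos, 0, le_rfl, fun y hy => hy.elim⟩
  · rintro s t hst ⟨δ, hδ, M, hM, H⟩
    exact ⟨δ, hδ, M, hM, fun y hy => H y (hst hy)⟩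
  · rintro s t ⟨δ, hδ, M, hM, H⟩ ⟨δ', hδ', M', hM', H'⟩
    refine ⟨min δ δ', lt_min hδ hδ', max M M', hM.trans (le_max_left _ _), ?_⟩
    rintro y (hy | hy) z w hz hw
    · exact (H y hy z w (hz.trans_le (min_le_left _ _)) (hw.trans_le (min_le_left _ _))).trans
        (mul_le_mul_of_nonneg_right (le_max_left _ _) (by positivity))
    · exact (H' y hy z w (hz.trans_le (min_le_right _ _)) (hw.trans_le (min_le_right _ _))).trans
        (mul_le_mul_of_nonneg_right (le_max_right _ _) (by positivity))
  · intro y hy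
    have hgy := hg y hy
    obtain ⟨K, t, ht, hK⟩ := (hgy.fderiv_right (m := 1) (by norm_num)).exists_lipschitzOnWith
    have hd : ∀ᶠ z in nhds y, DifferentiableAt ℝ g z := by
      filter_upwards [hgy.eventually (by simp)] with z hz
      exact hz.differentiableAt (by norm_num)
    obtain ⟨ε, hε, hεt⟩ := Metric.mem_nhds_iff.1 (Filter.inter_mem ht hd)
    refine ⟨Metric.ball y (ε / 3), mem_nhdsWithin_of_mem_nhds (Metric.ball_mem_nhds _ (by positivity)),
      ε / 3, by positivity, 2 * K, by positivity, fun y' hy' z d hz hd => ?_⟩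
    rw [← dist_eq_norm] at hz
    have hmem : ∀ s : ℝ, |s| ≤ 1 → z + s • d ∈ t ∧ DifferentiableAt ℝ g (z + s • d) := by
      intro s hs
      apply hεt
      rw [Metric.mem_ball] at hy' ⊢
      have h1 : dist (z + s • d) z ≤ ‖d‖ := by
        rw [dist_eq_norm, add_sub_cancel_left, norm_smul, Real.norm_eq_abs]
        exact mul_le_of_le_one_left (norm_nonneg _) hs
      linarith [dist_triangle z y' y, dist_triangle (z + s • d) z y]
    have hline : ∀ s : ℝ, |s| ≤ 1 →
        HasDerivAt (fun s : ℝ => g (z + s • d)) (fderiv ℝ g (z + s • d) d) s := by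
      intro s hs
      have h2 : HasDerivAt (fun s : ℝ => z + s • d) d s := by
        simpa using ((hasDerivAt_id s).smul_const d).const_add z
      exact (hmem s hs).2.hasFDerivAt.comp_hasDerivAt s h2
    -- Scale `d` by `s` from `0` to `1`. The derivative in `s` is a difference of `fderiv ℝ g` at
    -- two points `2s|d|` apart, applied to `d`; the Lipschitz constant `K` of `fderiv ℝ g` makes it
    -- at most `2K|d|²`.
    have h := norm_le_mul_pow_of_norm_deriv_le (n := 0) (S := 1) (C := 2 * K * ‖d‖ ^ 2)
      (e := fun s : ℝ => g (z + s • d) + g (z + (-s) • d) - (2 : ℝ) • g z)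
      (e' := fun s => fderiv ℝ g (z + s • d) d + (-1 : ℝ) • fderiv ℝ g (z + (-s) • d) d)
      (by positivity) zero_le_one ?_ ?_ ?_
    · simpa [sub_eq_add_neg] using h
    · rintro s ⟨hs0, hs1⟩
      have ha : |s| ≤ 1 := abs_le.2 ⟨by linarith, hs1⟩
      exact ((hline s ha).add ((hline (-s) (by rwa [abs_neg])).scomp s (hasDerivAt_neg s))).sub_const _
    · rintro s ⟨hs0, hs1⟩
      have ha : |s| ≤ 1 := abs_le.2 ⟨by linarith, hs1⟩
      have h3 := hK.dist_le_mul _ (hmem s ha).1 _ (hmem (-s) (by rwa [abs_neg])).1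
      rw [dist_eq_norm, dist_eq_norm] at h3
      have h4 : z + s • d - (z + (-s) • d) = (2 * s) • d := by module
      rw [h4, norm_smul, Real.norm_eq_abs, abs_of_nonneg (by positivity)] at h3
      have h5 : fderiv ℝ g (z + s • d) d + (-1 : ℝ) • fderiv ℝ g (z + (-s) • d) d =
          (fderiv ℝ g (z + s • d) - fderiv ℝ g (z + (-s) • d)) d := by
        rw [sub_apply]; module
      rw [h5, pow_zero, mul_one]
      refine ((fderiv ℝ g (z + s • d) - fderiv ℝ g (z + (-s) • d)).le_opNorm d).trans ?_
      calc _ ≤ (K * (2 * s * ‖d‖)) * ‖d‖ := mul_le_mul_of_nonneg_right h3 (norm_nonneg _)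
        _ = s * (2 * K * ‖d‖ ^ 2) := by ring
        _ ≤ 2 * K * ‖d‖ ^ 2 := mul_le_of_le_one_left (by positivity) hs1
    · simp only [zero_smul, neg_zero, add_zero]
      module

/-- Discrete Gronwall inequality for a one-step method of order two. -/
theorem le_of_forall_le_one_add_mul_add {E : ℕ → ℝ} {c d h : ℝ} {n : ℕ} (hc : 0 ≤ c) (hd : 0 ≤ d)
    (hh : 0 ≤ h) (hE : ∀ k < n, E (k + 1) ≤ (1 + c * h) * E k + d) :
    E n ≤ (1 + c * h) ^ n * (E 0 + n * d) := by
  induction n with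
  | zero => simp
  | succ n ih =>
    have h1 := ih fun k hk => hE k (hk.trans n.lt_succ_self)
    have h2 := hE n n.lt_succ_self
    have h3 : 1 ≤ (1 + c * h) ^ (n + 1) := one_le_pow₀ (by nlinarith)
    calc E (n + 1) ≤ (1 + c * h) * ((1 + c * h) ^ n * (E 0 + n * d)) + d := by
          refine h2.trans (by gcongr)
      _ ≤ (1 + c * h) * ((1 + c * h) ^ n * (E 0 + n * d)) + (1 + c * h) ^ (n + 1) * d := by
          gcongr; exact le_mul_of_one_le_left hd h3
      _ = _ := by push_cast; ring

/-! ### Coordinates in the plane -/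

theorem inner_plane (x y : Plane) : ⟪x, y⟫ = x 0 * y 0 + x 1 * y 1 := by
  simp [PiLp.inner_apply, Fin.sum_univ_two, mul_comm]

theorem norm_sq_plane (x : Plane) : ‖x‖ ^ 2 = x 0 ^ 2 + x 1 ^ 2 := by
  rw [EuclideanSpace.real_norm_sq_eq, Fin.sum_univ_two]

theorem plane_ext {x y : Plane} (h0 : x 0 = y 0) (h1 : x 1 = y 1) : x = y := by
  ext i; fin_cases i <;> assumption

theorem inner_sq_add_angularMomentum_sq (x y : Plane) :
    ⟪x, y⟫ ^ 2 + angularMomentum x y ^ 2 = ‖x‖ ^ 2 * ‖y‖ ^ 2 := by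
  rw [inner_plane, norm_sq_plane, norm_sq_plane, angularMomentum]; ring

theorem abs_angularMomentum_le (x y : Plane) : |angularMomentum x y| ≤ ‖x‖ * ‖y‖ := by
  apply abs_le_of_sq_le_sq _ (by positivity)
  rw [mul_pow, ← inner_sq_add_angularMomentum_sq]
  nlinarith [sq_nonneg ⟪x, y⟫]

theorem angularMomentum_add_right (x y z : Plane) :
    angularMomentum x (y + z) = angularMomentum x y + angularMomentum x z := by
  simp only [angularMomentum, PiLp.add_apply]; ring

theorem angularMomentum_sub_right (x y z : Plane) :
    angularMomentum x (y - z) = angularMomentum x y - angularMomentum x z := by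
  simp only [angularMomentum, PiLp.sub_apply]; ring

theorem angularMomentum_smul_right (x y : Plane) (r : ℝ) :
    angularMomentum x (r • y) = r * angularMomentum x y := by
  simp only [angularMomentum, PiLp.smul_apply, smul_eq_mul]; ring

theorem angularMomentum_add_left (x y z : Plane) :
    angularMomentum (x + y) z = angularMomentum x z + angularMomentum y z := by
  simp only [angularMomentum, PiLp.add_apply]; ring

theorem angularMomentum_smul_left (x y : Plane) (r : ℝ) :
    angularMomentum (r • x) y = r * angularMomentum x y := by
  simp only [angularMomentum, PiLp.smul_apply, smul_eq_mul]; ring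

theorem angularMomentum_self (x : Plane) : angularMomentum x x = 0 := by
  simp only [angularMomentum]; ring

/-! ### Signed angles -/

/-- The point of the complex plane with the given coordinates. -/
def planeToComplex (u : Plane) : ℂ := ⟨u 0, u 1⟩

theorem norm_planeToComplex (u : Plane) : ‖planeToComplex u‖ = ‖u‖ := by
  rw [← sq_eq_sq₀ (norm_nonneg _) (norm_nonneg _), Complex.sq_norm, Complex.normSq_apply,
    norm_sq_plane, planeToComplex]
  ring

theorem continuous_planeToComplex : Continuous planeToComplex := by
  have : planeToComplex = fun u : Plane => (u 0 : ℂ) + (u 1 : ℂ) * Complex.I := by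
    ext u; apply Complex.ext <;> simp [planeToComplex]
  rw [this]; fun_prop

theorem planeToComplex_sub (u w : Plane) :
    planeToComplex (u - w) = planeToComplex u - planeToComplex w := by
  apply Complex.ext <;> simp [planeToComplex]

theorem signedAngle_eq_arg (u w : Plane) :
    signedAngle u w = Complex.arg (starRingEnd ℂ (planeToComplex u) * planeToComplex w) := by
  rw [signedAngle]
  congr 1
  apply Complex.ext
  · simp [planeToComplex]
  · simp [planeToComplex]; ring

theorem conj_mul_self_planeToComplex (m : Plane) :
    starRingEnd ℂ (planeToComplex m) * planeToComplex m = ((‖m‖ ^ 2 : ℝ) : ℂ) := by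
  rw [mul_comm, Complex.mul_conj, Complex.normSq_eq_norm_sq, norm_planeToComplex]

theorem conj_mul_planeToComplex_re_pos {m u : Plane} (hm : m ≠ 0) (hu : ‖u - m‖ ≤ ‖m‖ / 2) :
    0 < (starRingEnd ℂ (planeToComplex m) * planeToComplex u).re := by
  have h0 : 0 < ‖m‖ := norm_pos_iff.2 hm
  have h1 : starRingEnd ℂ (planeToComplex m) * planeToComplex u =
      ((‖m‖ ^ 2 : ℝ) : ℂ) + starRingEnd ℂ (planeToComplex m) * planeToComplex (u - m) := by
    rw [← conj_mul_self_planeToComplex, planeToComplex_sub]; ring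
  have h2 := (abs_le.1 ((Complex.abs_re_le_norm
    (starRingEnd ℂ (planeToComplex m) * planeToComplex (u - m))))).1
  rw [norm_mul, Complex.norm_conj, norm_planeToComplex, norm_planeToComplex] at h2
  rw [h1, Complex.add_re, Complex.ofReal_re]
  nlinarith

/-- Factor `conj m * u = |m|²(1 + ζ)`. The angle is `Im log(1 + ζ)`, the linear term is `Im ζ`, and
`|log(1 + ζ) - ζ| ≤ |ζ|²` for `|ζ| ≤ 1/2`. With `u - m = O(h²)` the error is `O(h⁴)`. -/
theorem abs_signedAngle_sub_le {m u : Plane} (hm : m ≠ 0) (hu : ‖u - m‖ ≤ ‖m‖ / 2) :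
    |signedAngle m u - angularMomentum m u / ‖m‖ ^ 2| ≤ (‖u - m‖ / ‖m‖) ^ 2 := by
  have h0 : 0 < ‖m‖ := norm_pos_iff.2 hm
  set ζ : ℂ := ((‖m‖ ^ 2 : ℝ) : ℂ)⁻¹ * (starRingEnd ℂ (planeToComplex m) * planeToComplex (u - m))
    with hζ
  have hne : ((‖m‖ ^ 2 : ℝ) : ℂ) ≠ 0 := by exact_mod_cast (by positivity : ‖m‖ ^ 2 ≠ 0)
  have h1 : starRingEnd ℂ (planeToComplex m) * planeToComplex u = ((‖m‖ ^ 2 : ℝ) : ℂ) * (1 + ζ) := by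
    rw [mul_add, mul_one, hζ, mul_inv_cancel_left₀ hne, ← conj_mul_self_planeToComplex,
      planeToComplex_sub]
    ring
  have hζn : ‖ζ‖ = ‖u - m‖ / ‖m‖ := by
    rw [hζ, norm_mul, norm_mul, norm_inv, Complex.norm_conj, norm_planeToComplex,
      norm_planeToComplex, Complex.norm_real, Real.norm_of_nonneg (by positivity)]
    field_simp
  have hζ2 : ‖ζ‖ ≤ 1 / 2 := by
    rw [hζn, div_le_iff₀ h0]; linarith
  have hζi : ζ.im = angularMomentum m u / ‖m‖ ^ 2 := by
    rw [hζ, ← Complex.ofReal_inv, Complex.im_ofReal_mul, div_eq_inv_mul]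
    congr 1
    simp only [planeToComplex, angularMomentum, Complex.mul_im, Complex.conj_re, Complex.conj_im,
      PiLp.sub_apply]
    ring
  rw [signedAngle_eq_arg, h1, Complex.arg_real_mul _ (by positivity), ← Complex.log_im, ← hζi,
    ← Complex.sub_im, ← hζn]
  refine (Complex.abs_im_le_norm _).trans
    ((Complex.norm_log_one_add_sub_self_le (by linarith)).trans ?_)
  have h3 : (1 - ‖ζ‖)⁻¹ ≤ 2 := by
    rw [inv_le_comm₀ (by linarith) (by norm_num)]; linarith
  nlinarith [sq_nonneg ‖ζ‖]

/-- Angles from `m` lie in `(-π/2, π/2)`, so their differences stay in `(-π, π)` and no multiple of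
`2π` appears. This makes the sum of the step angles telescope. -/
theorem signedAngle_eq_sub {m u w : Plane} (hm : m ≠ 0) (hu : ‖u - m‖ ≤ ‖m‖ / 2)
    (hw : ‖w - m‖ ≤ ‖m‖ / 2) : signedAngle u w = signedAngle m w - signedAngle m u := by
  have h0 : 0 < ‖m‖ := norm_pos_iff.2 hm
  have hu' := conj_mul_planeToComplex_re_pos hm hu
  have hw' := conj_mul_planeToComplex_re_pos hm hw
  rw [signedAngle_eq_arg, signedAngle_eq_arg m, signedAngle_eq_arg m]
  set p := starRingEnd ℂ (planeToComplex m) * planeToComplex u with hp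
  set q := starRingEnd ℂ (planeToComplex m) * planeToComplex w with hq
  have h1 : starRingEnd ℂ p * q = ((‖m‖ ^ 2 : ℝ) : ℂ) *
      (starRingEnd ℂ (planeToComplex u) * planeToComplex w) := by
    rw [← conj_mul_self_planeToComplex, hp, hq, map_mul, Complex.conj_conj]; ring
  rw [← Complex.arg_real_mul (starRingEnd ℂ (planeToComplex u) * planeToComplex w)
    (by positivity : 0 < ‖m‖ ^ 2), ← h1]
  have hap := Complex.abs_arg_lt_pi_div_two_iff.2 (Or.inl hu')
  have haq := Complex.abs_arg_lt_pi_div_two_iff.2 (Or.inl hw')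
  rw [abs_lt] at hap haq
  have hcp : (starRingEnd ℂ p).arg = -p.arg := by
    rw [Complex.arg_conj, if_neg]
    intro h; linarith [Real.pi_pos]
  have hp0 : p ≠ 0 := by rintro h; rw [h] at hu'; simp at hu'
  have hq0 : q ≠ 0 := by rintro h; rw [h] at hw'; simp at hw'
  rw [(Complex.arg_mul_eq_add_arg_iff ((map_ne_zero _).2 hp0) hq0).2, hcp]
  · ring
  · rw [hcp]; constructor <;> linarith

theorem continuousAt_signedAngle {m u : Plane} (hm : m ≠ 0) (hu : ‖u - m‖ ≤ ‖m‖ / 2) :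
    ContinuousAt (signedAngle m) u := by
  have : signedAngle m = Complex.arg ∘ fun u => starRingEnd ℂ (planeToComplex m) * planeToComplex u :=
    funext (signedAngle_eq_arg m)
  rw [this]
  refine ContinuousAt.comp (Complex.continuousAt_arg (Or.inl (conj_mul_planeToComplex_re_pos hm hu))) ?_
  exact (continuous_const.mul continuous_planeToComplex).continuousAt

/-- A continuous angle of a curve that stays near `m` changes as the signed angle from `m`. -/
theorem continuous_angle_sub_eq {R : ℝ → Plane} {θ : ℝ → ℝ} {m : Plane} {T : ℝ} (hT : 0 ≤ T)
    (hm : m ≠ 0) (hR : ContinuousOn R (Set.Icc 0 T)) (hθ : ContinuousOn θ (Set.Icc 0 T))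
    (hnear : ∀ t ∈ Set.Icc 0 T, ‖R t - m‖ ≤ ‖m‖ / 2)
    (hRθ : ∀ t ∈ Set.Icc 0 T, R t = ‖R t‖ • !₂[Real.cos (θ t), Real.sin (θ t)]) :
    θ T - θ 0 = signedAngle m (R T) - signedAngle m (R 0) := by
  set g : ℝ → ℝ := fun t => θ t - signedAngle m (R t) with hg
  have hgc : ContinuousOn g (Set.Icc 0 T) := hθ.sub fun t ht =>
    (continuousAt_signedAngle hm (hnear t ht)).comp_continuousWithinAt (hR t ht)
  have hang : ∀ t ∈ Set.Icc 0 T,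
      ((g t : ℝ) : Real.Angle) = -((starRingEnd ℂ (planeToComplex m)).arg : Real.Angle) := by
    intro t ht
    have hre := conj_mul_planeToComplex_re_pos hm (hnear t ht)
    have hne : starRingEnd ℂ (planeToComplex m) * planeToComplex (R t) ≠ 0 := fun h => by
      rw [h] at hre; simp at hre
    have hRt : 0 < ‖R t‖ := by
      rw [norm_pos_iff]; intro h
      apply hne; rw [h]; simp [planeToComplex, Complex.ext_iff]
    have h1 : planeToComplex (R t) =
        ((‖R t‖ : ℝ) : ℂ) * ((Real.cos (θ t) : ℝ) + (Real.sin (θ t) : ℝ) * Complex.I) := by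
      conv_lhs => rw [hRθ t ht]
      apply Complex.ext <;> simp [planeToComplex, -Complex.ofReal_cos, -Complex.ofReal_sin]
    have h2 : ((planeToComplex (R t)).arg : Real.Angle) = (θ t : Real.Angle) := by
      rw [h1]
      exact Complex.arg_mul_cos_add_sin_mul_I_coe_angle hRt (θ t : Real.Angle)
    rw [hg, Real.Angle.coe_sub, signedAngle_eq_arg,
      Complex.arg_mul_coe_angle (left_ne_zero_of_mul hne) (right_ne_zero_of_mul hne), h2]
    abel
  have h0 : (0 : ℝ) ∈ Set.Icc 0 T := ⟨le_rfl, hT⟩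
  -- The two angles agree modulo `2π` up to a constant, so their difference changes by whole turns;
  -- being continuous, it cannot pass through half a turn and hence is constant.
  have hint : ∀ t ∈ Set.Icc 0 T, ∃ k : ℤ, (g t - g 0) / (2 * Real.pi) = k := by
    intro t ht
    obtain ⟨k, hk⟩ := Real.Angle.angle_eq_iff_two_pi_dvd_sub.1 ((hang t ht).trans (hang 0 h0).symm)
    refine ⟨k, ?_⟩
    rw [hk]; field_simp
  suffices h : g T = g 0 by simp only [hg] at h; linarith
  by_contra hne
  obtain ⟨k, hk⟩ := hint T ⟨hT, le_rfl⟩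
  have hk0 : k ≠ 0 := by
    rintro rfl
    rw [Int.cast_zero, div_eq_zero_iff] at hk
    rcases hk with hk | hk
    · exact hne (sub_eq_zero.1 hk)
    · exact Real.pi_ne_zero (by linarith)
  have hcont : ContinuousOn (fun t => |(g t - g 0) / (2 * Real.pi)|) (Set.Icc 0 T) :=
    ((hgc.sub continuousOn_const).div_const _).abs
  have := intermediate_value_Icc hT hcont
  have h1 : (1 : ℝ) ≤ |(k : ℝ)| := by exact_mod_cast Int.one_le_abs hk0
  obtain ⟨t, ht, hgt⟩ := this (show (1 / 2 : ℝ) ∈ _ by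
    simp only [sub_self, zero_div, abs_zero, hk]
    constructor <;> linarith)
  obtain ⟨j, hj⟩ := hint t ht
  simp only [hj] at hgt
  have h3 : (2 : ℝ) * ((|j| : ℤ) : ℝ) = 1 := by rw [Int.cast_abs, hgt]; norm_num
  have h4 : 2 * |j| = 1 := by exact_mod_cast h3
  omega

/-! ### Derivatives along curves in the plane -/

section Curves

variable {x v : ℝ → Plane} {x' v' : Plane} {s : Set ℝ} {t : ℝ}

theorem HasDerivWithinAt.plane_apply (hx : HasDerivWithinAt x x' s t) (i : Fin 2) :
    HasDerivWithinAt (fun t => x t i) (x' i) s t :=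
  (EuclideanSpace.proj (𝕜 := ℝ) i).hasFDerivAt.comp_hasDerivWithinAt t hx

theorem HasDerivWithinAt.inner_left_const (hx : HasDerivWithinAt x x' s t) (m : Plane) :
    HasDerivWithinAt (fun t => ⟪m, x t⟫) ⟪m, x'⟫ s t := by
  simpa using (hasDerivWithinAt_const t s m).inner ℝ hx

theorem HasDerivWithinAt.norm_of_ne (hx : HasDerivWithinAt x x' s t) (h0 : x t ≠ 0) :
    HasDerivWithinAt (fun t => ‖x t‖) (⟪x t, x'⟫ / ‖x t‖) s t := by
  have h1 : ‖x t‖ ^ 2 ≠ 0 := pow_ne_zero _ (norm_ne_zero_iff.2 h0)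
  have h2 := hx.norm_sq.sqrt h1
  simp only [Real.sqrt_sq (norm_nonneg _)] at h2
  convert h2 using 1
  field_simp

theorem HasDerivWithinAt.angularMomentum (hx : HasDerivWithinAt x x' s t)
    (hv : HasDerivWithinAt v v' s t) :
    HasDerivWithinAt (fun t => angularMomentum (x t) (v t))
      (angularMomentum x' (v t) + angularMomentum (x t) v') s t := by
  have := ((hx.plane_apply 0).mul (hv.plane_apply 1)).sub ((hv.plane_apply 0).mul (hx.plane_apply 1))
  refine this.congr_deriv ?_
  simp only [_root_.angularMomentum]; ring

/-- The unit vector `x/|x|` rotates at the rate `(x × x')/|x|²`. This single identity serves the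
Kepler orbit, the straight drift and the modified system. -/
theorem HasDerivWithinAt.angularMomentum_unit (hx : HasDerivWithinAt x x' s t) (h0 : x t ≠ 0)
    (m : Plane) :
    HasDerivWithinAt (fun t => _root_.angularMomentum m (x t) / ‖x t‖)
      (_root_.angularMomentum (x t) x' * ⟪m, x t⟫ / ‖x t‖ ^ 3) s t := by
  have hn : ‖x t‖ ≠ 0 := norm_ne_zero_iff.2 h0
  have h1 := ((hasDerivWithinAt_const t s m).angularMomentum hx).div (hx.norm_of_ne h0) hn
  refine h1.congr_deriv ?_
  have hsq := norm_sq_plane (x t)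
  simp only [_root_.angularMomentum, inner_plane, PiLp.zero_apply]
  field_simp
  rw [hsq]; ring

theorem HasDerivWithinAt.inner_unit (hx : HasDerivWithinAt x x' s t) (h0 : x t ≠ 0)
    (m : Plane) :
    HasDerivWithinAt (fun t => ⟪m, x t⟫ / ‖x t‖)
      (-(_root_.angularMomentum (x t) x' * _root_.angularMomentum m (x t) / ‖x t‖ ^ 3)) s t := by
  have hn : ‖x t‖ ≠ 0 := norm_ne_zero_iff.2 h0
  have h1 := (hx.inner_left_const m).div (hx.norm_of_ne h0) hn
  refine h1.congr_deriv ?_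
  have hsq := norm_sq_plane (x t)
  simp only [_root_.angularMomentum, inner_plane]
  field_simp
  rw [hsq]; ring

/-- The quadratic form `D²u(x)[v, v]` of the function `u(x) = ⟪m, x⟫ / |x|³`. -/
noncomputable def dipoleHessian (m x v : Plane) : ℝ :=
  -6 * (⟪x, v⟫ * ⟪m, v⟫ / ‖x‖ ^ 5) - 3 * (‖v‖ ^ 2 * ⟪m, x⟫ / ‖x‖ ^ 5) +
    15 * (⟪x, v⟫ ^ 2 * ⟪m, x⟫ / ‖x‖ ^ 7)

theorem HasDerivWithinAt.dipole (hx : HasDerivWithinAt x x' s t) (h0 : x t ≠ 0) (m : Plane) :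
    HasDerivWithinAt (fun t => ⟪m, x t⟫ / ‖x t‖ ^ 3)
      (⟪m, x'⟫ / ‖x t‖ ^ 3 - 3 * (⟪x t, x'⟫ * ⟪m, x t⟫ / ‖x t‖ ^ 5)) s t := by
  have hn : ‖x t‖ ≠ 0 := norm_ne_zero_iff.2 h0
  have h1 := (hx.inner_left_const m).div ((hx.norm_of_ne h0).pow 3) (pow_ne_zero 3 hn)
  refine h1.congr_deriv ?_
  simp only [Pi.pow_apply]
  field_simp
  push_cast
  ring

/-- The second derivative of `u` along a curve is `D²u[v, v] + Du[v']`. On a drift the second term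
is absent; on a Kepler orbit it equals `2⟪m, x⟫/|x|⁶`. -/
theorem HasDerivWithinAt.dipole_deriv (hx : HasDerivWithinAt x (v t) s t)
    (hv : HasDerivWithinAt v v' s t) (h0 : x t ≠ 0) (m : Plane) :
    HasDerivWithinAt (fun t => ⟪m, v t⟫ / ‖x t‖ ^ 3 - 3 * (⟪x t, v t⟫ * ⟪m, x t⟫ / ‖x t‖ ^ 5))
      (dipoleHessian m (x t) (v t) +
        (⟪m, v'⟫ / ‖x t‖ ^ 3 - 3 * (⟪x t, v'⟫ * ⟪m, x t⟫ / ‖x t‖ ^ 5))) s t := by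
  have hn : ‖x t‖ ≠ 0 := norm_ne_zero_iff.2 h0
  have h1 := ((hv.inner_left_const m).div ((hx.norm_of_ne h0).pow 3) (pow_ne_zero 3 hn)).sub
    ((((hx.inner ℝ hv).mul (hx.inner_left_const m)).div ((hx.norm_of_ne h0).pow 5)
      (pow_ne_zero 5 hn)).const_mul 3)
  refine h1.congr_deriv ?_
  simp only [dipoleHessian, real_inner_self_eq_norm_sq, real_inner_comm, Pi.mul_apply, Pi.pow_apply]
  field_simp
  push_cast
  ring

end Curves

/-! ### The Laplace-Runge-Lenz vector and the force -/

/-- In the plane `|v|²x - ⟪x, v⟫v` is `-(x × v)` times the quarter turn of `v`. Once the angular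
momentum is a constant, the first term is linear in the velocity, which is why this component is
used throughout. -/
theorem angularMomentum_lrlVector (m x v : Plane) :
    angularMomentum m (lrlVector x v) =
      -(angularMomentum x v * ⟪m, v⟫) - angularMomentum m x / ‖x‖ := by
  simp only [lrlVector, angularMomentum, norm_sq_plane, inner_plane, PiLp.sub_apply,
    PiLp.smul_apply, smul_eq_mul]
  ring

/-- With both invariants constant this is the equation of the orbit as a conic with focus at the
origin. -/
theorem inner_lrlVector_left (x v : Plane) :
    ⟪lrlVector x v, x⟫ = angularMomentum x v ^ 2 - ‖x‖ := by
  have h := inner_sq_add_angularMomentum_sq x v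
  simp only [lrlVector, inner_sub_left, real_inner_smul_left, real_inner_self_eq_norm_sq,
    real_inner_comm x v]
  by_cases hx : ‖x‖ = 0
  · simp only [hx] at h ⊢; simp; nlinarith
  · field_simp; linarith

theorem eq_of_forall_angularMomentum_eq {x y : Plane}
    (h : ∀ m, angularMomentum m x = angularMomentum m y) : x = y := by
  have h0 := h !₂[0, 1]
  have h1 := h !₂[1, 0]
  simp [angularMomentum] at h0 h1
  exact plane_ext h0 h1

theorem eq_of_forall_inner_eq {x y : Plane} (h : ∀ m : Plane, ⟪m, x⟫ = ⟪m, y⟫) : x = y :=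
  ext_inner_left ℝ h

theorem inner_keplerForce (m x : Plane) : ⟪m, keplerForce x⟫ = -(⟪m, x⟫ / ‖x‖ ^ 3) := by
  rw [keplerForce, inner_neg_right, real_inner_smul_right]; ring

theorem angularMomentum_keplerForce (m x : Plane) :
    angularMomentum m (keplerForce x) = -(angularMomentum m x / ‖x‖ ^ 3) := by
  simp only [keplerForce, angularMomentum, PiLp.neg_apply, PiLp.smul_apply, smul_eq_mul]; ring

/-- The region `ρ ≤ |x|` is not convex, so the bound comes from the factorization of `|x|⁻³ - |y|⁻³`
rather than from the mean value inequality. -/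
theorem norm_keplerForce_sub_le {x y : Plane} {ρ : ℝ} (hρ : 0 < ρ) (hx : ρ ≤ ‖x‖) (hy : ρ ≤ ‖y‖) :
    ‖keplerForce x - keplerForce y‖ ≤ 4 / ρ ^ 3 * ‖x - y‖ := by
  have hx0 : 0 < ‖x‖ := hρ.trans_le hx
  have hy0 : 0 < ‖y‖ := hρ.trans_le hy
  have h1 : keplerForce x - keplerForce y =
      -((‖x‖ ^ 3)⁻¹ • (x - y)) - ((‖x‖ ^ 3)⁻¹ - (‖y‖ ^ 3)⁻¹) • y := by
    simp only [keplerForce]; module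
  have h2 : (‖x‖ ^ 3)⁻¹ - (‖y‖ ^ 3)⁻¹ = (‖y‖ - ‖x‖) * ((‖x‖ ^ 3)⁻¹ * ‖y‖⁻¹ +
      (‖x‖ ^ 2)⁻¹ * (‖y‖ ^ 2)⁻¹ + ‖x‖⁻¹ * (‖y‖ ^ 3)⁻¹) := by
    field_simp; ring
  have h3 : |‖y‖ - ‖x‖| ≤ ‖x - y‖ := by
    rw [norm_sub_rev]; exact abs_norm_sub_norm_le y x
  have h4 : ((‖x‖ ^ 3)⁻¹ * ‖y‖⁻¹ + (‖x‖ ^ 2)⁻¹ * (‖y‖ ^ 2)⁻¹ + ‖x‖⁻¹ * (‖y‖ ^ 3)⁻¹) * ‖y‖ ≤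
      3 / ρ ^ 3 := by
    have e : ((‖x‖ ^ 3)⁻¹ * ‖y‖⁻¹ + (‖x‖ ^ 2)⁻¹ * (‖y‖ ^ 2)⁻¹ + ‖x‖⁻¹ * (‖y‖ ^ 3)⁻¹) * ‖y‖ =
        (‖x‖ ^ 3)⁻¹ + (‖x‖ ^ 2)⁻¹ * ‖y‖⁻¹ + ‖x‖⁻¹ * (‖y‖ ^ 2)⁻¹ := by field_simp
    rw [e]
    calc _ ≤ (ρ ^ 3)⁻¹ + (ρ ^ 2)⁻¹ * ρ⁻¹ + ρ⁻¹ * (ρ ^ 2)⁻¹ := by gcongr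
      _ = 3 / ρ ^ 3 := by field_simp; ring
  rw [h1]
  refine (norm_sub_le _ _).trans ?_
  rw [norm_neg, norm_smul, norm_smul, h2, norm_inv, norm_pow, norm_norm, norm_mul, Real.norm_eq_abs,
    Real.norm_of_nonneg (by positivity : 0 ≤ (‖x‖ ^ 3)⁻¹ * ‖y‖⁻¹ +
      (‖x‖ ^ 2)⁻¹ * (‖y‖ ^ 2)⁻¹ + ‖x‖⁻¹ * (‖y‖ ^ 3)⁻¹), mul_assoc]
  calc _ ≤ (ρ ^ 3)⁻¹ * ‖x - y‖ + ‖x - y‖ * (3 / ρ ^ 3) := by gcongr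
    _ = _ := by ring

/-! ### Kepler orbits -/

namespace IsKeplerSolution

variable {X V : ℝ → Plane} (hX : IsKeplerSolution X V)
include hX

theorem angularMomentum_eq (t : ℝ) :
    angularMomentum (X t) (V t) = angularMomentum (X 0) (V 0) := by
  have h : ∀ t, HasDerivAt (fun t => angularMomentum (X t) (V t)) 0 t := fun t => by
    rw [← hasDerivWithinAt_univ]
    refine ((hX.hasDerivAt_pos t).hasDerivWithinAt.angularMomentum
      (hX.hasDerivAt_vel t).hasDerivWithinAt).congr_deriv ?_
    rw [angularMomentum_keplerForce, angularMomentum_self, angularMomentum_self]; simp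
  exact is_const_of_deriv_eq_zero (fun t => (h t).differentiableAt) (fun t => (h t).deriv) t 0

theorem lrlVector_eq (t : ℝ) : lrlVector (X t) (V t) = lrlVector (X 0) (V 0) := by
  refine eq_of_forall_angularMomentum_eq fun m => ?_
  rw [angularMomentum_lrlVector, angularMomentum_lrlVector, hX.angularMomentum_eq]
  have h : ∀ t, HasDerivAt (fun t => -(angularMomentum (X 0) (V 0) * ⟪m, V t⟫) -
      angularMomentum m (X t) / ‖X t‖) 0 t := fun t => by
    rw [← hasDerivWithinAt_univ]
    refine ((((hX.hasDerivAt_vel t).hasDerivWithinAt.inner_left_const m).const_mul _).neg.sub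
      ((hX.hasDerivAt_pos t).hasDerivWithinAt.angularMomentum_unit (hX.ne_zero t) m)).congr_deriv ?_
    rw [hX.angularMomentum_eq t, inner_keplerForce]; ring
  exact is_const_of_deriv_eq_zero (fun t => (h t).differentiableAt) (fun t => (h t).deriv) t 0

theorem norm_pos (t : ℝ) : 0 < ‖X t‖ := norm_pos_iff.2 (hX.ne_zero t)

theorem norm_eq (t : ℝ) :
    ‖X t‖ = angularMomentum (X 0) (V 0) ^ 2 - ⟪lrlVector (X 0) (V 0), X t⟫ := by
  have := inner_lrlVector_left (X t) (V t)
  rw [hX.lrlVector_eq, hX.angularMomentum_eq] at this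
  linarith

theorem continuous_pos : Continuous X :=
  continuous_iff_continuousAt.2 fun t => (hX.hasDerivAt_pos t).continuousAt

theorem continuous_vel : Continuous V :=
  continuous_iff_continuousAt.2 fun t => (hX.hasDerivAt_vel t).continuousAt

theorem contDiff (n : ℕ) : ContDiff ℝ n X ∧ ContDiff ℝ n V := by
  induction n with
  | zero => exact ⟨contDiff_zero.2 hX.continuous_pos, contDiff_zero.2 hX.continuous_vel⟩
  | succ n ih =>
    have h1 : deriv X = V := funext fun t => (hX.hasDerivAt_pos t).deriv
    have h2 : deriv V = fun t => keplerForce (X t) := funext fun t => (hX.hasDerivAt_vel t).deriv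
    push_cast
    refine ⟨contDiff_succ_iff_deriv.2 ⟨fun t => (hX.hasDerivAt_pos t).differentiableAt, by simp, ?_⟩,
      contDiff_succ_iff_deriv.2 ⟨fun t => (hX.hasDerivAt_vel t).differentiableAt, by simp, ?_⟩⟩
    · rw [h1]; exact ih.2
    · rw [h2]
      have : ContDiff ℝ n fun t => ‖X t‖ := ih.1.norm ℝ hX.ne_zero
      exact (((this.pow 3).inv fun t => pow_ne_zero 3 (hX.norm_pos t).ne').smul ih.1).neg

theorem exists_angle : ∃ φ : ℝ → ℝ, φ 0 = 0 ∧
    ∀ t, HasDerivAt φ (angularMomentum (X 0) (V 0) / ‖X t‖ ^ 2) t := by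
  have hc : Continuous fun t => angularMomentum (X 0) (V 0) / ‖X t‖ ^ 2 :=
    continuous_const.div (hX.continuous_pos.norm.pow 2) fun t => pow_ne_zero 2 (hX.norm_pos t).ne'
  exact ⟨fun t => ∫ s in (0 : ℝ)..t, angularMomentum (X 0) (V 0) / ‖X s‖ ^ 2, by simp,
    fun t => hc.integral_hasStrictDerivAt 0 t |>.hasDerivAt⟩

variable {φ : ℝ → ℝ} (hφ0 : φ 0 = 0)
  (hφ : ∀ t, HasDerivAt φ (angularMomentum (X 0) (V 0) / ‖X t‖ ^ 2) t)
include hφ0 hφ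

/-- The direction of `X`, read off against `m`, turns at the rate `φ'`; turning it back by `φ` gives
a vector with zero derivative. -/
theorem unit_rotation (m : Plane) (t : ℝ) :
    ⟪m, X t⟫ / ‖X t‖ * Real.cos (φ t) + angularMomentum m (X t) / ‖X t‖ * Real.sin (φ t) =
      ⟪m, X 0⟫ / ‖X 0‖ ∧
    angularMomentum m (X t) / ‖X t‖ * Real.cos (φ t) - ⟪m, X t⟫ / ‖X t‖ * Real.sin (φ t) =
      angularMomentum m (X 0) / ‖X 0‖ := by
  have hc := fun t => (hX.hasDerivAt_pos t).hasDerivWithinAt (s := Set.univ)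
    |>.inner_unit (hX.ne_zero t) m
  have hd := fun t => (hX.hasDerivAt_pos t).hasDerivWithinAt (s := Set.univ)
    |>.angularMomentum_unit (hX.ne_zero t) m
  simp only [hasDerivWithinAt_univ] at hc hd
  have h1 : ∀ t, HasDerivAt (fun t => ⟪m, X t⟫ / ‖X t‖ * Real.cos (φ t) +
      angularMomentum m (X t) / ‖X t‖ * Real.sin (φ t)) 0 t := fun t => by
    refine (((hc t).mul (hφ t).cos).add ((hd t).mul (hφ t).sin)).congr_deriv ?_
    rw [hX.angularMomentum_eq t]
    have := (hX.norm_pos t).ne'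
    field_simp; ring
  have h2 : ∀ t, HasDerivAt (fun t => angularMomentum m (X t) / ‖X t‖ * Real.cos (φ t) -
      ⟪m, X t⟫ / ‖X t‖ * Real.sin (φ t)) 0 t := fun t => by
    refine (((hd t).mul (hφ t).cos).sub ((hc t).mul (hφ t).sin)).congr_deriv ?_
    rw [hX.angularMomentum_eq t]
    have := (hX.norm_pos t).ne'
    field_simp; ring
  constructor
  · have := is_const_of_deriv_eq_zero (fun t => (h1 t).differentiableAt) (fun t => (h1 t).deriv) t 0
    simpa [hφ0] using this
  · have := is_const_of_deriv_eq_zero (fun t => (h2 t).differentiableAt) (fun t => (h2 t).deriv) t 0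
    simpa [hφ0] using this

/-- A full turn restores the direction of `X`; the orbit equation then restores the radius, the two
invariants restore the velocity, and uniqueness for the ODE gives periodicity. -/
theorem periodic_of_cos_eq_one (hL : angularMomentum (X 0) (V 0) ≠ 0) {τ : ℝ}
    (hτ : Real.cos (φ τ) = 1) : Function.Periodic X τ := by
  have hs : Real.sin (φ τ) = 0 := by
    have := Real.sin_sq_add_cos_sq (φ τ); rw [hτ] at this; nlinarith
  have hu := fun m => hX.unit_rotation hφ0 hφ m τ
  simp only [hτ, hs, mul_one, mul_zero, add_zero, sub_zero] at hu
  have hnτ := hX.norm_pos τ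
  have hn0 := hX.norm_pos 0
  have hn : ‖X τ‖ = ‖X 0‖ := by
    have h1 := (hu (lrlVector (X 0) (V 0))).1
    have h2 := hX.norm_eq τ
    have h3 := hX.norm_eq 0
    rw [div_eq_div_iff hnτ.ne' hn0.ne'] at h1
    have h4 : angularMomentum (X 0) (V 0) ^ 2 * (‖X τ‖ - ‖X 0‖) = 0 := by
      linear_combination ‖X 0‖ * h2 - ‖X τ‖ * h3 - h1
    rcases mul_eq_zero.1 h4 with h | h
    · exact absurd h (pow_ne_zero 2 hL)
    · linarith
  have hXτ : X τ = X 0 := eq_of_forall_inner_eq fun m => by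
    have := (hu m).1
    rwa [hn, div_left_inj' hn0.ne'] at this
  have hVτ : V τ = V 0 := eq_of_forall_inner_eq fun m => by
    have h1 := angularMomentum_lrlVector m (X τ) (V τ)
    have h2 := angularMomentum_lrlVector m (X 0) (V 0)
    rw [hX.lrlVector_eq, hX.angularMomentum_eq, hXτ] at h1
    have h3 : angularMomentum (X 0) (V 0) * (⟪m, V τ⟫ - ⟪m, V 0⟫) = 0 := by linarith
    rcases mul_eq_zero.1 h3 with h | h
    · exact absurd h hL
    · linarith
  -- By Cauchy-Schwarz in the orbit equation, `L² ≤ (1 + |m|)|X|`. This keeps the orbit for all time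
  -- in a region where the force is Lipschitz.
  set ρ : ℝ := angularMomentum (X 0) (V 0) ^ 2 / (1 + ‖lrlVector (X 0) (V 0)‖) with hρdef
  have hρ : 0 < ρ := by positivity
  have hρX : ∀ t, ρ ≤ ‖X t‖ := fun t => by
    rw [hρdef, div_le_iff₀ (by positivity)]
    have h1 := hX.norm_eq t
    have h2 := real_inner_le_norm (lrlVector (X 0) (V 0)) (X t)
    linarith
  have huniq := ODE_solution_unique_univ (E := Plane × Plane) (t₀ := 0)
    (v := fun _ y => (y.2, keplerForce y.1)) (s := fun _ => {y | ρ ≤ ‖y.1‖})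
    (K := Real.toNNReal (max 1 (4 / ρ ^ 3)))
    (f := fun t => (X (t + τ), V (t + τ))) (g := fun t => (X t, V t)) ?_ ?_ ?_ ?_
  · intro t
    exact congrArg Prod.fst (congrFun huniq t)
  · intro t
    refine LipschitzOnWith.of_dist_le_mul fun y hy z hz => ?_
    rw [Real.coe_toNNReal _ (by positivity), Prod.dist_eq, Prod.dist_eq]
    refine max_le ?_ ?_
    · calc dist y.2 z.2 ≤ 1 * max (dist y.1 z.1) (dist y.2 z.2) := by
            rw [one_mul]; exact le_max_right _ _
        _ ≤ _ := by gcongr; exact le_max_left _ _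
    · rw [dist_eq_norm]
      refine (norm_keplerForce_sub_le hρ hy hz).trans ?_
      rw [← dist_eq_norm]
      gcongr
      · exact le_max_right _ _
      · exact le_max_left _ _
  · exact fun t => ⟨((hX.hasDerivAt_pos (t + τ)).comp_add_const t τ).prodMk
      ((hX.hasDerivAt_vel (t + τ)).comp_add_const t τ), hρX _⟩
  · exact fun t => ⟨(hX.hasDerivAt_pos t).prodMk (hX.hasDerivAt_vel t), hρX _⟩
  · simp [hXτ, hVτ]

/-- Over a minimal period the polar angle makes exactly one turn. -/
theorem angle_minimalPeriod (hL : angularMomentum (X 0) (V 0) ≠ 0) {T : ℝ}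
    (hT : IsMinimalPeriod X T) :
    φ T = 2 * Real.pi * Real.sign (angularMomentum (X 0) (V 0)) := by
  set L := angularMomentum (X 0) (V 0) with hLdef
  have hT0 : 0 < T := hT.1.1
  have hXT : X T = X 0 := by simpa using hT.1.2 0
  have hsign : Real.sign L * Real.sign L = 1 := by
    rcases Real.sign_apply_eq_of_ne_zero L hL with h | h <;> rw [h] <;> norm_num
  have hpos : 0 < Real.sign L * L := by
    rcases lt_or_gt_of_ne hL with h | h
    · rw [Real.sign_of_neg h]; linarith
    · rw [Real.sign_of_pos h]; linarith
  -- The sign makes the angle increasing for either orientation.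
  set ψ : ℝ → ℝ := fun t => Real.sign L * φ t with hψ
  have hψd : ∀ t, HasDerivAt ψ (Real.sign L * (L / ‖X t‖ ^ 2)) t := fun t => (hφ t).const_mul _
  have hmono : StrictMono ψ := strictMono_of_deriv_pos fun t => by
    rw [(hψd t).deriv, ← mul_div_assoc]
    have := hX.norm_pos t
    positivity
  have hcosψ : ∀ t, Real.cos (ψ t) = Real.cos (φ t) := fun t => by
    rcases Real.sign_apply_eq_of_ne_zero L hL with h | h <;> simp [hψ, h]
  have hcosT : Real.cos (φ T) = 1 := by
    have h1 := (hX.unit_rotation hφ0 hφ (X 0) T).1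
    rw [hXT, angularMomentum_self] at h1
    have h2 : ⟪X 0, X 0⟫ / ‖X 0‖ ≠ 0 :=
      div_ne_zero (inner_self_ne_zero.2 (hX.ne_zero 0)) (hX.norm_pos 0).ne'
    simp only [zero_div, zero_mul, add_zero] at h1
    exact mul_left_cancel₀ h2 (by rw [h1, mul_one])
  have hψ0 : ψ 0 = 0 := by simp [hψ, hφ0]
  have hψT : 0 < ψ T := hψ0 ▸ hmono hT0
  obtain ⟨k, hk⟩ := (Real.cos_eq_one_iff _).1 ((hcosψ T).trans hcosT)
  have hpi := Real.pi_pos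
  have hk1 : 0 < k := by
    have : (0 : ℝ) < k := by
      by_contra h
      nlinarith
    exact_mod_cast this
  suffices h : k = 1 by
    rw [h, Int.cast_one, one_mul] at hk
    have : Real.sign L * (Real.sign L * φ T) = φ T := by rw [← mul_assoc, hsign, one_mul]
    rw [← this]
    simp only [hψ] at hk
    rw [← hk]; ring
  -- With two or more turns, `ψ` would take the value `2π` strictly before `T`, and that time would
  -- already be a period.
  by_contra hne
  have hk2 : (2 : ℝ) ≤ k := by exact_mod_cast (by omega : 2 ≤ k)
  have hcont : ContinuousOn ψ (Set.Icc 0 T) := fun t _ => (hψd t).continuousAt.continuousWithinAt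
  obtain ⟨τ, hτ, hψτ⟩ := intermediate_value_Icc hT0.le hcont
    (show 2 * Real.pi ∈ _ by rw [hψ0]; constructor <;> nlinarith)
  have hτ0 : 0 < τ := lt_of_le_of_ne hτ.1 fun h => by rw [← h, hψ0] at hψτ; linarith
  have hτT : τ < T := lt_of_le_of_ne hτ.2 fun h => by rw [h, ← hk] at hψτ; nlinarith
  have := hT.2 ⟨hτ0, hX.periodic_of_cos_eq_one hφ0 hφ hL
    (by rw [← hcosψ, hψτ, Real.cos_two_pi])⟩
  linarith

end IsKeplerSolution

/-! ### The shape of the orbit and the average along it -/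

theorem inner_rotPlane (p u : Plane) : ⟪p, rotPlane u⟫ = angularMomentum u p := by
  simp only [inner_plane, rotPlane, angularMomentum, Matrix.cons_val_zero,
    Matrix.cons_val_one]
  ring

/-- An ellipse that lies on the conic `|p| = ℓ - ⟪m, p⟫` has semilatus rectum `ℓ` and
eccentricity `|m|`. -/
theorem IsEllipse.conic_parameters {S : Set Plane} {a b ℓ : ℝ} {m : Plane} (hS : IsEllipse S a b)
    (hba : b < a) (hℓ : 0 ≤ ℓ) (h : ∀ p ∈ S, ‖p‖ = ℓ - ⟪m, p⟫) :
    ℓ = b ^ 2 / a ∧ ‖m‖ ^ 2 = 1 - b ^ 2 / a ^ 2 := by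
  obtain ⟨hb, -, c, u, hu, rfl⟩ := hS
  have ha : 0 < a := hb.trans hba
  have hu2 : u 0 ^ 2 + u 1 ^ 2 = 1 := by rw [← norm_sq_plane, hu, one_pow]
  have hframe : ∀ p : Plane, ‖p‖ ^ 2 = ⟪p, u⟫ ^ 2 + angularMomentum u p ^ 2 := fun p => by
    have := inner_sq_add_angularMomentum_sq u p
    rw [hu, real_inner_comm] at this; linarith
  have hinner : ∀ p : Plane, ⟪m, p⟫ = ⟪m, u⟫ * ⟪p, u⟫ + angularMomentum u m * angularMomentum u p :=
    fun p => by
      simp only [inner_plane, angularMomentum]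
      linear_combination (-(m 0 * p 0) - m 1 * p 1) * hu2
  -- The squared conic equation at the point of the ellipse with parameters `(C, D)`, in the
  -- coordinates along `u` and `rotPlane u`. Four vertices and the rational point `(3/5, 4/5)` yield
  -- enough equations; the last one isolates the cross term `r₁ r₂`.
  have hpt : ∀ C D : ℝ, C ^ 2 + D ^ 2 = 1 →
      (⟪c, u⟫ + a * C) ^ 2 + (angularMomentum u c + b * D) ^ 2 =
        (ℓ - (⟪m, u⟫ * (⟪c, u⟫ + a * C) + angularMomentum u m * (angularMomentum u c + b * D))) ^ 2 := by
    intro C D hCD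
    set p : Plane := c + (a * C) • u + (b * D) • rotPlane u with hp
    have hru : ⟪rotPlane u, u⟫ = 0 := by
      rw [real_inner_comm, inner_rotPlane, angularMomentum_self]
    have hur : angularMomentum u (rotPlane u) = 1 := by
      simp only [rotPlane, angularMomentum, PiLp.toLp_apply, Matrix.cons_val_zero,
        Matrix.cons_val_one]
      linarith
    have h1 : ⟪p, u⟫ = ⟪c, u⟫ + a * C := by
      rw [hp, inner_add_left, inner_add_left, real_inner_smul_left, real_inner_smul_left, hru,
        real_inner_self_eq_norm_sq, hu]
      ring
    have h2 : angularMomentum u p = angularMomentum u c + b * D := by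
      rw [hp, angularMomentum_add_right, angularMomentum_add_right, angularMomentum_smul_right,
        angularMomentum_smul_right, angularMomentum_self, hur]
      ring
    have hpS : (⟪p - c, u⟫ / a) ^ 2 + (⟪p - c, rotPlane u⟫ / b) ^ 2 = 1 := by
      rw [inner_sub_left, inner_rotPlane, angularMomentum_sub_right, h1, h2, ← hCD]
      field_simp
      ring
    rw [← h1, ← h2, ← hframe, ← hinner, h p hpS]
  have hm := hframe m
  set r₁ := ⟪m, u⟫
  set r₂ := angularMomentum u m
  set c₁ := ⟪c, u⟫
  set c₂ := angularMomentum u c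
  obtain ⟨μ, hμ⟩ : ∃ μ, μ = ℓ - r₁ * c₁ - r₂ * c₂ := ⟨_, rfl⟩
  have e1 := hpt 1 0 (by norm_num)
  have e2 := hpt (-1) 0 (by norm_num)
  have e3 := hpt 0 1 (by norm_num)
  have e4 := hpt 0 (-1) (by norm_num)
  have e5 := hpt (3 / 5) (4 / 5) (by norm_num)
  obtain rfl : ℓ = μ + r₁ * c₁ + r₂ * c₂ := by linarith
  have f1 : c₁ = -μ * r₁ := mul_left_cancel₀ ha.ne' (by linear_combination e1 / 4 - e2 / 4)
  have f2 : c₂ = -μ * r₂ := mul_left_cancel₀ hb.ne' (by linear_combination e3 / 4 - e4 / 4)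
  have f3 : c₁ ^ 2 + a ^ 2 + c₂ ^ 2 = μ ^ 2 + r₁ ^ 2 * a ^ 2 := by
    linear_combination e1 / 2 + e2 / 2
  have f4 : c₁ ^ 2 + c₂ ^ 2 + b ^ 2 = μ ^ 2 + r₂ ^ 2 * b ^ 2 := by
    linear_combination e3 / 2 + e4 / 2
  have f5 : r₁ * r₂ = 0 := by
    have : (a * b) * (r₁ * r₂) = (a * b) * 0 := by
      linear_combination (-25 / 24) * e5 + (25 / 24) * (9 / 25) * f3 + (25 / 24) * (16 / 25) * f4 +
        (25 / 24) * (6 / 5 * a) * f1 + (25 / 24) * (8 / 5 * b) * f2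
    exact mul_left_cancel₀ (by positivity) this
  -- If instead `r₁ = 0`, the equations `f3` and `f4` give `b² = a² + r₂²b²`, against `b < a`. So
  -- `m` lies along the major axis.
  have hr2 : r₂ = 0 := by
    rcases mul_eq_zero.1 f5 with h1 | h1
    · rw [h1] at f3
      nlinarith [mul_nonneg (sq_nonneg r₂) (sq_nonneg b)]
    · exact h1
  rw [hr2] at f2 f4 hm
  have f6 : a ^ 2 * r₁ ^ 2 = a ^ 2 - b ^ 2 := by linarith
  have f7 : μ ^ 2 = a ^ 2 := by
    have : b ^ 2 * (μ ^ 2 - a ^ 2) = 0 := by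
      rw [f1, f2] at f3
      linear_combination -(a ^ 2) * f3 + (μ ^ 2 - a ^ 2) * f6
    rcases mul_eq_zero.1 this with h1 | h1
    · exact absurd h1 (by positivity)
    · linarith
  have f8 : a ^ 2 * (μ + r₁ * c₁ + r₂ * c₂) = μ * b ^ 2 := by
    rw [hr2, f1]; linear_combination -μ * f6
  -- Squaring lost the sign of `μ`; it is recovered from `0 ≤ ℓ`.
  have hμa : μ = a := by
    rcases sq_eq_sq_iff_eq_or_eq_neg.1 f7 with h1 | h1
    · exact h1
    · exfalso
      have h2 : 0 ≤ a ^ 2 * (μ + r₁ * c₁ + r₂ * c₂) := by positivity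
      rw [f8, h1] at h2
      nlinarith [mul_pos ha (sq_pos_of_pos hb)]
  constructor
  · rw [eq_div_iff ha.ne']
    apply mul_left_cancel₀ ha.ne'
    rw [hμa] at f8 ⊢
    linear_combination f8
  · rw [hm]
    field_simp
    linear_combination f6

namespace IsKeplerSolution

variable {X V : ℝ → Plane} (hX : IsKeplerSolution X V)
include hX

theorem angularMomentum_sq_and_norm_lrlVector_sq {a b : ℝ} (horbit : IsEllipse (Set.range X) a b)
    (hba : b < a) : angularMomentum (X 0) (V 0) ^ 2 = b ^ 2 / a ∧
      ‖lrlVector (X 0) (V 0)‖ ^ 2 = 1 - b ^ 2 / a ^ 2 :=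
  horbit.conic_parameters hba (sq_nonneg _) (by rintro _ ⟨t, rfl⟩; exact hX.norm_eq t)

theorem periodic_vel {T : ℝ} (hT : Function.Periodic X T) : V T = V 0 := by
  have h1 : HasDerivAt (fun t => X (t + T)) (V (0 + T)) 0 :=
    (hX.hasDerivAt_pos (0 + T)).comp_add_const 0 T
  rw [funext hT] at h1
  simpa using h1.unique (hX.hasDerivAt_pos 0)

/-- A primitive of the dipole Hessian along the orbit, and its increment over a period. -/
theorem exists_primitive_dipoleHessian (hL : angularMomentum (X 0) (V 0) ≠ 0) {T : ℝ}
    (hT : IsMinimalPeriod X T) :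
    ∃ W : ℝ → ℝ, (∀ t, HasDerivAt W (dipoleHessian (lrlVector (X 0) (V 0)) (X t) (V t)) t) ∧
      W T - W 0 = -(Real.pi * (6 * ‖lrlVector (X 0) (V 0)‖ ^ 2 +
        3 / 2 * ‖lrlVector (X 0) (V 0)‖ ^ 4) * Real.sign (angularMomentum (X 0) (V 0))) /
          angularMomentum (X 0) (V 0) ^ 7 := by
  obtain ⟨φ, hφ0, hφ⟩ := hX.exists_angle
  have hφT := hX.angle_minimalPeriod hφ0 hφ hL hT
  have hXT : X T = X 0 := by simpa using hT.1.2 0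
  have hVT : V T = V 0 := hX.periodic_vel hT.1.2
  set m := lrlVector (X 0) (V 0) with hm
  set L := angularMomentum (X 0) (V 0) with hLdef
  set e := ‖m‖ ^ 2 with he
  set c : ℝ → ℝ := fun t => ⟪m, X t⟫ / ‖X t‖ with hc
  set d : ℝ → ℝ := fun t => angularMomentum m (X t) / ‖X t‖ with hd
  have hc' : ∀ t, HasDerivAt c (-(L / ‖X t‖ ^ 2 * d t)) t := fun t => by
    have := (hX.hasDerivAt_pos t).hasDerivWithinAt (s := Set.univ) |>.inner_unit (hX.ne_zero t) m
    rw [hasDerivWithinAt_univ, hX.angularMomentum_eq t, ← hLdef] at this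
    refine this.congr_deriv ?_
    have := (hX.norm_pos t).ne'
    simp only [hd]; field_simp
  have hd' : ∀ t, HasDerivAt d (L / ‖X t‖ ^ 2 * c t) t := fun t => by
    have := (hX.hasDerivAt_pos t).hasDerivWithinAt (s := Set.univ)
      |>.angularMomentum_unit (hX.ne_zero t) m
    rw [hasDerivWithinAt_univ, hX.angularMomentum_eq t, ← hLdef] at this
    refine this.congr_deriv ?_
    have := (hX.norm_pos t).ne'
    simp only [hc]; field_simp
  have hcd : ∀ t, d t ^ 2 = e - c t ^ 2 := fun t => by
    have h1 := inner_sq_add_angularMomentum_sq m (X t)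
    have := (hX.norm_pos t).ne'
    simp only [hd, hc, he]; field_simp; linarith
  have hr : ∀ t, ‖X t‖ * (1 + c t) = L ^ 2 := fun t => by
    have h1 := hX.norm_eq t
    have := (hX.norm_pos t).ne'
    simp only [hc]; field_simp; linarith
  -- The first two terms are `Du(X)[V]`. The bracket is an antiderivative of `c(1 + c)³` in `φ`,
  -- where `dc/dφ = -d`, `dd/dφ = c` and `c² + d² = e = |m|²`. Its only non-periodic part is the `φ`
  -- term, from the means `e/2` of `c²` and `3e²/8` of `c⁴`.
  refine ⟨fun t => ⟪m, V t⟫ / ‖X t‖ ^ 3 - 3 * (⟪X t, V t⟫ * ⟪m, X t⟫ / ‖X t‖ ^ 5) -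
    2 / L ^ 7 * (d t + 3 / 2 * (c t * d t) + (2 * e * d t + c t ^ 2 * d t) + c t ^ 3 * d t / 4 +
      3 * e / 8 * (c t * d t) + (3 / 2 * e + 3 / 8 * e ^ 2) * φ t), fun t => ?_, ?_⟩
  · have h1 := (hX.hasDerivAt_pos t).hasDerivWithinAt (s := Set.univ) |>.dipole_deriv
      (hX.hasDerivAt_vel t).hasDerivWithinAt (hX.ne_zero t) m
    rw [hasDerivWithinAt_univ] at h1
    have hcd' := (hc' t).mul (hd' t)
    have h2 := (((((hd' t).add (hcd'.const_mul (3 / 2))).add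
      (((hd' t).const_mul (2 * e)).add (((hc' t).pow 2).mul (hd' t)))).add
      ((((hc' t).pow 3).mul (hd' t)).div_const 4)).add (hcd'.const_mul (3 * e / 8))).add
      ((hφ t).const_mul (3 / 2 * e + 3 / 8 * e ^ 2))
    refine (h1.sub (h2.const_mul (2 / L ^ 7))).congr_deriv ?_
    have hn := hX.norm_pos t
    have hmX : ⟪m, X t⟫ = ‖X t‖ * c t := by simp only [hc]; field_simp
    have h3 : ⟪m, keplerForce (X t)⟫ / ‖X t‖ ^ 3 -
        3 * (⟪X t, keplerForce (X t)⟫ * ⟪m, X t⟫ / ‖X t‖ ^ 5) = 2 * (c t / ‖X t‖ ^ 5) := by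
      rw [inner_keplerForce, inner_keplerForce, hmX, real_inner_self_eq_norm_sq]
      field_simp; ring
    -- Change of variable from `t` to `φ`: `L/|X|²` is `φ'`, and the remaining `|X|⁻³` is `(1 +
    -- c)³/L⁶`.
    have h4 : L / ‖X t‖ ^ 2 * (c t * (1 + c t) ^ 3) = L ^ 7 * (c t / ‖X t‖ ^ 5) := by
      have : L ^ 7 = L * (‖X t‖ * (1 + c t)) ^ 3 := by rw [hr]; ring
      rw [this]; field_simp
    rw [h3]
    have h5 : c t / ‖X t‖ ^ 5 = L / ‖X t‖ ^ 2 * (c t * (1 + c t) ^ 3) / L ^ 7 := by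
      rw [h4]; field_simp
    rw [h5]
    have h6 := hcd t
    simp only [Pi.pow_apply]
    push_cast
    generalize L / ‖X t‖ ^ 2 = w
    linear_combination (w * 2 / L ^ 7) * (3 / 2 + 2 * c t + 3 / 4 * c t ^ 2 + 3 * e / 8) * h6
  · simp only [hc, hd, hXT, hVT, hφT, hφ0, he]
    field_simp
    ring

end IsKeplerSolution

/-- Division by `|m|²` cancels the factor `e²` of the integral and leaves `(12 + 3e²)/L⁶`, in which
the odd power of `L` survives only through its sign. -/
theorem precession_coefficient {a b L e W : ℝ} (hb : 0 < b) (hba : b < a) (hL : L ^ 2 = b ^ 2 / a)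
    (he : e ^ 2 = 1 - b ^ 2 / a ^ 2)
    (hW : W = -(Real.pi * (6 * e ^ 2 + 3 / 2 * e ^ 4) * Real.sign L) / L ^ 7) (h : ℝ) :
    L * h ^ 2 / 12 * W / e ^ 2 = -(Real.sign L * (Real.pi / 24) *
      (15 * (a ^ 3 / b ^ 6) - 3 * (a / b ^ 4)) * h ^ 2) := by
  have ha : 0 < a := hb.trans hba
  have hL0 : L ≠ 0 := by
    rintro rfl
    have : 0 < b ^ 2 / a := by positivity
    rw [← hL] at this; simp at this
  have he0 : 0 < e ^ 2 := by
    rw [he, sub_pos, div_lt_one (by positivity)]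
    gcongr
  have he0' : e ≠ 0 := by rintro rfl; simp at he0
  have h1 : L * h ^ 2 / 12 * W / e ^ 2 =
      -(Real.sign L * (Real.pi / 24) * (12 + 3 * e ^ 2) / (L ^ 2) ^ 3 * h ^ 2) := by
    rw [hW]; field_simp; ring
  rw [h1, he, hL]
  field_simp
  ring

/-! ### Taylor estimates, uniform on compact time intervals -/

/-- The three bounds are the left-endpoint, midpoint and trapezoidal rules. Only `t` must lie in the
compact interval; `t + s` may leave it slightly. -/
theorem exists_taylor_bounds {E : Type*} [NormedAddCommGroup E] [NormedSpace ℝ E] {F g : ℝ → E}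
    (hF : ∀ t, HasDerivAt F (g t) t) (hg : ContDiff ℝ 2 g) (A B : ℝ) :
    ∃ C ≥ 0, ∃ δ > 0, ∀ t ∈ Set.Icc A B, ∀ s, 0 ≤ s → s < δ →
      ‖F (t + s) - F t - s • g t‖ ≤ C * s ^ 2 ∧
      ‖F (t + s) - F t - s • g (t + s / 2)‖ ≤ C * s ^ 3 ∧
      ‖F (t + s) - F t - (s / 2) • (g t + g (t + s))‖ ≤ C * s ^ 3 := by
  obtain ⟨δ₁, hδ₁, M₁, hM₁, H₁⟩ := (isCompact_Icc (a := A) (b := B)).exists_norm_sub_le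
    (g := g) fun y _ => (hg.of_le (by norm_num)).contDiffAt
  obtain ⟨δ₂, hδ₂, M₂, hM₂, H₂⟩ := (isCompact_Icc (a := A) (b := B)).exists_norm_symm_diff_le
    (g := g) fun y _ => hg.contDiffAt
  refine ⟨M₁ + M₂, by positivity, min δ₁ δ₂, lt_min hδ₁ hδ₂, fun t ht s hs0 hs => ?_⟩
  have hs1 : s < δ₁ := hs.trans_le (min_le_left _ _)
  have hs2 : s < δ₂ := hs.trans_le (min_le_right _ _)
  have hsym : ∀ σ ∈ Set.Icc 0 (s / 2),
      ‖g (t + s / 2 + σ) + g (t + s / 2 - σ) - (2 : ℝ) • g (t + s / 2)‖ ≤ M₂ * σ ^ 2 := by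
    rintro σ ⟨hσ0, hσ⟩
    have := H₂ t ht (t + s / 2) σ
      (by rw [add_sub_cancel_left, Real.norm_of_nonneg (by positivity)]; linarith)
      (by rw [Real.norm_of_nonneg hσ0]; linarith)
    rwa [Real.norm_of_nonneg hσ0] at this
  have hadd : ∀ c σ, HasDerivAt (fun σ => F (c + σ)) (g (c + σ)) σ := fun c σ =>
    (hF (c + σ)).comp_const_add c σ
  have hsub : ∀ c σ, HasDerivAt (fun σ => F (c - σ)) (-g (c - σ)) σ := fun c σ =>
    (hF (c - σ)).comp_const_sub c σ
  -- Expand symmetrically about the midpoint: the derivative of the error in the half-width `σ` is a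
  -- second symmetric difference of `g`, hence `O(σ²)`.
  have hmid : ‖F (t + s) - F t - s • g (t + s / 2)‖ ≤ M₂ * (s / 2) ^ 3 := by
    have := norm_le_mul_pow_of_norm_deriv_le (n := 2) (S := s / 2)
      (e := fun σ => F (t + s / 2 + σ) - F (t + s / 2 - σ) - (2 * σ) • g (t + s / 2))
      (e' := fun σ => g (t + s / 2 + σ) + g (t + s / 2 - σ) - (2 : ℝ) • g (t + s / 2))
      hM₂ (by positivity) (fun σ _ => ?_) hsym (by simp)
    · have e1 : t + s / 2 + s / 2 = t + s := by ring
      have e2 : t + s / 2 - s / 2 = t := by ring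
      have e3 : 2 * (s / 2) = s := by ring
      simpa only [e1, e2, e3] using this
    · have h3 : HasDerivAt (fun σ : ℝ => (2 * σ) • g (t + s / 2)) ((2 : ℝ) • g (t + s / 2)) σ := by
        simpa using ((hasDerivAt_id σ).const_mul (2 : ℝ)).smul_const (g (t + s / 2))
      refine (((hadd (t + s / 2) σ).sub (hsub (t + s / 2) σ)).sub h3).congr_deriv ?_
      abel
  have hs3 : M₂ * (s / 2) ^ 3 = M₂ * s ^ 3 / 8 := by ring
  have hMs1 : 0 ≤ M₁ * s ^ 3 := by positivity
  have hMs2 : 0 ≤ M₂ * s ^ 3 := by positivity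
  refine ⟨?_, ?_, ?_⟩
  · have := norm_le_mul_pow_of_norm_deriv_le (n := 1) (S := s)
      (e := fun σ => F (t + σ) - F t - σ • g t) (e' := fun σ => g (t + σ) - g t)
      hM₁ hs0 (fun σ _ => ?_) (fun σ hσ => ?_) (by simp)
    · refine this.trans ?_
      norm_num1
      nlinarith [mul_nonneg hM₂ (sq_nonneg s)]
    · have h3 : HasDerivAt (fun σ : ℝ => σ • g t) (g t) σ := by
        simpa using (hasDerivAt_id σ).smul_const (g t)
      exact ((hadd t σ).sub_const _).sub h3
    · have := H₁ t ht (t + σ) t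
        (by rw [add_sub_cancel_left, Real.norm_of_nonneg hσ.1]; linarith [hσ.2]) (by simpa)
      rw [add_sub_cancel_left, Real.norm_of_nonneg hσ.1] at this
      simpa using this
  · refine hmid.trans ?_
    rw [hs3, add_mul]; linarith
  · have h4 := hsym (s / 2) ⟨by positivity, le_rfl⟩
    have e1 : t + s / 2 + s / 2 = t + s := by ring
    have e2 : t + s / 2 - s / 2 = t := by ring
    rw [e1, e2] at h4
    have h5 : F (t + s) - F t - (s / 2) • (g t + g (t + s)) =
        (F (t + s) - F t - s • g (t + s / 2)) -
          (s / 2) • (g (t + s) + g t - (2 : ℝ) • g (t + s / 2)) := by module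
    rw [h5]
    refine (norm_sub_le _ _).trans ?_
    rw [norm_smul, Real.norm_of_nonneg (by positivity)]
    calc _ ≤ M₂ * (s / 2) ^ 3 + s / 2 * (M₂ * (s / 2) ^ 2) := by gcongr
      _ = M₂ * s ^ 3 / 4 := by ring
      _ ≤ (M₁ + M₂) * s ^ 3 := by rw [add_mul]; linarith

/-! ### Smoothness of the functions on phase space -/

theorem contDiffAt_dipoleHessian (m : Plane) {y : Plane × Plane} (hy : y.1 ≠ 0) (n : WithTop ℕ∞) :
    ContDiffAt ℝ n (fun y : Plane × Plane => dipoleHessian m y.1 y.2) y := by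
  have h0 : ‖y.1‖ ≠ 0 := norm_ne_zero_iff.2 hy
  have hn : ContDiffAt ℝ n (fun y : Plane × Plane => ‖y.1‖) y := contDiffAt_fst.norm ℝ hy
  have hxv : ContDiffAt ℝ n (fun y : Plane × Plane => ⟪y.1, y.2⟫) y :=
    contDiffAt_fst.inner ℝ contDiffAt_snd
  have hmx : ContDiffAt ℝ n (fun y : Plane × Plane => ⟪m, y.1⟫) y :=
    contDiffAt_const.inner ℝ contDiffAt_fst
  have hmv : ContDiffAt ℝ n (fun y : Plane × Plane => ⟪m, y.2⟫) y :=
    contDiffAt_const.inner ℝ contDiffAt_snd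
  have hv : ContDiffAt ℝ n (fun y : Plane × Plane => ‖y.2‖ ^ 2) y := contDiffAt_snd.norm_sq ℝ
  unfold dipoleHessian
  exact (((contDiffAt_const.mul ((hxv.mul hmv).div (hn.pow 5) (pow_ne_zero 5 h0))).sub
    (contDiffAt_const.mul ((hv.mul hmx).div (hn.pow 5) (pow_ne_zero 5 h0)))).add
    (contDiffAt_const.mul (((hxv.pow 2).mul hmx).div (hn.pow 7) (pow_ne_zero 7 h0))))

theorem contDiffAt_plane_apply {E : Type*} [NormedAddCommGroup E] [NormedSpace ℝ E] {f : E → Plane}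
    {y : E} {n : WithTop ℕ∞} (hf : ContDiffAt ℝ n f y) (i : Fin 2) : ContDiffAt ℝ n (fun y => f y i) y :=
  (EuclideanSpace.proj (𝕜 := ℝ) i).contDiff.contDiffAt.comp y hf

theorem contDiffAt_angularMomentum {E : Type*} [NormedAddCommGroup E] [NormedSpace ℝ E]
    {f g : E → Plane} {y : E} {n : WithTop ℕ∞} (hf : ContDiffAt ℝ n f y) (hg : ContDiffAt ℝ n g y) :
    ContDiffAt ℝ n (fun y => angularMomentum (f y) (g y)) y :=
  ((contDiffAt_plane_apply hf 0).mul (contDiffAt_plane_apply hg 1)).sub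
    ((contDiffAt_plane_apply hg 0).mul (contDiffAt_plane_apply hf 1))

theorem contDiffAt_lrlVector {y : Plane × Plane} (hy : y.1 ≠ 0) (n : WithTop ℕ∞) :
    ContDiffAt ℝ n (fun y : Plane × Plane => lrlVector y.1 y.2) y := by
  have h0 : ‖y.1‖ ≠ 0 := norm_ne_zero_iff.2 hy
  have hn : ContDiffAt ℝ n (fun y : Plane × Plane => ‖y.1‖) y := contDiffAt_fst.norm ℝ hy
  exact ((((contDiffAt_snd.norm_sq ℝ).smul contDiffAt_fst)).sub
    ((contDiffAt_fst.inner ℝ contDiffAt_snd).smul contDiffAt_snd)).sub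
    ((hn.inv h0).smul contDiffAt_fst)

/-! ### The defect of the trapezoidal rule along a drift -/

/-- Along a straight line, `angularMomentum m x / |x|` is a primitive of a multiple of
`⟪m, x⟫ / |x|³`; the error of the trapezoidal rule for this integral is given by the
dipole Hessian at the midpoint, up to fifth order. -/
theorem exists_trapezoid_defect_bound (m : Plane) {O : Set (Plane × Plane)} (hO : IsCompact O)
    (hO0 : ∀ y ∈ O, y.1 ≠ 0) :
    ∃ C ≥ 0, ∃ δ > 0, ∀ y ∈ O, ∀ z p : Plane, ‖(z, p) - y‖ < δ → ∀ σ, 0 ≤ σ → σ < δ →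
      |angularMomentum z p * (σ * (⟪m, z + σ • p⟫ / ‖z + σ • p‖ ^ 3 +
          ⟪m, z - σ • p⟫ / ‖z - σ • p‖ ^ 3)) -
        (angularMomentum m (z + σ • p) / ‖z + σ • p‖ - angularMomentum m (z - σ • p) / ‖z - σ • p‖) -
        angularMomentum z p * (2 * σ ^ 3 / 3 * dipoleHessian m z p)| ≤ C * σ ^ 5 := by
  obtain ⟨δ₁, hδ₁, M, hM, H⟩ := hO.exists_norm_symm_diff_le
    (g := fun y : Plane × Plane => dipoleHessian m y.1 y.2)
    fun y hy => contDiffAt_dipoleHessian m (hO0 y hy) 2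
  obtain ⟨B, hB⟩ := hO.isBounded.exists_norm_le
  obtain ⟨ρ, hρ, hρO⟩ : ∃ ρ > 0, ∀ y ∈ O, ρ ≤ ‖y.1‖ := by
    rcases O.eq_empty_or_nonempty with rfl | hne
    · exact ⟨1, one_pos, by simp⟩
    · obtain ⟨y, hy, hmin⟩ := hO.exists_isMinOn hne (f := fun y => ‖y.1‖) (by fun_prop)
      exact ⟨‖y.1‖, norm_pos_iff.2 (hO0 y hy), fun z hz => hmin hz⟩
  have hB1 : 0 < |B| + 1 := by positivity
  set N := |B| + 1 with hN
  -- `N` bounds `|z|` and `|p|`. The bound `δ₁/N` keeps the displacement `σ • p` within reach of the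
  -- symmetric difference estimate, and `ρ/(2N + 2)` keeps the whole drift away from the origin.
  refine ⟨N * N * (M * N ^ 2), by positivity, min (min 1 δ₁) (min (δ₁ / N) (ρ / (2 * N + 2))),
    by positivity, fun y hy z p hzp σ₀ hσ₀ hσ₀δ => ?_⟩
  simp only [lt_min_iff] at hzp hσ₀δ
  obtain ⟨⟨hzp1, hzp2⟩, -, hzp3⟩ := hzp
  obtain ⟨-, hσ1, hσ2⟩ := hσ₀δ
  rw [lt_div_iff₀ (by positivity)] at hzp3 hσ1 hσ2
  have hz1 : ‖z - y.1‖ ≤ ‖(z, p) - y‖ := norm_fst_le ((z, p) - y)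
  have hp1 : ‖p - y.2‖ ≤ ‖(z, p) - y‖ := norm_snd_le ((z, p) - y)
  have hyB : ‖y‖ ≤ |B| := (hB y hy).trans (le_abs_self B)
  have hpN : ‖p‖ ≤ N := by
    have := norm_le_norm_add_norm_sub' p y.2
    have h2 := norm_snd_le y
    linarith
  have hzN : ‖z‖ ≤ N := by
    have := norm_le_norm_add_norm_sub' z y.1
    have h2 := norm_fst_le y
    linarith
  have hN1 : 1 ≤ N := by rw [hN]; linarith [abs_nonneg B]
  have hzρ : ρ / 2 < ‖z‖ := by
    have h1 := norm_sub_norm_le y.1 z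
    rw [norm_sub_rev] at h1
    have h2 := hρO y hy
    nlinarith [norm_nonneg ((z, p) - y)]
  have hne : ∀ s : ℝ, |s| ≤ σ₀ → z + s • p ≠ 0 := by
    intro s hs h0
    have h1 : ‖z‖ = |s| * ‖p‖ := by
      rw [← Real.norm_eq_abs, ← norm_smul, ← norm_neg (s • p), ← eq_neg_of_add_eq_zero_left h0]
    have h2 : |s| * ‖p‖ ≤ σ₀ * N := mul_le_mul hs hpN (norm_nonneg _) hσ₀
    nlinarith
  have hline : ∀ s : ℝ, HasDerivWithinAt (fun s : ℝ => z + s • p) p Set.univ s := fun s => by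
    rw [hasDerivWithinAt_univ]
    simpa using ((hasDerivAt_id s).smul_const p).const_add z
  set U : ℝ → ℝ := fun s => ⟪m, z + s • p⟫ / ‖z + s • p‖ ^ 3 with hU
  set U' : ℝ → ℝ := fun s => ⟪m, p⟫ / ‖z + s • p‖ ^ 3 -
    3 * (⟪z + s • p, p⟫ * ⟪m, z + s • p⟫ / ‖z + s • p‖ ^ 5) with hU'
  set c : ℝ → ℝ := fun s => angularMomentum m (z + s • p) / ‖z + s • p‖ with hc
  have hUd : ∀ s, |s| ≤ σ₀ → HasDerivAt U (U' s) s := fun s hs => by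
    rw [← hasDerivWithinAt_univ]
    exact (hline s).dipole (hne s hs) m
  have hU'd : ∀ s, |s| ≤ σ₀ → HasDerivAt U' (dipoleHessian m (z + s • p) p) s := fun s hs => by
    rw [← hasDerivWithinAt_univ]
    refine ((hline s).dipole_deriv (hasDerivWithinAt_const s Set.univ p) (hne s hs) m).congr_deriv ?_
    simp
  have hcd : ∀ s, |s| ≤ σ₀ → HasDerivAt c (angularMomentum z p * U s) s := fun s hs => by
    rw [← hasDerivWithinAt_univ]
    refine ((hline s).angularMomentum_unit (hne s hs) m).congr_deriv ?_
    rw [angularMomentum_add_left, angularMomentum_smul_left, angularMomentum_self, hU]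
    ring
  have hneg : ∀ {f : ℝ → ℝ} {f' s : ℝ}, HasDerivAt f f' (-s) → HasDerivAt (fun s => f (-s)) (-f') s :=
    fun {f f' s} hf => by
      have := hf.scomp s (hasDerivAt_neg s)
      simpa [Function.comp_def] using this
  have habs : ∀ s ∈ Set.Icc 0 σ₀, |s| ≤ σ₀ ∧ |-s| ≤ σ₀ := fun s hs => by
    rw [abs_neg, abs_of_nonneg hs.1]; exact ⟨hs.2, hs.2⟩
  have hD : ∀ σ ∈ Set.Icc 0 σ₀,
      |U' σ - U' (-σ) - 2 * σ * dipoleHessian m z p| ≤ M * N ^ 2 * σ ^ 3 := by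
    rintro σ ⟨hσ0, hσ⟩
    refine norm_le_mul_pow_of_norm_deriv_le (n := 2)
      (e := fun σ => U' σ - U' (-σ) - 2 * σ * dipoleHessian m z p)
      (e' := fun σ => dipoleHessian m (z + σ • p) p + dipoleHessian m (z + (-σ) • p) p -
        2 * dipoleHessian m z p) (by positivity) hσ0 (fun s hs => ?_) (fun s hs => ?_) (by simp)
    · obtain ⟨h1, h2⟩ := habs s ⟨hs.1, hs.2.trans hσ⟩
      have h3 : HasDerivAt (fun σ : ℝ => 2 * σ * dipoleHessian m z p) (2 * dipoleHessian m z p) s := by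
        simpa using ((hasDerivAt_id s).const_mul (2 : ℝ)).mul_const (dipoleHessian m z p)
      refine (((hU'd s h1).sub (hneg (hU'd (-s) h2))).sub h3).congr_deriv ?_
      ring
    · have h1 : ‖((s • p, 0) : Plane × Plane)‖ ≤ s * N := by
        rw [Prod.norm_mk, norm_zero, max_eq_left (norm_nonneg _), norm_smul,
          Real.norm_of_nonneg hs.1]
        gcongr; exact hs.1
      have h2 := H y hy (z, p) (s • p, 0) hzp2
        (h1.trans_lt ((mul_le_mul_of_nonneg_right (hs.2.trans hσ) hB1.le).trans_lt hσ1))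
      simp only [Prod.mk_add_mk, Prod.mk_sub_mk, add_zero, sub_zero, smul_eq_mul] at h2
      rw [neg_smul, ← sub_eq_add_neg]
      refine h2.trans ?_
      calc M * ‖((s • p, 0) : Plane × Plane)‖ ^ 2 ≤ M * (s * N) ^ 2 := by gcongr
        _ = M * N ^ 2 * s ^ 2 := by ring
  -- On differentiating in `σ`, the terms `U σ + U (-σ)` cancel because `c` is a primitive of `(z ×
  -- p) U`. What remains is `σ` times the quantity in `hD`, so the derivative is `O(σ⁴)`.
  have hfin := norm_le_mul_pow_of_norm_deriv_le (n := 4) (S := σ₀) (C := N * N * (M * N ^ 2))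
    (e := fun σ => angularMomentum z p * (σ * (U σ + U (-σ))) - (c σ - c (-σ)) -
      angularMomentum z p * (2 * σ ^ 3 / 3 * dipoleHessian m z p))
    (e' := fun σ => angularMomentum z p * (σ * (U' σ - U' (-σ) - 2 * σ * dipoleHessian m z p)))
    (by positivity) hσ₀ (fun s hs => ?_) (fun s hs => ?_) (by simp)
  · simp only [hU, hc, neg_smul, ← sub_eq_add_neg] at hfin
    exact hfin
  · obtain ⟨h1, h2⟩ := habs s hs
    have h3 : HasDerivAt (fun σ : ℝ => 2 * σ ^ 3 / 3 * dipoleHessian m z p)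
        (2 * s ^ 2 * dipoleHessian m z p) s := by
      have := (((hasDerivAt_pow 3 s).const_mul 2).div_const 3).mul_const (dipoleHessian m z p)
      refine this.congr_deriv ?_
      push_cast; ring
    refine ((((hasDerivAt_id s).mul ((hUd s h1).add (hneg (hUd (-s) h2)))).const_mul
      (angularMomentum z p)).sub ((hcd s h1).sub (hneg (hcd (-s) h2))) |>.sub
      (h3.const_mul (angularMomentum z p))).congr_deriv ?_
    simp only [Pi.add_apply, id_eq]
    ring
  · rw [norm_mul, norm_mul, Real.norm_of_nonneg hs.1, Real.norm_eq_abs, Real.norm_eq_abs]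
    have h1 : |angularMomentum z p| ≤ N * N :=
      (abs_angularMomentum_le z p).trans (mul_le_mul hzN hpN (norm_nonneg _) hB1.le)
    calc _ ≤ N * N * (s * (M * N ^ 2 * s ^ 3)) := by
          have := hD s hs
          have := hs.1
          gcongr
      _ = _ := by ring

/-! ### The one-step form of the Störmer-Verlet method -/

theorem svStep_pos {h : ℝ} (hh : h ≠ 0) (x : ℕ → Plane) (k : ℕ) :
    x (k + 1) = x k + h • svMomentum h x k + (h ^ 2 / 2) • keplerForce (x k) := by
  rw [svMomentum, smul_sub, smul_inv_smul₀ hh, smul_smul]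
  module

theorem IsStormerVerlet.svMomentum_succ {h : ℝ} (hh : h ≠ 0) {x : ℕ → Plane}
    (hx : IsStormerVerlet h x) (k : ℕ) :
    svMomentum h x (k + 1) =
      svMomentum h x k + (h / 2) • (keplerForce (x k) + keplerForce (x (k + 1))) := by
  have h1 : h • keplerForce (x (k + 1)) = h⁻¹ • (x (k + 2) - (2 : ℝ) • x (k + 1) + x k) := by
    rw [← hx k, smul_smul]
    congr 1
    field_simp
  have h2 : svMomentum h x (k + 1) - svMomentum h x k =
      h⁻¹ • (x (k + 2) - (2 : ℝ) • x (k + 1) + x k) - (h / 2) • keplerForce (x (k + 1)) +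
        (h / 2) • keplerForce (x k) := by
    simp only [svMomentum]; module
  rw [← h1] at h2
  rw [← sub_eq_iff_eq_add', h2]
  module

/-- A kick is parallel to the position, so it leaves the angular momentum unchanged. -/
theorem angularMomentum_add_smul_keplerForce (x p : Plane) (r : ℝ) :
    angularMomentum x (p + r • keplerForce x) = angularMomentum x p := by
  rw [angularMomentum_add_right, angularMomentum_smul_right, angularMomentum_keplerForce,
    angularMomentum_self]
  simp

/-- The change of a component of the Laplace-Runge-Lenz vector in one step is the defect of the
trapezoidal rule along the drift; `z` and `p` are the position and the momentum in the middle. -/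
theorem IsStormerVerlet.svLrl_succ_sub {h : ℝ} (hh : h ≠ 0) {x : ℕ → Plane}
    (hx : IsStormerVerlet h x) (m : Plane) (k : ℕ) {z p : Plane}
    (hp : p = svMomentum h x k + (h / 2) • keplerForce (x k)) (hz : z = x k + (h / 2) • p) :
    angularMomentum m (svLrl h x (k + 1)) - angularMomentum m (svLrl h x k) =
      angularMomentum z p * (h / 2 * (⟪m, z + (h / 2) • p⟫ / ‖z + (h / 2) • p‖ ^ 3 +
          ⟪m, z - (h / 2) • p⟫ / ‖z - (h / 2) • p‖ ^ 3)) -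
        (angularMomentum m (z + (h / 2) • p) / ‖z + (h / 2) • p‖ -
          angularMomentum m (z - (h / 2) • p) / ‖z - (h / 2) • p‖) := by
  have h0 : z - (h / 2) • p = x k := by rw [hz]; module
  have h1 : z + (h / 2) • p = x (k + 1) := by
    rw [hz, svStep_pos hh x k, hp]
    module
  have hp1 : svMomentum h x (k + 1) = p + (h / 2) • keplerForce (x (k + 1)) := by
    rw [hx.svMomentum_succ hh, hp]; module
  have hp0 : svMomentum h x k = p + (-(h / 2)) • keplerForce (x k) := by rw [hp]; module
  have hl0 : angularMomentum (x k) p = angularMomentum z p := by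
    rw [← h0, sub_eq_add_neg, ← neg_smul, angularMomentum_add_left, angularMomentum_smul_left,
      angularMomentum_self]
    ring
  have hl1 : angularMomentum (x (k + 1)) p = angularMomentum z p := by
    rw [← h1, angularMomentum_add_left, angularMomentum_smul_left, angularMomentum_self]
    ring
  rw [svLrl, svLrl, angularMomentum_lrlVector, angularMomentum_lrlVector, hp1, hp0,
    angularMomentum_add_smul_keplerForce, angularMomentum_add_smul_keplerForce, hl0, hl1, h0, h1,
    inner_add_right, inner_add_right, real_inner_smul_right, real_inner_smul_right,
    inner_keplerForce, inner_keplerForce]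
  ring

/-- Bound for the errors `a` (position) and `b` (momentum) of a one-step method of order two whose
force is Lipschitz with constant `M` as long as the position error is at most `ρ`. -/
theorem error_le_of_recurrence {a b : ℕ → ℝ} {h M C ρ D T B c d : ℝ} (ha0 : ∀ k, 0 ≤ a k)
    (hb0 : ∀ k, 0 ≤ b k) (hh : 0 < h) (hh1 : h ≤ 1) (hM0 : 0 ≤ M) (hC : 0 ≤ C) (hD : 0 ≤ D)
    (hT : 0 ≤ T) (hc : c = (1 + M) + M * (3 + M) / 2) (hd : d = C * (2 + M / 2))
    (hB : B = Real.exp (c * T) * (D + T * d)) (hsmall : h * (B * (2 + M) + C) ≤ ρ)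
    (hE0 : a 0 + b 0 ≤ D * h ^ 2)
    (hstep₁ : ∀ k : ℕ, ((k + 1 : ℕ) : ℝ) * h ≤ T → a k ≤ ρ →
      a (k + 1) ≤ a k + h * b k + h ^ 2 / 2 * (M * a k) + C * h ^ 3)
    (hstep₂ : ∀ k : ℕ, ((k + 1 : ℕ) : ℝ) * h ≤ T → a k ≤ ρ → a (k + 1) ≤ ρ →
      b (k + 1) ≤ b k + h / 2 * (M * a k + M * a (k + 1)) + C * h ^ 3) (n : ℕ) (hn : n * h ≤ T) :
    a n + b n ≤ B * h ^ 2 := by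
  have hc0 : 0 ≤ c := by rw [hc]; positivity
  have hd0 : 0 ≤ d := by rw [hd]; positivity
  have hB0 : 0 ≤ B := by rw [hB]; positivity
  have hh22 : h ^ 2 ≤ h := pow_le_of_le_one hh.le hh1 (by norm_num)
  have hh3 : h ^ 3 ≤ h ^ 2 := pow_le_pow_of_le_one hh.le hh1 (by norm_num)
  have hh31 : h ^ 3 ≤ h := hh3.trans hh22
  have hBk : B * h ^ 2 * (2 + M) + C * h ^ 3 ≤ ρ := by
    have e1 : B * (2 + M) * h ^ 2 ≤ B * (2 + M) * h := by gcongr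
    have e2 : C * h ^ 3 ≤ C * h := by gcongr
    linarith
  -- The Lipschitz bound is available only while the error is at most `ρ`, so the final estimate
  -- must be known at all earlier steps before the Gronwall inequality can be applied up to `n`.
  induction n using Nat.strong_induction_on with
  | _ n ih =>
  have hrec : ∀ k < n, a (k + 1) + b (k + 1) ≤ (1 + c * h) * (a k + b k) + d * h ^ 3 := by
    intro k hk
    have hkT : ((k + 1 : ℕ) : ℝ) * h ≤ T := le_trans (by gcongr; exact_mod_cast hk) hn
    have hEk := ih k hk (le_trans (by gcongr; simp) hkT)
    have hab := add_nonneg (ha0 k) (hb0 k)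
    have hak : a k ≤ ρ := by
      have e1 : 0 ≤ B * h ^ 2 * (1 + M) := by positivity
      have e2 : 0 ≤ C * h ^ 3 := by positivity
      have := hb0 k
      linarith
    have ha1 : a (k + 1) ≤ a k + h * (1 + M) * (a k + b k) + C * h ^ 3 := by
      refine (hstep₁ k hkT hak).trans ?_
      have e1 : h ^ 2 / 2 * (M * a k) ≤ h * (M * a k) :=
        mul_le_mul_of_nonneg_right (by linarith) (mul_nonneg hM0 (ha0 k))
      have e2 : 0 ≤ h * a k := mul_nonneg hh.le (ha0 k)
      have e3 : 0 ≤ h * (M * b k) := mul_nonneg hh.le (mul_nonneg hM0 (hb0 k))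
      linarith
    have h1 : h * (1 + M) * (a k + b k) ≤ 1 * (1 + M) * (a k + b k) := by gcongr
    -- The implicit force evaluation at the next point needs this bound too; the factor `2 + M` in
    -- `hsmall` provides for it.
    have hak1 : a (k + 1) ≤ ρ := by
      have e1 : (2 + M) * (a k + b k) ≤ (2 + M) * (B * h ^ 2) := by gcongr
      have := hb0 k
      linarith
    have hb1 := hstep₂ k hkT hak hak1
    have e1 : a (k + 1) ≤ (2 + M) * (a k + b k) + C * h ^ 2 := by
      have h2 : C * h ^ 3 ≤ C * h ^ 2 := by gcongr
      have := hb0 k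
      linarith
    have e2 : h / 2 * (M * a k + M * a (k + 1)) ≤
        h / 2 * (M * (a k + b k) + M * ((2 + M) * (a k + b k) + C * h ^ 2)) := by
      have e3 : a k ≤ a k + b k := by linarith [hb0 k]
      gcongr
    calc a (k + 1) + b (k + 1) ≤ (a k + h * (1 + M) * (a k + b k) + C * h ^ 3) +
          (b k + h / 2 * (M * (a k + b k) + M * ((2 + M) * (a k + b k) + C * h ^ 2)) +
            C * h ^ 3) := by linarith
      _ = _ := by rw [hc, hd]; ring
  have hg := le_of_forall_le_one_add_mul_add (E := fun k => a k + b k) hc0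
    (by positivity : 0 ≤ d * h ^ 3) hh.le hrec
  have hexp : (1 + c * h) ^ n ≤ Real.exp (c * T) := by
    calc (1 + c * h) ^ n ≤ Real.exp (c * h) ^ n := by
          gcongr; linarith [Real.add_one_le_exp (c * h)]
      _ = Real.exp (c * (n * h)) := by rw [← Real.exp_nat_mul]; ring_nf
      _ ≤ _ := by gcongr
  have h1 : (a 0 + b 0) + n * (d * h ^ 3) ≤ (D + T * d) * h ^ 2 := by
    have e1 : n * (d * h ^ 3) = (n * h) * d * h ^ 2 := by ring
    have e2 : (n * h) * d * h ^ 2 ≤ T * d * h ^ 2 := by gcongr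
    linarith
  calc a n + b n ≤ (1 + c * h) ^ n * ((a 0 + b 0) + n * (d * h ^ 3)) := hg
    _ ≤ Real.exp (c * T) * ((D + T * d) * h ^ 2) := by
        have := ha0 0
        have := hb0 0
        gcongr
    _ = B * h ^ 2 := by rw [hB]; ring

/-! ### Convergence of the method and precession of the numerical solution -/

namespace IsKeplerSolution

variable {X V : ℝ → Plane} (hX : IsKeplerSolution X V)
include hX

theorem isCompact_orbit (A B : ℝ) : IsCompact ((fun t => (X t, V t)) '' Set.Icc A B) :=
  isCompact_Icc.image (hX.continuous_pos.prodMk hX.continuous_vel)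

theorem exists_le_norm (A B : ℝ) : ∃ ρ > 0, ∀ t ∈ Set.Icc A B, ρ ≤ ‖X t‖ := by
  rcases (Set.Icc A B).eq_empty_or_nonempty with h | hne
  · exact ⟨1, one_pos, by simp [h]⟩
  · obtain ⟨t, -, hmin⟩ := isCompact_Icc.exists_isMinOn hne hX.continuous_pos.norm.continuousOn
    exact ⟨‖X t‖, hX.norm_pos t, fun s hs => hmin hs⟩

theorem contDiff_keplerForce : ContDiff ℝ 2 fun t => keplerForce (X t) := by
  have h2 : deriv V = fun t => keplerForce (X t) := funext fun t => (hX.hasDerivAt_vel t).deriv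
  rw [← h2]
  exact ((contDiff_succ_iff_deriv (n := 2)).1 (hX.contDiff 3).2).2.2

/-- The Störmer-Verlet method converges of second order on compact time intervals. -/
theorem exists_sv_error_bound (K T : ℝ) (hT : 0 ≤ T) :
    ∃ C ≥ 0, ∃ h₀ > 0, ∀ h, 0 < h → h < h₀ → ∀ x : ℕ → Plane, IsStormerVerlet h x →
      ‖x 0 - X 0‖ ≤ K * h ^ 2 → ‖svMomentum h x 0 - V 0‖ ≤ K * h ^ 2 →
      ∀ n : ℕ, n * h ≤ T →
        ‖x n - X (n * h)‖ ≤ C * h ^ 2 ∧ ‖svMomentum h x n - V (n * h)‖ ≤ C * h ^ 2 := by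
  obtain ⟨ρ, hρ, hρX⟩ := hX.exists_le_norm 0 T
  obtain ⟨C₁, hC₁, δ₁, hδ₁, H₁⟩ := exists_taylor_bounds hX.hasDerivAt_pos (hX.contDiff 2).2 0 T
  obtain ⟨C₂, hC₂, δ₂, hδ₂, H₂⟩ := exists_taylor_bounds hX.hasDerivAt_vel hX.contDiff_keplerForce 0 T
  -- Integrating the first order expansion of `V` gives the second order expansion of `X`, with the
  -- same constant.
  have hTX : ∀ t ∈ Set.Icc 0 T, ∀ s, 0 ≤ s → s < min δ₁ δ₂ →
      ‖X (t + s) - X t - s • V t - (s ^ 2 / 2) • keplerForce (X t)‖ ≤ C₂ * s ^ 3 := by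
    intro t ht s hs0 hs
    refine norm_le_mul_pow_of_norm_deriv_le (n := 2)
      (e := fun s => X (t + s) - X t - s • V t - (s ^ 2 / 2) • keplerForce (X t))
      (e' := fun s => V (t + s) - V t - s • keplerForce (X t)) hC₂ hs0 (fun σ _ => ?_)
      (fun σ hσ => ?_) (by simp)
    · have e1 : HasDerivAt (fun s => X (t + s)) (V (t + σ)) σ :=
        (hX.hasDerivAt_pos (t + σ)).comp_const_add t σ
      have e2 : HasDerivAt (fun σ : ℝ => σ • V t) (V t) σ := by
        simpa using (hasDerivAt_id σ).smul_const (V t)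
      have e3 : HasDerivAt (fun σ : ℝ => (σ ^ 2 / 2) • keplerForce (X t)) (σ • keplerForce (X t)) σ := by
        have := ((hasDerivAt_pow 2 σ).div_const 2).smul_const (keplerForce (X t))
        refine this.congr_deriv ?_
        congr 1; push_cast; ring
      exact ((e1.sub_const _).sub e2).sub e3
    · exact (H₂ t ht σ hσ.1 ((hσ.2.trans_lt hs).trans_le (min_le_right _ _))).1
  -- A position error of at most `ρ/2` leaves the numerical point at distance at least `ρ/2` from
  -- the origin; `M` is the Lipschitz constant of the force there.
  obtain ⟨M, hM⟩ : ∃ M, M = 4 / (ρ / 2) ^ 3 := ⟨_, rfl⟩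
  have hM0 : 0 ≤ M := by rw [hM]; positivity
  obtain ⟨c, hc⟩ : ∃ c, c = (1 + M) + M * (3 + M) / 2 := ⟨_, rfl⟩
  obtain ⟨d, hd⟩ : ∃ d, d = C₂ * (2 + M / 2) := ⟨_, rfl⟩
  obtain ⟨B, hB⟩ : ∃ B, B = Real.exp (c * T) * (2 * |K| + T * d) := ⟨_, rfl⟩
  have hd0 : 0 ≤ d := by rw [hd]; positivity
  have hB0 : 0 ≤ B := by rw [hB]; positivity
  refine ⟨B, hB0, min (min 1 (min δ₁ δ₂)) (ρ / 2 / (B * (2 + M) + C₂ + 1)), by positivity,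
    fun h hh hh₀ x hx hx0 hv0 => ?_⟩
  simp only [lt_min_iff] at hh₀
  obtain ⟨⟨hh1, hhδ⟩, hh2⟩ := hh₀
  rw [lt_div_iff₀ (by positivity)] at hh2
  have hmem : ∀ k : ℕ, ((k + 1 : ℕ) : ℝ) * h ≤ T → (k : ℝ) * h ∈ Set.Icc 0 T := fun k hk =>
    ⟨by positivity, le_trans (by gcongr; simp) hk⟩
  have hk1 : ∀ k : ℕ, ((k + 1 : ℕ) : ℝ) * h = k * h + h := fun k => by push_cast; ring
  have hfl : ∀ j : ℕ, (j : ℝ) * h ∈ Set.Icc 0 T → ‖x j - X (j * h)‖ ≤ ρ / 2 →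
      ‖keplerForce (x j) - keplerForce (X (j * h))‖ ≤ M * ‖x j - X (j * h)‖ := by
    intro j hj haj
    have h1 := hρX _ hj
    rw [hM]
    refine norm_keplerForce_sub_le (by positivity) ?_ (by linarith)
    have h2 := norm_sub_norm_le (X (j * h)) (x j)
    rw [norm_sub_rev] at h2
    linarith
  have key := error_le_of_recurrence (a := fun k => ‖x k - X (k * h)‖)
    (b := fun k => ‖svMomentum h x k - V (k * h)‖) (ρ := ρ / 2) (fun k => norm_nonneg _)
    (fun k => norm_nonneg _) hh hh1.le hM0 hC₂ (by positivity : 0 ≤ 2 * |K|) hT hc hd hB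
    (by linarith) ?_ ?_ ?_
  · intro n hn
    have h1 := key n hn
    exact ⟨(le_add_of_nonneg_right (norm_nonneg _)).trans h1,
      (le_add_of_nonneg_left (norm_nonneg _)).trans h1⟩
  · have : K * h ^ 2 ≤ |K| * h ^ 2 := by gcongr; exact le_abs_self K
    simp only [Nat.cast_zero, zero_mul]
    linarith
  · intro k hkT hak
    have hk0 := hmem k hkT
    have hfk := hfl k hk0 hak
    have hxerr : x (k + 1) - X ((k + 1 : ℕ) * h) =
        (x k - X (k * h)) + h • (svMomentum h x k - V (k * h)) +
          (h ^ 2 / 2) • (keplerForce (x k) - keplerForce (X (k * h))) -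
          (X (k * h + h) - X (k * h) - h • V (k * h) - (h ^ 2 / 2) • keplerForce (X (k * h))) := by
      rw [hk1, svStep_pos hh.ne' x k]; module
    rw [hxerr]
    refine (norm_sub_le _ _).trans (add_le_add ((norm_add_le _ _).trans (add_le_add
      ((norm_add_le _ _).trans (add_le_add le_rfl ?_)) ?_)) (hTX _ hk0 h hh.le (lt_min hhδ.1 hhδ.2)))
    · rw [norm_smul, Real.norm_of_nonneg hh.le]
    · rw [norm_smul, Real.norm_of_nonneg (by positivity)]
      gcongr
  · intro k hkT hak hak1
    have hk0 := hmem k hkT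
    have hfk := hfl k hk0 hak
    have hfk1 := hfl (k + 1) ⟨by positivity, hkT⟩ hak1
    have hverr : svMomentum h x (k + 1) - V ((k + 1 : ℕ) * h) =
        (svMomentum h x k - V (k * h)) + (h / 2) • ((keplerForce (x k) - keplerForce (X (k * h))) +
          (keplerForce (x (k + 1)) - keplerForce (X ((k + 1 : ℕ) * h)))) -
        (V (k * h + h) - V (k * h) -
          (h / 2) • (keplerForce (X (k * h)) + keplerForce (X (k * h + h)))) := by
      rw [hk1, hx.svMomentum_succ hh.ne']; module
    rw [hverr]
    refine (norm_sub_le _ _).trans (add_le_add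
      ((norm_add_le _ _).trans (add_le_add le_rfl ?_)) (H₂ _ hk0 h hh.le hhδ.2).2.2)
    rw [norm_smul, Real.norm_of_nonneg (by positivity)]
    gcongr
    exact (norm_add_le _ _).trans (add_le_add hfk hfk1)

end IsKeplerSolution

theorem contDiffAt_keplerForce {x : Plane} (hx : x ≠ 0) (n : WithTop ℕ∞) :
    ContDiffAt ℝ n keplerForce x :=
  ((((contDiffAt_id.norm ℝ hx).pow 3).inv (pow_ne_zero 3 (norm_ne_zero_iff.2 hx))).smul
    contDiffAt_id).neg

namespace IsKeplerSolution

variable {X V : ℝ → Plane} (hX : IsKeplerSolution X V)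
include hX

/-- In the middle of each drift the numerical solution is second order accurate. -/
theorem exists_sv_midpoint_bound (K T : ℝ) (hT : 0 ≤ T) :
    ∃ C ≥ 0, ∃ h₀ > 0, ∀ h, 0 < h → h < h₀ → ∀ x : ℕ → Plane, IsStormerVerlet h x →
      ‖x 0 - X 0‖ ≤ K * h ^ 2 → ‖svMomentum h x 0 - V 0‖ ≤ K * h ^ 2 →
      ∀ k : ℕ, ((k + 1 : ℕ) : ℝ) * h ≤ T → ∀ z p : Plane,
        p = svMomentum h x k + (h / 2) • keplerForce (x k) → z = x k + (h / 2) • p →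
        ‖(z, p) - (X (k * h + h / 2), V (k * h + h / 2))‖ ≤ C * h ^ 2 := by
  obtain ⟨B, hB, h₁, hh₁, H⟩ := hX.exists_sv_error_bound K T hT
  obtain ⟨C₁, hC₁, δ₁, hδ₁, H₁⟩ := exists_taylor_bounds hX.hasDerivAt_pos (hX.contDiff 2).2 0 T
  obtain ⟨C₂, hC₂, δ₂, hδ₂, H₂⟩ := exists_taylor_bounds hX.hasDerivAt_vel hX.contDiff_keplerForce 0 T
  obtain ⟨δ₃, hδ₃, M, hM, H₃⟩ := ((isCompact_Icc (a := 0) (b := T)).image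
    hX.continuous_pos).exists_norm_sub_le (g := keplerForce) (by
      rintro _ ⟨t, -, rfl⟩; exact contDiffAt_keplerForce (hX.ne_zero t) 1)
  obtain ⟨F, hF⟩ := (isCompact_Icc (a := 0) (b := T)).exists_bound_of_continuousOn
    hX.contDiff_keplerForce.continuous.continuousOn
  have hF0 : 0 ≤ F := (norm_nonneg _).trans (hF 0 ⟨le_rfl, hT⟩)
  refine ⟨2 * B + M * B + F + C₁ + C₂, by positivity,
    min (min 1 h₁) (min (min δ₁ δ₂) (δ₃ / (B + 1))), by positivity,
    fun h hh hh₀ x hx hx0 hv0 k hk z p hp hz => ?_⟩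
  simp only [lt_min_iff] at hh₀
  obtain ⟨⟨hh1, hhh1⟩, ⟨hhδ1, hhδ2⟩, hhδ3⟩ := hh₀
  rw [lt_div_iff₀ (by positivity)] at hhδ3
  have hkT : (k : ℝ) * h ≤ T := le_trans (by gcongr; simp) hk
  have ht : (k : ℝ) * h ∈ Set.Icc 0 T := ⟨by positivity, hkT⟩
  obtain ⟨hxk, hpk⟩ := H h hh hhh1 x hx hx0 hv0 k hkT
  have hT1 := (H₁ _ ht (h / 2) (by positivity) (by linarith)).1
  have hT2 := (H₂ _ ht (h / 2) (by positivity) (by linarith)).1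
  have hFk := hF _ ht
  generalize (k : ℝ) * h = t at *
  have hh22 : h ^ 2 ≤ h := pow_le_of_le_one hh.le hh1.le (by norm_num)
  have hh21 : h ^ 2 ≤ 1 := hh22.trans hh1.le
  have hf := H₃ (X t) ⟨t, ht, rfl⟩ (x k) (X t)
    (by
      have : B * h ^ 2 ≤ B * h := by gcongr
      linarith) (by simpa)
  have hf2 : ‖keplerForce (x k) - keplerForce (X t)‖ ≤ M * (B * h ^ 2) := hf.trans (by gcongr)
  have hfx : ‖keplerForce (x k)‖ ≤ F + M * B := by
    have h1 := norm_le_norm_add_norm_sub' (keplerForce (x k)) (keplerForce (X t))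
    have h2 : M * (B * h ^ 2) ≤ M * (B * 1) := by gcongr
    linarith
  have ep : p - V (t + h / 2) = (svMomentum h x k - V t) +
      (h / 2) • (keplerForce (x k) - keplerForce (X t)) -
      (V (t + h / 2) - V t - (h / 2) • keplerForce (X t)) := by rw [hp]; module
  have ez : z - X (t + h / 2) = (x k - X t) + (h / 2) • (svMomentum h x k - V t) +
      (h ^ 2 / 4) • keplerForce (x k) - (X (t + h / 2) - X t - (h / 2) • V t) := by
    rw [hz, hp]; module
  have hMB : 0 ≤ M * B * h ^ 2 := by positivity
  have hBh : 0 ≤ B * h ^ 2 := by positivity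
  have hC1h : 0 ≤ C₁ * h ^ 2 := by positivity
  have hC2h : 0 ≤ C₂ * h ^ 2 := by positivity
  have hFh : 0 ≤ F * h ^ 2 := by positivity
  rw [Prod.mk_sub_mk, Prod.norm_mk]
  refine max_le ?_ ?_
  · rw [ez]
    have h1 : ‖(h / 2) • (svMomentum h x k - V t)‖ ≤ 1 * (B * h ^ 2) := by
      rw [norm_smul, Real.norm_of_nonneg (by positivity)]
      gcongr; linarith
    have h2 : ‖(h ^ 2 / 4) • keplerForce (x k)‖ ≤ h ^ 2 / 4 * (F + M * B) := by
      rw [norm_smul, Real.norm_of_nonneg (by positivity)]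
      gcongr
    refine (norm_sub_le _ _).trans ((add_le_add ((norm_add_le _ _).trans (add_le_add
      ((norm_add_le _ _).trans (add_le_add hxk h1)) h2)) hT1).trans ?_)
    nlinarith
  · rw [ep]
    have h1 : ‖(h / 2) • (keplerForce (x k) - keplerForce (X t))‖ ≤ 1 * (M * (B * h ^ 2)) := by
      rw [norm_smul, Real.norm_of_nonneg (by positivity)]
      gcongr; linarith
    refine (norm_sub_le _ _).trans ((add_le_add ((norm_add_le _ _).trans (add_le_add hpk h1))
      hT2).trans ?_)
    nlinarith

theorem contDiff_dipoleHessian (m : Plane) :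
    ContDiff ℝ 2 fun t => dipoleHessian m (X t) (V t) := by
  have hXV : ContDiff ℝ 2 fun t => (X t, V t) := (hX.contDiff 2).1.prodMk (hX.contDiff 2).2
  exact contDiff_iff_contDiffAt.2 fun t =>
    (contDiffAt_dipoleHessian m (y := (X t, V t)) (hX.ne_zero t) 2).comp (f := fun t => (X t, V t))
      t hXV.contDiffAt

/-- The components of the Laplace-Runge-Lenz vector of the numerical solution, up to `O(h⁴)`. -/
theorem exists_svLrl_bound (K T : ℝ) (hT : 0 ≤ T) (m : Plane) {W : ℝ → ℝ}
    (hW : ∀ t, HasDerivAt W (dipoleHessian m (X t) (V t)) t) :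
    ∃ C ≥ 0, ∃ h₀ > 0, ∀ h, 0 < h → h < h₀ → ∀ x : ℕ → Plane, IsStormerVerlet h x →
      ‖x 0 - X 0‖ ≤ K * h ^ 2 → ‖svMomentum h x 0 - V 0‖ ≤ K * h ^ 2 →
      ∀ n : ℕ, n * h ≤ T →
        |angularMomentum m (svLrl h x n) - angularMomentum m (svLrl h x 0) -
          angularMomentum (X 0) (V 0) * h ^ 2 / 12 * (W (n * h) - W 0)| ≤ C * h ^ 4 := by
  set L := angularMomentum (X 0) (V 0) with hL
  obtain ⟨B, hB, h₁, hh₁, H⟩ := hX.exists_sv_midpoint_bound K T hT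
  obtain ⟨C₁, hC₁, δ₁, hδ₁, H₁⟩ := exists_trapezoid_defect_bound m (hX.isCompact_orbit 0 T)
    (by rintro _ ⟨t, -, rfl⟩; exact hX.ne_zero t)
  obtain ⟨C₂, hC₂, δ₂, hδ₂, H₂⟩ := exists_taylor_bounds hW (hX.contDiff_dipoleHessian m) 0 T
  obtain ⟨δ₃, hδ₃, M, hM, H₃⟩ := (hX.isCompact_orbit 0 T).exists_norm_sub_le
    (g := fun y => angularMomentum y.1 y.2 * dipoleHessian m y.1 y.2) (by
      rintro _ ⟨t, -, rfl⟩
      exact (contDiffAt_angularMomentum (n := 1) contDiffAt_fst contDiffAt_snd).mul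
        (contDiffAt_dipoleHessian m (hX.ne_zero t) 1))
  refine ⟨(C₁ + M * B + |L| * C₂) * T, by positivity,
    min (min 1 h₁) (min (min δ₁ δ₂) (min (δ₃ / (B + 1)) (δ₁ / (B + 1)))), by positivity,
    fun h hh hh₀ x hx hx0 hv0 => ?_⟩
  simp only [lt_min_iff] at hh₀
  obtain ⟨⟨hh1, hhh1⟩, ⟨hhδ1, hhδ2⟩, hhδ3, hhδ1'⟩ := hh₀
  rw [lt_div_iff₀ (by positivity)] at hhδ3 hhδ1'
  have hh22 : h ^ 2 ≤ h := pow_le_of_le_one hh.le hh1.le (by norm_num)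
  have hBh : B * h ^ 2 ≤ B * h := by gcongr
  have hstep : ∀ k : ℕ, ((k + 1 : ℕ) : ℝ) * h ≤ T →
      |angularMomentum m (svLrl h x (k + 1)) - angularMomentum m (svLrl h x k) -
        L * h ^ 2 / 12 * (W ((k + 1 : ℕ) * h) - W (k * h))| ≤
          (C₁ + M * B + |L| * C₂) * h ^ 5 := by
    intro k hk
    obtain ⟨p, hp⟩ : ∃ p, p = svMomentum h x k + (h / 2) • keplerForce (x k) := ⟨_, rfl⟩
    obtain ⟨z, hz⟩ : ∃ z, z = x k + (h / 2) • p := ⟨_, rfl⟩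
    have hzp := H h hh hhh1 x hx hx0 hv0 k hk z p hp hz
    have hkT : (k : ℝ) * h + h ≤ T := by push_cast at hk; linarith
    have hk0 : 0 ≤ (k : ℝ) * h := by positivity
    have hmid : (k : ℝ) * h + h / 2 ∈ Set.Icc 0 T := ⟨by positivity, by linarith⟩
    have hd := H₁ _ ⟨_, hmid, rfl⟩ z p (by linarith) (h / 2) (by positivity) (by linarith)
    rw [← hx.svLrl_succ_sub hh.ne' m k hp hz] at hd
    have hg := H₃ _ ⟨_, hmid, rfl⟩ (z, p) _ (by linarith) (by rw [sub_self, norm_zero]; exact hδ₃)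
    simp only [hX.angularMomentum_eq (k * h + h / 2), ← hL] at hg
    have hw := (H₂ (k * h) ⟨hk0, by linarith⟩ h hh.le hhδ2).2.1
    have hk1 : ((k + 1 : ℕ) : ℝ) * h = k * h + h := by push_cast; ring
    rw [hk1]
    generalize (k : ℝ) * h = t at *
    rw [Real.norm_eq_abs] at hg hw
    have hg' : |h ^ 3 / 12 * (angularMomentum z p * dipoleHessian m z p -
        L * dipoleHessian m (X (t + h / 2)) (V (t + h / 2)))| ≤ h ^ 3 / 12 * (M * (B * h ^ 2)) := by
      rw [abs_mul, abs_of_nonneg (by positivity : 0 ≤ h ^ 3 / 12)]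
      gcongr
      exact hg.trans (by gcongr)
    have hw' : |L * h ^ 2 / 12 *
        (W (t + h) - W t - h • dipoleHessian m (X (t + h / 2)) (V (t + h / 2)))| ≤
          |L| * h ^ 2 / 12 * (C₂ * h ^ 3) := by
      rw [abs_mul, abs_div, abs_mul, abs_of_nonneg (by positivity : 0 ≤ h ^ 2),
        abs_of_nonneg (by norm_num : (0 : ℝ) ≤ 12)]
      gcongr
    -- Three errors of size `h⁵`: the remainder of the trapezoidal defect, the replacement of the
    -- numerical midpoint by the exact one (`h³` times `h²`), and the midpoint rule for `W` (`h²`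
    -- times `h³`). Since `nh ≤ T`, their sum is `O(h⁴)`.
    have hsplit : angularMomentum m (svLrl h x (k + 1)) - angularMomentum m (svLrl h x k) -
        L * h ^ 2 / 12 * (W (t + h) - W t) =
        (angularMomentum m (svLrl h x (k + 1)) - angularMomentum m (svLrl h x k) -
          angularMomentum z p * (2 * (h / 2) ^ 3 / 3 * dipoleHessian m z p)) +
        h ^ 3 / 12 * (angularMomentum z p * dipoleHessian m z p -
          L * dipoleHessian m (X (t + h / 2)) (V (t + h / 2))) -
        L * h ^ 2 / 12 *
          (W (t + h) - W t - h • dipoleHessian m (X (t + h / 2)) (V (t + h / 2))) := by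
      rw [smul_eq_mul]; ring
    rw [hsplit]
    refine (abs_sub _ _).trans ((add_le_add ((abs_add_le _ _).trans (add_le_add hd hg')) hw').trans ?_)
    have e1 : 0 ≤ C₁ * h ^ 5 := by positivity
    have e2 : 0 ≤ M * B * h ^ 5 := by positivity
    have e3 : 0 ≤ |L| * C₂ * h ^ 5 := by positivity
    linarith
  have hsum : ∀ n : ℕ, n * h ≤ T →
      |angularMomentum m (svLrl h x n) - angularMomentum m (svLrl h x 0) -
        L * h ^ 2 / 12 * (W (n * h) - W 0)| ≤ (C₁ + M * B + |L| * C₂) * h ^ 5 * n := by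
    intro n
    induction n with
    | zero => simp
    | succ n ih =>
      intro hn
      have h1 := ih (le_trans (by gcongr; simp) hn)
      have h2 := hstep n hn
      have h3 := abs_add_le (angularMomentum m (svLrl h x n) - angularMomentum m (svLrl h x 0) -
        L * h ^ 2 / 12 * (W (n * h) - W 0)) (angularMomentum m (svLrl h x (n + 1)) -
        angularMomentum m (svLrl h x n) - L * h ^ 2 / 12 * (W ((n + 1 : ℕ) * h) - W (n * h)))
      have h4 : ∀ a b c u v w l : ℝ, a - b - l * (u - v) + (c - a - l * (w - u)) =
        c - b - l * (w - v) := by intros; ring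
      rw [h4] at h3
      refine h3.trans ((add_le_add h1 h2).trans ?_)
      push_cast; linarith
  intro n hn
  refine (hsum n hn).trans ?_
  calc (C₁ + M * B + |L| * C₂) * h ^ 5 * n = (C₁ + M * B + |L| * C₂) * (n * h) * h ^ 4 := by ring
    _ ≤ _ := by gcongr

/-- The LRL vector is Lipschitz near the compact orbit, so it inherits the second order accuracy.
This keeps it close enough to `m` for the angle estimates, whose quadratic remainder is then
`O(h⁴)`. -/
theorem exists_svLrl_sub_bound (K T : ℝ) (hT : 0 ≤ T) :
    ∃ C ≥ 0, ∃ h₀ > 0, ∀ h, 0 < h → h < h₀ → ∀ x : ℕ → Plane, IsStormerVerlet h x →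
      ‖x 0 - X 0‖ ≤ K * h ^ 2 → ‖svMomentum h x 0 - V 0‖ ≤ K * h ^ 2 →
      ∀ n : ℕ, n * h ≤ T → ‖svLrl h x n - lrlVector (X 0) (V 0)‖ ≤ C * h ^ 2 := by
  obtain ⟨B, hB, h₁, hh₁, H⟩ := hX.exists_sv_error_bound K T hT
  obtain ⟨δ, hδ, M, hM, H'⟩ := (hX.isCompact_orbit 0 T).exists_norm_sub_le
    (g := fun y => lrlVector y.1 y.2) (by
      rintro _ ⟨t, -, rfl⟩; exact contDiffAt_lrlVector (hX.ne_zero t) 1)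
  refine ⟨M * B, by positivity, min (min 1 h₁) (δ / (B + 1)), by positivity,
    fun h hh hh₀ x hx hx0 hv0 n hn => ?_⟩
  simp only [lt_min_iff] at hh₀
  obtain ⟨⟨hh1, hhh1⟩, hhδ⟩ := hh₀
  rw [lt_div_iff₀ (by positivity)] at hhδ
  have hh22 : h ^ 2 ≤ h := pow_le_of_le_one hh.le hh1.le (by norm_num)
  have hBh : B * h ^ 2 ≤ B * h := by gcongr
  obtain ⟨hxn, hpn⟩ := H h hh hhh1 x hx hx0 hv0 n hn
  have hd : ‖(x n, svMomentum h x n) - (X (n * h), V (n * h))‖ ≤ B * h ^ 2 := max_le hxn hpn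
  have := H' _ ⟨n * h, ⟨by positivity, hn⟩, rfl⟩ (x n, svMomentum h x n) _
    (by linarith) (by rw [sub_self, norm_zero]; exact hδ)
  simp only [hX.lrlVector_eq (n * h)] at this
  rw [svLrl, mul_assoc]
  exact this.trans (by gcongr)

/-- The angle through which the Laplace-Runge-Lenz vector of the numerical solution turns,
up to `O(h⁴)`. -/
theorem exists_svAngle_bound (K T : ℝ) (hT : 0 ≤ T) (hm : lrlVector (X 0) (V 0) ≠ 0) {W : ℝ → ℝ}
    (hW : ∀ t, HasDerivAt W (dipoleHessian (lrlVector (X 0) (V 0)) (X t) (V t)) t) :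
    ∃ C ≥ 0, ∃ h₀ > 0, ∀ h, 0 < h → h < h₀ → ∀ x : ℕ → Plane, IsStormerVerlet h x →
      ‖x 0 - X 0‖ ≤ K * h ^ 2 → ‖svMomentum h x 0 - V 0‖ ≤ K * h ^ 2 →
      ∀ n : ℕ, n * h ≤ T →
        |svAngle h x n - angularMomentum (X 0) (V 0) * h ^ 2 / 12 * (W (n * h) - W 0) /
          ‖lrlVector (X 0) (V 0)‖ ^ 2| ≤ C * h ^ 4 := by
  obtain ⟨C₁, hC₁, h₁, hh₁, H₁⟩ := hX.exists_svLrl_bound K T hT _ hW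
  obtain ⟨C₂, hC₂, h₂, hh₂, H₂⟩ := hX.exists_svLrl_sub_bound K T hT
  set m := lrlVector (X 0) (V 0) with hmdef
  have hm0 : 0 < ‖m‖ := norm_pos_iff.2 hm
  refine ⟨(C₁ + 2 * C₂ ^ 2) / ‖m‖ ^ 2, by positivity,
    min (min 1 (‖m‖ / 2 / (C₂ + 1))) (min h₁ h₂), by positivity,
    fun h hh hh₀ x hx hx0 hv0 n hn => ?_⟩
  simp only [lt_min_iff] at hh₀
  obtain ⟨⟨hh1, hhm⟩, hhh1, hhh2⟩ := hh₀
  rw [lt_div_iff₀ (by positivity)] at hhm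
  have hh22 : h ^ 2 ≤ h := pow_le_of_le_one hh.le hh1.le (by norm_num)
  have hCh : C₂ * h ^ 2 ≤ C₂ * h := by gcongr
  have hR := H₂ h hh hhh2 x hx hx0 hv0
  have hnear : ∀ k : ℕ, k * h ≤ T → ‖svLrl h x k - m‖ ≤ ‖m‖ / 2 := fun k hk =>
    (hR k hk).trans (by linarith)
  have htel : svAngle h x n = signedAngle m (svLrl h x n) - signedAngle m (svLrl h x 0) := by
    rw [svAngle, ← Finset.sum_range_sub (fun k => signedAngle m (svLrl h x k))]
    refine Finset.sum_congr rfl fun k hk => ?_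
    have hk1 : ((k + 1 : ℕ) : ℝ) * h ≤ T :=
      le_trans (by gcongr; exact_mod_cast Finset.mem_range.1 hk) hn
    exact signedAngle_eq_sub hm (hnear k (le_trans (by gcongr; simp) hk1)) (hnear (k + 1) hk1)
  have hang : ∀ k : ℕ, k * h ≤ T →
      |signedAngle m (svLrl h x k) - angularMomentum m (svLrl h x k) / ‖m‖ ^ 2| ≤
        C₂ ^ 2 / ‖m‖ ^ 2 * h ^ 4 := fun k hk => by
    refine (abs_signedAngle_sub_le hm (hnear k hk)).trans ?_
    calc (‖svLrl h x k - m‖ / ‖m‖) ^ 2 ≤ (C₂ * h ^ 2 / ‖m‖) ^ 2 := by gcongr; exact hR k hk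
      _ = _ := by ring
  have ha := hang n hn
  have hb := hang 0 (by simpa using hT)
  have hc := H₁ h hh hhh1 x hx hx0 hv0 n hn
  have hc' : |(angularMomentum m (svLrl h x n) - angularMomentum m (svLrl h x 0) -
      angularMomentum (X 0) (V 0) * h ^ 2 / 12 * (W (n * h) - W 0)) / ‖m‖ ^ 2| ≤
        C₁ * h ^ 4 / ‖m‖ ^ 2 := by
    rw [abs_div, abs_of_nonneg (by positivity : 0 ≤ ‖m‖ ^ 2)]
    gcongr
  rw [htel]
  have e1 : (C₁ + 2 * C₂ ^ 2) / ‖m‖ ^ 2 * h ^ 4 =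
      C₁ * h ^ 4 / ‖m‖ ^ 2 + 2 * (C₂ ^ 2 / ‖m‖ ^ 2 * h ^ 4) := by ring
  rw [sub_div, sub_div] at hc'
  rw [e1]
  rw [abs_le] at *
  constructor <;> linarith

/-- The precession of the numerical solution, up to `O(h⁴)`. -/
theorem exists_svPrecession_bound (K T : ℝ) (hT : 0 ≤ T) (hm : lrlVector (X 0) (V 0) ≠ 0)
    {W : ℝ → ℝ} (hW : ∀ t, HasDerivAt W (dipoleHessian (lrlVector (X 0) (V 0)) (X t) (V t)) t) :
    ∃ C ≥ 0, ∃ h₀ > 0, ∀ h, 0 < h → h < h₀ → ∀ x : ℕ → Plane, IsStormerVerlet h x →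
      ‖x 0 - X 0‖ ≤ K * h ^ 2 → ‖svMomentum h x 0 - V 0‖ ≤ K * h ^ 2 →
        |svPrecession h x T - angularMomentum (X 0) (V 0) * h ^ 2 / 12 * (W T - W 0) /
          ‖lrlVector (X 0) (V 0)‖ ^ 2| ≤ C * h ^ 4 := by
  -- The interpolation also uses the grid point after `T`, which lies before `T + 1` because `h <
  -- 1`.
  obtain ⟨C₁, hC₁, h₁, hh₁, H₁⟩ := hX.exists_svAngle_bound K (T + 1) (by positivity) hm hW
  obtain ⟨C₂, hC₂, δ₂, hδ₂, H₂⟩ := exists_taylor_bounds hW (hX.contDiff_dipoleHessian _) 0 T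
  set m := lrlVector (X 0) (V 0) with hmdef
  set L := angularMomentum (X 0) (V 0) with hL
  have hm0 : 0 < ‖m‖ := norm_pos_iff.2 hm
  refine ⟨C₁ + |L| / 12 / ‖m‖ ^ 2 * (2 * C₂), by positivity, min 1 (min h₁ δ₂), by positivity,
    fun h hh hh₀ x hx hx0 hv0 => ?_⟩
  simp only [lt_min_iff] at hh₀
  obtain ⟨hh1, hhh1, hhδ⟩ := hh₀
  rw [svPrecession]
  set N := ⌊T / h⌋₊ with hN
  have hN0 : (N : ℝ) ≤ T / h := Nat.floor_le (by positivity)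
  have hN1 : T / h < N + 1 := Nat.lt_floor_add_one _
  obtain ⟨lam, hlam⟩ : ∃ lam, lam = T / h - N := ⟨_, rfl⟩
  have hlam0 : 0 ≤ lam := by linarith
  have hlam1 : lam < 1 := by linarith
  have hTN : T = N * h + lam * h := by rw [hlam]; field_simp; ring
  have hlh : lam * h < h := mul_lt_of_lt_one_left hh hlam1
  have hlh0 : 0 ≤ lam * h := by positivity
  have hNT : (N : ℝ) * h ∈ Set.Icc 0 T := ⟨by positivity, by linarith⟩
  have hNh : ((N + 1 : ℕ) : ℝ) * h = N * h + h := by push_cast; ring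
  have ha := H₁ h hh hhh1 x hx hx0 hv0 N (by linarith)
  have hb := H₁ h hh hhh1 x hx hx0 hv0 (N + 1) (by linarith)
  have hw1 := (H₂ _ hNT h hh.le hhδ).1
  have hw2 := (H₂ _ hNT (lam * h) hlh0 (hlh.trans hhδ)).1
  rw [← hTN] at hw2
  rw [hNh] at hb
  rw [← hlam]
  generalize (N : ℝ) * h = t at *
  rw [Real.norm_eq_abs, smul_eq_mul] at hw1 hw2
  set κ := L * h ^ 2 / 12 / ‖m‖ ^ 2 with hκ
  have hκabs : |κ| = |L| * h ^ 2 / 12 / ‖m‖ ^ 2 := by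
    rw [hκ, abs_div, abs_div, abs_mul, abs_of_nonneg (by positivity : 0 ≤ h ^ 2),
      abs_of_nonneg (by positivity : 0 ≤ ‖m‖ ^ 2), abs_of_nonneg (by norm_num : (0 : ℝ) ≤ 12)]
  have hform : ∀ w, L * h ^ 2 / 12 * w / ‖m‖ ^ 2 = κ * w := fun w => by rw [hκ]; ring
  rw [hform] at ha hb ⊢
  set w := dipoleHessian m (X t) (V t)
  -- A convex combination of the errors at the two grid points, plus `κ = O(h²)` times the linear
  -- interpolation error of `W`, which is `O(h²)`: both increments of `W` are compared with the same
  -- slope `w`.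
  have hsplit : svAngle h x N + lam * (svAngle h x (N + 1) - svAngle h x N) - κ * (W T - W 0) =
      (1 - lam) * (svAngle h x N - κ * (W t - W 0)) +
      lam * (svAngle h x (N + 1) - κ * (W (t + h) - W 0)) +
      κ * (lam * (W (t + h) - W t - h * w) - (W T - W t - lam * h * w)) := by ring
  rw [hsplit]
  have b1 : |(1 - lam) * (svAngle h x N - κ * (W t - W 0))| ≤ (1 - lam) * (C₁ * h ^ 4) := by
    rw [abs_mul, abs_of_nonneg (by linarith : 0 ≤ 1 - lam)]
    gcongr
  have b2 : |lam * (svAngle h x (N + 1) - κ * (W (t + h) - W 0))| ≤ lam * (C₁ * h ^ 4) := by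
    rw [abs_mul, abs_of_nonneg hlam0]
    gcongr
  have b3 : |κ * (lam * (W (t + h) - W t - h * w) - (W T - W t - lam * h * w))| ≤
      |κ| * (1 * (C₂ * h ^ 2) + C₂ * h ^ 2) := by
    rw [abs_mul]
    gcongr
    refine (abs_sub _ _).trans (add_le_add ?_ (hw2.trans (by gcongr)))
    rw [abs_mul, abs_of_nonneg hlam0]
    gcongr
  refine (abs_add_le _ _).trans ((add_le_add ((abs_add_le _ _).trans (add_le_add b1 b2)) b3).trans ?_)
  rw [hκabs]
  apply le_of_eq
  ring

end IsKeplerSolution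

/-! ### The Euler-Lagrange equation of the modified Lagrangian -/

/-- The second order correction of the momentum `∂L/∂v` of the modified Lagrangian. -/
noncomputable def momentumCorrection (x v : Plane) : Plane :=
  (⟪x, v⟫ / (2 * ‖x‖ ^ 5)) • x - (6 * ‖x‖ ^ 3)⁻¹ • v

/-- The second order correction of the force `∂L/∂x` of the modified Lagrangian. -/
noncomputable def forceCorrection (x v : Plane) : Plane :=
  (‖v‖ ^ 2 / (4 * ‖x‖ ^ 5) - (6 * ‖x‖ ^ 6)⁻¹ - 5 * ⟪x, v⟫ ^ 2 / (4 * ‖x‖ ^ 7)) • x +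
    (⟪x, v⟫ / (2 * ‖x‖ ^ 5)) • v

/-- Given differentiability, derivatives along lines identify the gradient, so the derivative rules
for curves suffice to compute it. -/
theorem hasGradientAt_of_hasDerivAt_line {f : Plane → ℝ} {g x : Plane} (hf : DifferentiableAt ℝ f x)
    (h : ∀ d : Plane, HasDerivAt (fun t : ℝ => f (x + t • d)) ⟪g, d⟫ 0) : HasGradientAt f g x := by
  have h1 := hf.hasFDerivAt
  refine hasGradientAt_iff_hasFDerivAt.2 (h1.congr_fderiv (ContinuousLinearMap.ext fun d => ?_))
  have hline : HasDerivAt (fun t : ℝ => x + t • d) d 0 := by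
    simpa using ((hasDerivAt_id (0 : ℝ)).smul_const d).const_add x
  have h2 : HasFDerivAt f (fderiv ℝ f x) (x + (0 : ℝ) • d) := by simpa using h1
  exact ((h d).unique (h2.comp_hasDerivAt 0 hline)).symm

theorem hasGradientAt_svModLagrangian_vel (h : ℝ) (x v : Plane) :
    HasGradientAt (fun w => svModLagrangian h x w) (v + h ^ 2 • momentumCorrection x v) v := by
  refine hasGradientAt_of_hasDerivAt_line ?_ fun d => ?_
  · unfold svModLagrangian
    have h1 : DifferentiableAt ℝ (fun w : Plane => ‖w‖ ^ 2) v := differentiableAt_id.norm_sq ℝ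
    have h2 : DifferentiableAt ℝ (fun w : Plane => ⟪x, w⟫) v :=
      (differentiableAt_const x).inner ℝ differentiableAt_id
    fun_prop
  · have hline : HasDerivWithinAt (fun t : ℝ => v + t • d) d Set.univ 0 := by
      rw [hasDerivWithinAt_univ]
      simpa using ((hasDerivAt_id (0 : ℝ)).smul_const d).const_add v
    have h1 := hline.norm_sq
    have h2 := hline.inner_left_const x
    rw [← hasDerivWithinAt_univ]
    refine (((h1.const_mul (1 / 2)).add_const (1 / ‖x‖)).add
      ((((h1.div_const (‖x‖ ^ 3)).const_mul 2).const_sub (1 / ‖x‖ ^ 4) |>.add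
        (((h2.pow 2).div_const (‖x‖ ^ 5)).const_mul 6)).const_mul (h ^ 2 / 24))).congr_deriv ?_
    simp only [zero_smul, add_zero, momentumCorrection, inner_add_left, inner_sub_left,
      real_inner_smul_left]
    rw [mul_inv, mul_comm 2 (‖x‖ ^ 5), ← div_div]
    push_cast
    ring

theorem hasGradientAt_svModLagrangian_pos (h : ℝ) {x : Plane} (hx : x ≠ 0) (v : Plane) :
    HasGradientAt (fun y => svModLagrangian h y v) (keplerForce x + h ^ 2 • forceCorrection x v) x := by
  have hn : ‖x‖ ≠ 0 := norm_ne_zero_iff.2 hx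
  refine hasGradientAt_of_hasDerivAt_line ?_ fun d => ?_
  · unfold svModLagrangian
    have h1 : ContDiffAt ℝ 1 (fun y : Plane => ‖y‖) x := contDiffAt_id.norm ℝ hx
    have h2 : ContDiffAt ℝ 1 (fun y : Plane => ⟪y, v⟫) x := contDiffAt_id.inner ℝ contDiffAt_const
    exact (((contDiffAt_const.add (contDiffAt_const.div h1 hn)).add (contDiffAt_const.mul
      (((contDiffAt_const.div (h1.pow 4) (pow_ne_zero 4 hn)).sub (contDiffAt_const.mul
        (contDiffAt_const.div (h1.pow 3) (pow_ne_zero 3 hn)))).add (contDiffAt_const.mul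
          ((h2.pow 2).div (h1.pow 5) (pow_ne_zero 5 hn)))))).differentiableAt (by norm_num))
  · have hline : HasDerivWithinAt (fun t : ℝ => x + t • d) d Set.univ 0 := by
      rw [hasDerivWithinAt_univ]
      simpa using ((hasDerivAt_id (0 : ℝ)).smul_const d).const_add x
    have hx0 : x + (0 : ℝ) • d = x := by simp
    have h1 := hline.norm_of_ne (by rwa [hx0])
    have h2 : HasDerivWithinAt (fun t : ℝ => ⟪x + t • d, v⟫) ⟪d, v⟫ Set.univ 0 := by
      have := hline.inner_left_const v
      simpa only [real_inner_comm v] using this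
    have hn0 : ‖x + (0 : ℝ) • d‖ ≠ 0 := by rwa [hx0]
    have hc : ∀ c : ℝ, HasDerivWithinAt (fun _ : ℝ => c) 0 Set.univ 0 := fun c =>
      hasDerivWithinAt_const _ _ _
    rw [← hasDerivWithinAt_univ]
    refine (((hc (1 / 2 * ‖v‖ ^ 2)).add ((hc 1).div h1 hn0)).add
      (((((hc 1).div (h1.pow 4) (pow_ne_zero 4 hn0)).sub (((hc (‖v‖ ^ 2)).div (h1.pow 3)
        (pow_ne_zero 3 hn0)).const_mul 2)).add (((h2.pow 2).div (h1.pow 5)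
          (pow_ne_zero 5 hn0)).const_mul 6)).const_mul (h ^ 2 / 24))).congr_deriv ?_
    simp only [Pi.pow_apply, hx0, keplerForce, forceCorrection, inner_add_left, inner_neg_left,
      real_inner_smul_left, real_inner_comm d v]
    field_simp
    push_cast
    ring

namespace IsEulerLagrangeSolution

variable {h T : ℝ} {x v : ℝ → Plane} (hx : IsEulerLagrangeSolution (svModLagrangian h) T x v)
include hx

theorem hasDerivWithinAt_momentum {t : ℝ} (ht : t ∈ Set.Icc 0 T) :
    HasDerivWithinAt (fun s => v s + h ^ 2 • momentumCorrection (x s) (v s))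
      (keplerForce (x t) + h ^ 2 • forceCorrection (x t) (v t)) (Set.Icc 0 T) t := by
  have h1 := hx.eulerLagrange t ht
  rw [(hasGradientAt_svModLagrangian_pos h (hx.ne_zero t ht) (v t)).gradient] at h1
  have h2 : (fun s => gradient (fun w => svModLagrangian h (x s) w) (v s)) =
      fun s => v s + h ^ 2 • momentumCorrection (x s) (v s) :=
    funext fun s => (hasGradientAt_svModLagrangian_vel h (x s) (v s)).gradient
  rwa [h2] at h1

theorem continuousOn_pos : ContinuousOn x (Set.Icc 0 T) := fun t ht =>
  (hx.hasDeriv t ht).continuousWithinAt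

end IsEulerLagrangeSolution

theorem angularMomentum_momentum (h : ℝ) (x v : Plane) :
    angularMomentum x (v + h ^ 2 • momentumCorrection x v) =
      angularMomentum x v - h ^ 2 * (angularMomentum x v / (6 * ‖x‖ ^ 3)) := by
  simp only [momentumCorrection, angularMomentum_add_right, angularMomentum_smul_right,
    angularMomentum_sub_right, angularMomentum_self]
  ring

/-- The link between the two halves of the theorem: the force correction contains the same Hessian
as the trapezoidal defect. The `|x|⁻⁶` term cancels, to order `h²`, against the difference between
`ℓ` and `x × v`. -/
theorem inner_forceCorrection (m : Plane) {x : Plane} (hx : x ≠ 0) (v : Plane) :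
    ⟪m, forceCorrection x v⟫ = -(⟪m, x⟫ / (6 * ‖x‖ ^ 6)) - dipoleHessian m x v / 12 := by
  have hn : ‖x‖ ≠ 0 := norm_ne_zero_iff.2 hx
  simp only [forceCorrection, dipoleHessian, inner_add_right, real_inner_smul_right]
  field_simp
  ring

namespace IsEulerLagrangeSolution

variable {h T : ℝ} {x v : ℝ → Plane} (hx : IsEulerLagrangeSolution (svModLagrangian h) T x v)
include hx

/-- The angular momentum of the modified Lagrangian is conserved. -/
theorem angularMomentum_momentum_eq {t : ℝ} (ht : t ∈ Set.Icc 0 T) :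
    angularMomentum (x t) (v t + h ^ 2 • momentumCorrection (x t) (v t)) =
      angularMomentum (x 0) (v 0 + h ^ 2 • momentumCorrection (x 0) (v 0)) := by
  have hd : ∀ t ∈ Set.Icc 0 T, HasDerivWithinAt
      (fun t => angularMomentum (x t) (v t + h ^ 2 • momentumCorrection (x t) (v t))) 0
        (Set.Icc 0 T) t := fun t ht => by
    refine ((hx.hasDeriv t ht).angularMomentum (hx.hasDerivWithinAt_momentum ht)).congr_deriv ?_
    simp only [momentumCorrection, forceCorrection, angularMomentum_add_right,
      angularMomentum_smul_right, angularMomentum_sub_right, angularMomentum_self,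
      angularMomentum_keplerForce]
    simp only [angularMomentum]
    ring
  have := norm_image_sub_le_of_norm_deriv_le_segment' (C := 0) hd (by simp) t ht
  rw [zero_mul, norm_le_zero_iff, sub_eq_zero] at this
  exact this

/-- Evolution of a component of the Laplace-Runge-Lenz vector of the modified system. -/
theorem hasDerivWithinAt_lrl (m : Plane) {ℓ : ℝ}
    (hℓ : ℓ = angularMomentum (x 0) (v 0 + h ^ 2 • momentumCorrection (x 0) (v 0))) {t : ℝ}
    (ht : t ∈ Set.Icc 0 T) :
    HasDerivWithinAt (fun t => -(ℓ * ⟪m, v t + h ^ 2 • momentumCorrection (x t) (v t)⟫) -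
        angularMomentum m (x t) / ‖x t‖)
      (h ^ 2 / 12 * (angularMomentum (x t) (v t) * dipoleHessian m (x t) (v t)) -
        h ^ 4 * (angularMomentum (x t) (v t) * (⟪m, x t⟫ / (6 * ‖x t‖ ^ 6) +
          dipoleHessian m (x t) (v t) / 12) / (6 * ‖x t‖ ^ 3))) (Set.Icc 0 T) t := by
  have hx0 := hx.ne_zero t ht
  have hn : ‖x t‖ ≠ 0 := norm_ne_zero_iff.2 hx0
  refine ((((hx.hasDerivWithinAt_momentum ht).inner_left_const m).const_mul ℓ).neg.sub
    ((hx.hasDeriv t ht).angularMomentum_unit hx0 m)).congr_deriv ?_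
  rw [inner_add_right, real_inner_smul_right, inner_keplerForce, inner_forceCorrection m hx0, hℓ,
    ← hx.angularMomentum_momentum_eq ht, angularMomentum_momentum]
  field_simp
  ring

end IsEulerLagrangeSolution

/-! ### Solutions of the modified system stay near the Kepler orbit -/

/-- A continuous function that is at most `ε` wherever it has not exceeded `δ > ε` before is at
most `ε` everywhere. -/
theorem le_of_continuousOn_of_forall_le {d : ℝ → ℝ} {T δ ε : ℝ} (hd : ContinuousOn d (Set.Icc 0 T))
    (hεδ : ε < δ) (h0 : d 0 ≤ δ)
    (hstep : ∀ t ∈ Set.Icc 0 T, (∀ s ∈ Set.Ico 0 t, d s < δ) → d t ≤ δ → d t ≤ ε) :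
    ∀ t ∈ Set.Icc 0 T, d t ≤ ε := by
  have hlt : ∀ t ∈ Set.Icc 0 T, d t < δ := by
    by_contra! hex
    have hcl : IsCompact (Set.Icc 0 T ∩ d ⁻¹' Set.Ici δ) :=
      isCompact_Icc.of_isClosed_subset (hd.preimage_isClosed_of_isClosed isClosed_Icc isClosed_Ici)
        Set.inter_subset_left
    -- At the first time with `δ ≤ d`, continuity forces `d = δ`, while the hypothesis gives `d ≤ ε
    -- < δ`.
    obtain ⟨t, ⟨ht, hδt⟩, hmin⟩ := hcl.exists_isLeast (by
      obtain ⟨t, ht, hδt⟩ := hex; exact ⟨t, ht, hδt⟩)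
    have hbefore : ∀ s ∈ Set.Ico 0 t, d s < δ := fun s hs => by
      by_contra! hsd
      exact absurd (hmin ⟨⟨hs.1, hs.2.le.trans ht.2⟩, hsd⟩) (not_le.2 hs.2)
    obtain ⟨s, hs, hds⟩ := intermediate_value_Icc ht.1
      (hd.mono (Set.Icc_subset_Icc_right ht.2)) ⟨h0, hδt⟩
    have hst : s = t := by
      by_contra hne
      exact (hbefore s ⟨hs.1, lt_of_le_of_ne hs.2 hne⟩).ne hds
    rw [hst] at hds
    linarith [hstep t ht hbefore hds.le]
  exact fun t ht => hstep t ht (fun s hs => hlt s ⟨hs.1, hs.2.le.trans ht.2⟩) (hlt t ht).le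

theorem IsCompact.exists_norm_le_nhds {E F : Type*} [NormedAddCommGroup E] [NormedSpace ℝ E]
    [NormedAddCommGroup F] [NormedSpace ℝ F] {g : E → F} {O : Set E} (hO : IsCompact O)
    (hg : ∀ y ∈ O, ContDiffAt ℝ 1 g y) :
    ∃ δ > 0, ∃ Q ≥ 0, ∀ y ∈ O, ∀ z, ‖z - y‖ < δ → ‖g z‖ ≤ Q := by
  obtain ⟨δ, hδ, M, hM, H⟩ := hO.exists_norm_sub_le hg
  obtain ⟨B, hB⟩ := hO.exists_bound_of_continuousOn (f := g)
    fun y hy => (hg y hy).continuousAt.continuousWithinAt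
  refine ⟨δ, hδ, |B| + M * δ, by positivity, fun y hy z hz => ?_⟩
  have h1 := H y hy z y hz (by simpa)
  have h2 := hB y hy
  have h3 := norm_le_norm_add_norm_sub' (g z) (g y)
  have h4 : M * ‖z - y‖ ≤ M * δ := by gcongr
  linarith [le_abs_self B]

section Smoothness

variable {y : Plane × Plane} (hy : y.1 ≠ 0) (n : WithTop ℕ∞)
include hy

theorem contDiffAt_momentumCorrection :
    ContDiffAt ℝ n (fun y : Plane × Plane => momentumCorrection y.1 y.2) y := by
  have h0 : ‖y.1‖ ≠ 0 := norm_ne_zero_iff.2 hy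
  have hn : ContDiffAt ℝ n (fun y : Plane × Plane => ‖y.1‖) y := contDiffAt_fst.norm ℝ hy
  have hxv : ContDiffAt ℝ n (fun y : Plane × Plane => ⟪y.1, y.2⟫) y :=
    contDiffAt_fst.inner ℝ contDiffAt_snd
  exact ((hxv.div (contDiffAt_const.mul (hn.pow 5)) (by positivity)).smul contDiffAt_fst).sub
    (((contDiffAt_const.mul (hn.pow 3)).inv (by positivity)).smul contDiffAt_snd)

theorem contDiffAt_forceCorrection :
    ContDiffAt ℝ n (fun y : Plane × Plane => forceCorrection y.1 y.2) y := by
  have h0 : ‖y.1‖ ≠ 0 := norm_ne_zero_iff.2 hy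
  have hn : ContDiffAt ℝ n (fun y : Plane × Plane => ‖y.1‖) y := contDiffAt_fst.norm ℝ hy
  have hv : ContDiffAt ℝ n (fun y : Plane × Plane => ‖y.2‖ ^ 2) y := contDiffAt_snd.norm_sq ℝ
  have hxv : ContDiffAt ℝ n (fun y : Plane × Plane => ⟪y.1, y.2⟫) y :=
    contDiffAt_fst.inner ℝ contDiffAt_snd
  exact ((((hv.div (contDiffAt_const.mul (hn.pow 5)) (by positivity)).sub
    ((contDiffAt_const.mul (hn.pow 6)).inv (by positivity))).sub
    ((contDiffAt_const.mul (hxv.pow 2)).div (contDiffAt_const.mul (hn.pow 7)) (by positivity))).smul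
    contDiffAt_fst).add ((hxv.div (contDiffAt_const.mul (hn.pow 5)) (by positivity)).smul
      contDiffAt_snd)

end Smoothness

namespace IsKeplerSolution

variable {X V : ℝ → Plane} (hX : IsKeplerSolution X V)
include hX

/-- The Euler-Lagrange equation gives the derivative of the canonical momentum `P`, not of `v`. In
the variables `(x, P)` the curve solves the Kepler system with defect `O(h²)`, and Gronwall's
inequality applies; `P - v = O(h²)` then returns to `v`. -/
theorem exists_modified_error_bound (K T : ℝ) (hT : 0 ≤ T) :
    ∃ C ≥ 0, ∃ h₀ > 0, ∀ h, 0 < h → h < h₀ → ∀ x v : ℝ → Plane,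
      IsEulerLagrangeSolution (svModLagrangian h) T x v →
      ‖x 0 - X 0‖ ≤ K * h ^ 2 → ‖v 0 - V 0‖ ≤ K * h ^ 2 →
      ∀ t ∈ Set.Icc 0 T, ‖(x t, v t) - (X t, V t)‖ ≤ C * h ^ 2 := by
  have hne : ∀ y ∈ (fun t => (X t, V t)) '' Set.Icc 0 T, y.1 ≠ 0 := by
    rintro _ ⟨t, -, rfl⟩; exact hX.ne_zero t
  have hq : ∀ y ∈ (fun t => (X t, V t)) '' Set.Icc 0 T,
      ContDiffAt ℝ 1 (fun y : Plane × Plane => momentumCorrection y.1 y.2) y := fun y hy =>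
    contDiffAt_momentumCorrection (hne y hy) 1
  have hs : ∀ y ∈ (fun t => (X t, V t)) '' Set.Icc 0 T,
      ContDiffAt ℝ 1 (fun y : Plane × Plane => forceCorrection y.1 y.2) y := fun y hy =>
    contDiffAt_forceCorrection (hne y hy) 1
  obtain ⟨δ₁, hδ₁, Q₁, hQ₁, H₁⟩ := (hX.isCompact_orbit 0 T).exists_norm_le_nhds hq
  obtain ⟨δ₂, hδ₂, Q₂, hQ₂, H₂⟩ := (hX.isCompact_orbit 0 T).exists_norm_le_nhds hs
  obtain ⟨δ₃, hδ₃, M, hM, H₃⟩ := ((isCompact_Icc (a := 0) (b := T)).image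
    hX.continuous_pos).exists_norm_sub_le (g := keplerForce) (by
      rintro _ ⟨t, -, rfl⟩; exact contDiffAt_keplerForce (hX.ne_zero t) 1)
  obtain ⟨δ, hδ, hδ1, hδ2, hδ3⟩ : ∃ δ > 0, δ < δ₁ ∧ δ < δ₂ ∧ δ < δ₃ := by
    obtain ⟨δ, h0, h1⟩ := exists_between (lt_min hδ₁ (lt_min hδ₂ hδ₃))
    simp only [lt_min_iff] at h1
    exact ⟨δ, h0, h1⟩
  -- The `1` is the Lipschitz constant of the velocity component; it also makes division by `M'` in
  -- the Gronwall bound harmless.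
  obtain ⟨M', hM'⟩ : ∃ M' : NNReal, M' = Real.toNNReal (max 1 M) := ⟨_, rfl⟩
  have hM'c : (M' : ℝ) = max 1 M := by rw [hM', Real.coe_toNNReal _ (by positivity)]
  have hM'1 : (1 : ℝ) ≤ M' := by rw [hM'c]; exact le_max_left _ _
  obtain ⟨Q, hQ⟩ : ∃ Q, Q = Q₁ + Q₂ := ⟨_, rfl⟩
  have hQ0 : 0 ≤ Q := by rw [hQ]; positivity
  obtain ⟨B, hB⟩ : ∃ B, B = (|K| + 2 * Q) * Real.exp (M' * T) := ⟨_, rfl⟩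
  have hB0 : 0 ≤ B := by rw [hB]; positivity
  refine ⟨B + Q, by positivity, min 1 (δ / (B + Q + |K| + 1)), by positivity,
    fun h hh hh₀ x v hxv hx0 hv0 => ?_⟩
  simp only [lt_min_iff] at hh₀
  obtain ⟨hh1, hhδ⟩ := hh₀
  rw [lt_div_iff₀ (by positivity)] at hhδ
  have hh22 : h ^ 2 ≤ h := pow_le_of_le_one hh.le hh1.le (by norm_num)
  have hsmall : (B + Q + |K| + 1) * h ^ 2 < δ := by
    have : (B + Q + |K| + 1) * h ^ 2 ≤ (B + Q + |K| + 1) * h := by gcongr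
    linarith
  have hKh : K * h ^ 2 ≤ |K| * h ^ 2 := by gcongr; exact le_abs_self K
  have hBh : 0 ≤ B * h ^ 2 := by positivity
  have hQh : 0 ≤ Q * h ^ 2 := by positivity
  have hQ1h : Q₁ * h ^ 2 ≤ Q * h ^ 2 := by gcongr; linarith
  have hQ2h : Q₂ * h ^ 2 ≤ Q * h ^ 2 := by gcongr; linarith
  have hh0 : 0 < h ^ 2 := by positivity
  have hKh0 : 0 ≤ |K| * h ^ 2 := by positivity
  have hd0 : ‖(x 0, v 0) - (X 0, V 0)‖ ≤ |K| * h ^ 2 := max_le (hx0.trans hKh) (hv0.trans hKh)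
  have hcx := hxv.continuousOn_pos
  have hcv := hxv.contDiffOn_vel.continuousOn
  -- The corrections are controlled only within `δ` of the orbit, hence a bootstrap: staying within
  -- `δ` up to `t` implies the much smaller bound `(B + Q)h²` at `t`.
  refine le_of_continuousOn_of_forall_le (δ := δ)
    (d := fun t => ‖(x t, v t) - (X t, V t)‖) ?_ (by linarith) (by linarith) ?_
  · exact ((hcx.prodMk hcv).sub
      (hX.continuous_pos.prodMk hX.continuous_vel).continuousOn).norm
  intro t ht hbefore hdt
  set P : ℝ → Plane := fun s => v s + h ^ 2 • momentumCorrection (x s) (v s) with hP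
  have hPv : ∀ s ∈ Set.Icc 0 T, ‖(x s, v s) - (X s, V s)‖ ≤ δ → ‖P s - v s‖ ≤ Q * h ^ 2 := by
    intro s hs hd
    rw [hP, add_sub_cancel_left, norm_smul, Real.norm_of_nonneg hh0.le, mul_comm]
    have := H₁ _ ⟨s, hs, rfl⟩ (x s, v s) (hd.trans_lt hδ1)
    refine le_trans ?_ hQ1h
    exact mul_le_mul_of_nonneg_right this hh0.le
  have hsub : Set.Icc 0 t ⊆ Set.Icc 0 T := Set.Icc_subset_Icc_right ht.2
  have hmem : ∀ s ∈ Set.Ico 0 t, s ∈ Set.Icc 0 T := fun s hs => hsub ⟨hs.1, hs.2.le⟩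
  have hnhds : ∀ s ∈ Set.Ico 0 t, Set.Icc 0 T ∈ nhdsWithin s (Set.Ici s) := fun s hs =>
    Icc_mem_nhdsGE_of_mem ⟨hs.1, hs.2.trans_le ht.2⟩
  have h0T : (0 : ℝ) ∈ Set.Icc 0 T := ⟨le_rfl, hT⟩
  have hgron := dist_le_of_approx_trajectories_ODE_of_mem (E := Plane × Plane) (a := 0) (b := t)
    (v := fun _ y => (y.2, keplerForce y.1)) (s := fun s => {y | ‖y.1 - X s‖ < δ₃}) (K := M')
    (f := fun s => (x s, P s)) (g := fun s => (X s, V s))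
    (f' := fun s => (v s, keplerForce (x s) + h ^ 2 • forceCorrection (x s) (v s)))
    (g' := fun s => (V s, keplerForce (X s))) (εf := Q * h ^ 2) (εg := 0)
    (δ := |K| * h ^ 2 + Q * h ^ 2) ?_ ?_ ?_ ?_ ?_ ?_ ?_ ?_ ?_ ?_ t ⟨ht.1, le_rfl⟩
  · have hgb : gronwallBound (|K| * h ^ 2 + Q * h ^ 2) M' (Q * h ^ 2 + 0) (t - 0) ≤ B * h ^ 2 := by
      rw [gronwallBound_of_K_ne_0 (by positivity), add_zero, sub_zero]
      have h1 : Q * h ^ 2 / M' ≤ Q * h ^ 2 := div_le_self hQh hM'1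
      have h2 : Real.exp (M' * t) ≤ Real.exp (M' * T) := by
        gcongr; exact ht.2
      have h3 : 0 ≤ Real.exp (M' * t) - 1 := by
        rw [sub_nonneg]; exact Real.one_le_exp (mul_nonneg (by positivity) ht.1)
      calc _ ≤ (|K| * h ^ 2 + Q * h ^ 2) * Real.exp (M' * T) +
            Q * h ^ 2 * Real.exp (M' * T) :=
            add_le_add (mul_le_mul_of_nonneg_left h2 (by positivity))
              (mul_le_mul h1 (by linarith) h3 hQh)
        _ = _ := by rw [hB]; ring
    have hgron' := hgron.trans hgb
    rw [dist_eq_norm, Prod.mk_sub_mk, Prod.norm_mk, max_le_iff] at hgron'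
    refine max_le ?_ ?_
    · have := hgron'.1
      show ‖x t - X t‖ ≤ _
      linarith
    · have h1 := hPv t ht hdt
      have h2 : v t - V t = (P t - V t) - (P t - v t) := by abel
      show ‖v t - V t‖ ≤ _
      rw [h2]
      refine (norm_sub_le _ _).trans ?_
      linarith [hgron'.2]
  · intro s hs
    refine LipschitzOnWith.of_dist_le_mul fun y hy z hz => ?_
    rw [hM'c, Prod.dist_eq, Prod.dist_eq]
    refine max_le ?_ ?_
    · calc dist y.2 z.2 ≤ 1 * max (dist y.1 z.1) (dist y.2 z.2) := by
            rw [one_mul]; exact le_max_right _ _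
        _ ≤ _ := by gcongr; exact le_max_left _ _
    · rw [dist_eq_norm]
      refine (H₃ (X s) ⟨s, hmem s hs, rfl⟩ _ _ hy hz).trans ?_
      rw [← dist_eq_norm]
      gcongr
      · exact le_max_right _ _
      · exact le_max_left _ _
  · exact (hcx.mono hsub).prodMk fun s hs =>
      (hxv.hasDerivWithinAt_momentum (hsub hs)).continuousWithinAt.mono hsub
  · exact fun s hs => ((hxv.hasDeriv s (hmem s hs)).prodMk
      (hxv.hasDerivWithinAt_momentum (hmem s hs))).mono_of_mem_nhdsWithin (hnhds s hs)
  · intro s hs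
    rw [dist_eq_norm, Prod.mk_sub_mk, Prod.norm_mk]
    refine max_le ?_ ?_
    · rw [norm_sub_rev]
      exact hPv s (hmem s hs) (hbefore s hs).le
    · rw [add_sub_cancel_left, norm_smul, Real.norm_of_nonneg hh0.le, mul_comm]
      have := H₂ _ ⟨s, hmem s hs, rfl⟩ (x s, v s) ((hbefore s hs).trans hδ2)
      refine le_trans ?_ hQ2h
      exact mul_le_mul_of_nonneg_right this hh0.le
  · intro s hs
    exact ((norm_fst_le ((x s, v s) - (X s, V s))).trans_lt (hbefore s hs)).trans hδ3
  · exact (hX.continuous_pos.prodMk hX.continuous_vel).continuousOn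
  · exact fun s _ => ((hX.hasDerivAt_pos s).prodMk (hX.hasDerivAt_vel s)).hasDerivWithinAt
  · exact fun s _ => (dist_self _).le
  · intro s _
    simpa using hδ₃
  · rw [dist_eq_norm, Prod.mk_sub_mk, Prod.norm_mk]
    refine max_le (by linarith) ?_
    have h1 := hPv 0 h0T (by linarith)
    have h2 : P 0 - V 0 = (P 0 - v 0) + (v 0 - V 0) := by abel
    rw [h2]
    refine (norm_add_le _ _).trans ?_
    linarith

/-- The components of the Laplace-Runge-Lenz vector of the modified system, up to `O(h⁴)`. -/
theorem exists_modified_lrl_bound (K T : ℝ) (hT : 0 ≤ T) (hper : Function.Periodic X T) (m : Plane)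
    {W : ℝ → ℝ} (hW : ∀ t, HasDerivAt W (dipoleHessian m (X t) (V t)) t) :
    ∃ C ≥ 0, ∃ h₀ > 0, ∀ h, 0 < h → h < h₀ → ∀ x v : ℝ → Plane,
      IsEulerLagrangeSolution (svModLagrangian h) T x v →
      ‖x 0 - X 0‖ ≤ K * h ^ 2 → ‖v 0 - V 0‖ ≤ K * h ^ 2 →
        |angularMomentum m (lrlVector (x T) (v T)) - angularMomentum m (lrlVector (x 0) (v 0)) -
          angularMomentum (X 0) (V 0) * h ^ 2 / 12 * (W T - W 0)| ≤ C * h ^ 4 := by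
  set L := angularMomentum (X 0) (V 0) with hL
  have hne : ∀ y ∈ (fun t => (X t, V t)) '' Set.Icc 0 T, y.1 ≠ 0 := by
    rintro _ ⟨t, -, rfl⟩; exact hX.ne_zero t
  have hc : ∀ y : Plane × Plane,
      ContDiffAt ℝ 1 (fun y : Plane × Plane => angularMomentum y.1 y.2) y := fun y =>
    contDiffAt_angularMomentum contDiffAt_fst contDiffAt_snd
  have hmv : ∀ y : Plane × Plane, ContDiffAt ℝ 1 (fun y : Plane × Plane => ⟪m, y.2⟫) y := fun y =>
    contDiffAt_const.inner ℝ contDiffAt_snd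
  have hmx : ∀ y : Plane × Plane, ContDiffAt ℝ 1 (fun y : Plane × Plane => ⟪m, y.1⟫) y := fun y =>
    contDiffAt_const.inner ℝ contDiffAt_fst
  have hr : ∀ y : Plane × Plane, y.1 ≠ 0 → ∀ k : ℕ,
      ContDiffAt ℝ 1 (fun y : Plane × Plane => 6 * ‖y.1‖ ^ k) y := fun y hy k =>
    contDiffAt_const.mul ((contDiffAt_fst.norm ℝ hy).pow k)
  have hr0 : ∀ y : Plane × Plane, y.1 ≠ 0 → ∀ k : ℕ, 6 * ‖y.1‖ ^ k ≠ 0 := fun y hy k =>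
    mul_ne_zero (by norm_num) (pow_ne_zero k (norm_ne_zero_iff.2 hy))
  have hmq : ∀ y : Plane × Plane, y.1 ≠ 0 →
      ContDiffAt ℝ 1 (fun y : Plane × Plane => ⟪m, momentumCorrection y.1 y.2⟫) y := fun y hy =>
    contDiffAt_const.inner ℝ (contDiffAt_momentumCorrection hy 1)
  have hG : ∀ y : Plane × Plane, y.1 ≠ 0 →
      ContDiffAt ℝ 1 (fun y : Plane × Plane => dipoleHessian m y.1 y.2) y := fun y hy =>
    contDiffAt_dipoleHessian m hy 1
  have c₁ : ∀ y ∈ (fun t => (X t, V t)) '' Set.Icc 0 T, ContDiffAt ℝ 1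
      (fun y : Plane × Plane => angularMomentum y.1 y.2 * dipoleHessian m y.1 y.2) y :=
    fun y hy => (hc y).mul (hG y (hne y hy))
  have c₂ : ∀ y ∈ (fun t => (X t, V t)) '' Set.Icc 0 T, ContDiffAt ℝ 1
      (fun y : Plane × Plane => angularMomentum y.1 y.2 * (⟪m, y.1⟫ / (6 * ‖y.1‖ ^ 6) +
        dipoleHessian m y.1 y.2 / 12) / (6 * ‖y.1‖ ^ 3)) y := fun y hy =>
    ((hc y).mul (((hmx y).div (hr y (hne y hy) 6) (hr0 y (hne y hy) 6)).add
      ((hG y (hne y hy)).div_const 12))).div (hr y (hne y hy) 3) (hr0 y (hne y hy) 3)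
  have c₃ : ∀ y ∈ (fun t => (X t, V t)) '' Set.Icc 0 T, ContDiffAt ℝ 1
      (fun y : Plane × Plane => angularMomentum y.1 y.2 * ⟪m, momentumCorrection y.1 y.2⟫ -
        angularMomentum y.1 y.2 / (6 * ‖y.1‖ ^ 3) * ⟪m, y.2⟫) y := fun y hy =>
    ((hc y).mul (hmq y (hne y hy))).sub
      (((hc y).div (hr y (hne y hy) 3) (hr0 y (hne y hy) 3)).mul (hmv y))
  have c₄ : ∀ y ∈ (fun t => (X t, V t)) '' Set.Icc 0 T, ContDiffAt ℝ 1
      (fun y : Plane × Plane => angularMomentum y.1 y.2 / (6 * ‖y.1‖ ^ 3) *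
        ⟪m, momentumCorrection y.1 y.2⟫) y := fun y hy =>
    ((hc y).div (hr y (hne y hy) 3) (hr0 y (hne y hy) 3)).mul (hmq y (hne y hy))
  obtain ⟨B, hB, h₁, hh₁, H⟩ := hX.exists_modified_error_bound K T hT
  obtain ⟨δ₁, hδ₁, M₁, hM₁, H₁⟩ := (hX.isCompact_orbit 0 T).exists_norm_sub_le c₁
  obtain ⟨δ₂, hδ₂, Q₂, hQ₂, H₂⟩ := (hX.isCompact_orbit 0 T).exists_norm_le_nhds c₂
  obtain ⟨δ₃, hδ₃, M₃, hM₃, H₃⟩ := (hX.isCompact_orbit 0 T).exists_norm_sub_le c₃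
  obtain ⟨δ₄, hδ₄, Q₄, hQ₄, H₄⟩ := (hX.isCompact_orbit 0 T).exists_norm_le_nhds c₄
  obtain ⟨δ, hδ, hδ1, hδ2, hδ3, hδ4⟩ : ∃ δ > 0, δ < δ₁ ∧ δ < δ₂ ∧ δ < δ₃ ∧ δ < δ₄ := by
    obtain ⟨δ, h0, h1⟩ := exists_between (lt_min hδ₁ (lt_min hδ₂ (lt_min hδ₃ hδ₄)))
    simp only [lt_min_iff] at h1
    exact ⟨δ, h0, h1⟩
  refine ⟨(M₁ * B / 12 + Q₂) * T + 2 * (M₃ * B) + 2 * Q₄, by positivity,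
    min (min 1 h₁) (δ / (B + 1)), by positivity, fun h hh hh₀ x v hxv hx0 hv0 => ?_⟩
  simp only [lt_min_iff] at hh₀
  obtain ⟨⟨hh1, hhh1⟩, hhδ⟩ := hh₀
  rw [lt_div_iff₀ (by positivity)] at hhδ
  have hh22 : h ^ 2 ≤ h := pow_le_of_le_one hh.le hh1.le (by norm_num)
  have hBh : B * h ^ 2 ≤ B * h := by gcongr
  have hE := H h hh hhh1 x v hxv hx0 hv0
  have hEδ : ∀ t ∈ Set.Icc 0 T, ‖(x t, v t) - (X t, V t)‖ < δ := fun t ht =>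
    (hE t ht).trans_lt (by linarith)
  obtain ⟨ℓ, hℓ⟩ : ∃ ℓ, ℓ = angularMomentum (x 0) (v 0 + h ^ 2 • momentumCorrection (x 0) (v 0)) :=
    ⟨_, rfl⟩
  set S : ℝ → ℝ := fun t => -(ℓ * ⟪m, v t + h ^ 2 • momentumCorrection (x t) (v t)⟫) -
        angularMomentum m (x t) / ‖x t‖ with hS
  have h0T : (0 : ℝ) ∈ Set.Icc 0 T := ⟨le_rfl, hT⟩
  have hTT : T ∈ Set.Icc 0 T := ⟨hT, le_rfl⟩
  have hmain := norm_image_sub_le_of_norm_deriv_le_segment' (a := 0) (b := T)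
    (C := (M₁ * B / 12 + Q₂) * h ^ 4)
    (fun t ht => (hxv.hasDerivWithinAt_lrl m hℓ ht).sub
      ((hW t).hasDerivWithinAt.const_mul (L * h ^ 2 / 12))) (fun t ht => ?_) T hTT
  -- `S` uses `P` and `ℓ`, whereas the LRL vector uses `v` and `x × v`; expanding the product `ℓ⟪m,
  -- P⟫` gives correction terms of order `h²` and `h⁴`.
  · have hform : ∀ t ∈ Set.Icc 0 T, angularMomentum m (lrlVector (x t) (v t)) = S t +
        h ^ 2 * (angularMomentum (x t) (v t) * ⟪m, momentumCorrection (x t) (v t)⟫ -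
          angularMomentum (x t) (v t) / (6 * ‖x t‖ ^ 3) * ⟪m, v t⟫) -
        h ^ 4 * (angularMomentum (x t) (v t) / (6 * ‖x t‖ ^ 3) *
          ⟪m, momentumCorrection (x t) (v t)⟫) := fun t ht => by
      simp only [hS]
      rw [angularMomentum_lrlVector, inner_add_right, real_inner_smul_right, hℓ,
        ← hxv.angularMomentum_momentum_eq ht, angularMomentum_momentum]
      ring
    have hXT : X T = X 0 := by simpa using hper 0
    have hVT : V T = V 0 := hX.periodic_vel hper
    have e1 := H₃ _ ⟨T, hTT, rfl⟩ (x T, v T) _ ((hEδ T hTT).trans hδ3)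
      (by rw [sub_self, norm_zero]; exact hδ₃)
    have e2 := H₃ _ ⟨0, h0T, rfl⟩ (x 0, v 0) _ ((hEδ 0 h0T).trans hδ3)
      (by rw [sub_self, norm_zero]; exact hδ₃)
    have e3 := H₄ _ ⟨T, hTT, rfl⟩ (x T, v T) ((hEδ T hTT).trans hδ4)
    have e4 := H₄ _ ⟨0, h0T, rfl⟩ (x 0, v 0) ((hEδ 0 h0T).trans hδ4)
    have e1' := e1.trans (mul_le_mul_of_nonneg_left (hE T hTT) hM₃)
    have e2' := e2.trans (mul_le_mul_of_nonneg_left (hE 0 h0T) hM₃)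
    simp only [hXT, hVT, Real.norm_eq_abs, sub_zero] at e1' e2' e3 e4 hmain
    rw [hform T hTT, hform 0 h0T]
    simp only [Pi.sub_apply] at hmain
    generalize angularMomentum (x T) (v T) * ⟪m, momentumCorrection (x T) (v T)⟫ -
      angularMomentum (x T) (v T) / (6 * ‖x T‖ ^ 3) * ⟪m, v T⟫ = a at *
    generalize angularMomentum (x 0) (v 0) * ⟪m, momentumCorrection (x 0) (v 0)⟫ -
      angularMomentum (x 0) (v 0) / (6 * ‖x 0‖ ^ 3) * ⟪m, v 0⟫ = b at *
    generalize angularMomentum (x T) (v T) / (6 * ‖x T‖ ^ 3) *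
      ⟪m, momentumCorrection (x T) (v T)⟫ = c at *
    generalize angularMomentum (x 0) (v 0) / (6 * ‖x 0‖ ^ 3) *
      ⟪m, momentumCorrection (x 0) (v 0)⟫ = d at *
    -- Periodicity enters here: `a` and `b` are values of one function at states within `O(h²)` of
    -- the same point `(X 0, V 0)`, so the `h²` corrections at the two ends cancel up to `O(h⁴)`.
    have hab : |a - b| ≤ 2 * (M₃ * (B * h ^ 2)) := by
      rw [abs_le] at *
      constructor <;> linarith
    have hcd : |c - d| ≤ 2 * Q₄ := (abs_sub _ _).trans (by linarith)
    have hsplit : S T + h ^ 2 * a - h ^ 4 * c - (S 0 + h ^ 2 * b - h ^ 4 * d) -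
        L * h ^ 2 / 12 * (W T - W 0) =
        (S T - L * h ^ 2 / 12 * W T - (S 0 - L * h ^ 2 / 12 * W 0)) + h ^ 2 * (a - b) -
          h ^ 4 * (c - d) := by ring
    rw [hsplit]
    have b1 : |h ^ 2 * (a - b)| ≤ h ^ 2 * (2 * (M₃ * (B * h ^ 2))) := by
      rw [abs_mul, abs_of_nonneg (by positivity : 0 ≤ h ^ 2)]
      gcongr
    have b2 : |h ^ 4 * (c - d)| ≤ h ^ 4 * (2 * Q₄) := by
      rw [abs_mul, abs_of_nonneg (by positivity : 0 ≤ h ^ 4)]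
      gcongr
    refine (abs_sub _ _).trans ((add_le_add ((abs_add_le _ _).trans
      (add_le_add hmain b1)) b2).trans (le_of_eq ?_))
    ring
  · have ht' : t ∈ Set.Icc 0 T := ⟨ht.1, ht.2.le⟩
    have e1 := H₁ _ ⟨t, ht', rfl⟩ (x t, v t) _ ((hEδ t ht').trans hδ1)
      (by rw [sub_self, norm_zero]; exact hδ₁)
    have e1' := e1.trans (mul_le_mul_of_nonneg_left (hE t ht') hM₁)
    have e2 := H₂ _ ⟨t, ht', rfl⟩ (x t, v t) ((hEδ t ht').trans hδ2)
    simp only [hX.angularMomentum_eq t, ← hL, Real.norm_eq_abs] at e1' e2 ⊢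
    have hsplit : ∀ a n g : ℝ, h ^ 2 / 12 * a - h ^ 4 * n - L * h ^ 2 / 12 * g =
      h ^ 2 / 12 * (a - L * g) - h ^ 4 * n := by intros; ring
    rw [hsplit]
    refine (abs_sub _ _).trans ?_
    rw [abs_mul, abs_mul, abs_of_nonneg (by positivity : 0 ≤ h ^ 2 / 12),
      abs_of_nonneg (by positivity : 0 ≤ h ^ 4)]
    calc _ ≤ h ^ 2 / 12 * (M₁ * (B * h ^ 2)) + h ^ 4 * Q₂ := by gcongr
      _ = _ := by ring

/-- The precession of the modified system, up to `O(h⁴)`. -/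
theorem exists_modified_precession_bound (K T : ℝ) (hT : 0 ≤ T) (hper : Function.Periodic X T)
    (hm : lrlVector (X 0) (V 0) ≠ 0) {W : ℝ → ℝ}
    (hW : ∀ t, HasDerivAt W (dipoleHessian (lrlVector (X 0) (V 0)) (X t) (V t)) t) :
    ∃ C ≥ 0, ∃ h₀ > 0, ∀ h, 0 < h → h < h₀ → ∀ (x v : ℝ → Plane) (θ : ℝ → ℝ),
      IsEulerLagrangeSolution (svModLagrangian h) T x v →
      ‖x 0 - X 0‖ ≤ K * h ^ 2 → ‖v 0 - V 0‖ ≤ K * h ^ 2 → IsLrlAngle T x v θ →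
        |θ T - θ 0 - angularMomentum (X 0) (V 0) * h ^ 2 / 12 * (W T - W 0) /
          ‖lrlVector (X 0) (V 0)‖ ^ 2| ≤ C * h ^ 4 := by
  have hlrl : ∀ y ∈ (fun t => (X t, V t)) '' Set.Icc 0 T,
      ContDiffAt ℝ 1 (fun y : Plane × Plane => lrlVector y.1 y.2) y := by
    rintro _ ⟨t, -, rfl⟩; exact contDiffAt_lrlVector (hX.ne_zero t) 1
  obtain ⟨C₁, hC₁, h₁, hh₁, H₁⟩ := hX.exists_modified_lrl_bound K T hT hper _ hW
  obtain ⟨B, hB, h₂, hh₂, H₂⟩ := hX.exists_modified_error_bound K T hT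
  obtain ⟨δ, hδ, M, hM, H₃⟩ := (hX.isCompact_orbit 0 T).exists_norm_sub_le hlrl
  set m := lrlVector (X 0) (V 0) with hmdef
  have hm0 : 0 < ‖m‖ := norm_pos_iff.2 hm
  refine ⟨(C₁ + 2 * (M * B) ^ 2) / ‖m‖ ^ 2, by positivity,
    min (min 1 (‖m‖ / 2 / (M * B + 1))) (min (min h₁ h₂) (δ / (B + 1))), by positivity,
    fun h hh hh₀ x v θ hxv hx0 hv0 hθ => ?_⟩
  simp only [lt_min_iff] at hh₀
  obtain ⟨⟨hh1, hhm⟩, ⟨hhh1, hhh2⟩, hhδ⟩ := hh₀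
  rw [lt_div_iff₀ (by positivity)] at hhm hhδ
  have hh22 : h ^ 2 ≤ h := pow_le_of_le_one hh.le hh1.le (by norm_num)
  have hMBh : M * B * h ^ 2 ≤ M * B * h := by gcongr
  have hBh : B * h ^ 2 ≤ B * h := by gcongr
  have hE := H₂ h hh hhh2 x v hxv hx0 hv0
  have hR : ∀ t ∈ Set.Icc 0 T, ‖lrlVector (x t) (v t) - m‖ ≤ M * B * h ^ 2 := fun t ht => by
    have := H₃ _ ⟨t, ht, rfl⟩ (x t, v t) _ ((hE t ht).trans_lt (by linarith))
      (by rw [sub_self, norm_zero]; exact hδ)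
    simp only [hX.lrlVector_eq t] at this
    rw [mul_assoc]
    exact this.trans (mul_le_mul_of_nonneg_left (hE t ht) hM)
  have hnear : ∀ t ∈ Set.Icc 0 T, ‖lrlVector (x t) (v t) - m‖ ≤ ‖m‖ / 2 := fun t ht =>
    (hR t ht).trans (by linarith)
  have h0T : (0 : ℝ) ∈ Set.Icc 0 T := ⟨le_rfl, hT⟩
  have hTT : T ∈ Set.Icc 0 T := ⟨hT, le_rfl⟩
  have hcont : ContinuousOn (fun t => lrlVector (x t) (v t)) (Set.Icc 0 T) := fun t ht =>
    (contDiffAt_lrlVector (y := (x t, v t)) (hxv.ne_zero t ht) 1).continuousAt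
      |>.comp_continuousWithinAt (f := fun t => (x t, v t))
        ((hxv.continuousOn_pos t ht).prodMk (hxv.contDiffOn_vel.continuousOn t ht))
  rw [continuous_angle_sub_eq hT hm hcont hθ.1 hnear hθ.2]
  have hang : ∀ t ∈ Set.Icc 0 T, |signedAngle m (lrlVector (x t) (v t)) -
      angularMomentum m (lrlVector (x t) (v t)) / ‖m‖ ^ 2| ≤ (M * B) ^ 2 / ‖m‖ ^ 2 * h ^ 4 :=
    fun t ht => by
      refine (abs_signedAngle_sub_le hm (hnear t ht)).trans ?_
      calc (‖lrlVector (x t) (v t) - m‖ / ‖m‖) ^ 2 ≤ (M * B * h ^ 2 / ‖m‖) ^ 2 := by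
            gcongr; exact hR t ht
        _ = _ := by ring
  have ha := hang T hTT
  have hb := hang 0 h0T
  have hc := H₁ h hh hhh1 x v hxv hx0 hv0
  have hc' : |(angularMomentum m (lrlVector (x T) (v T)) -
      angularMomentum m (lrlVector (x 0) (v 0)) -
      angularMomentum (X 0) (V 0) * h ^ 2 / 12 * (W T - W 0)) / ‖m‖ ^ 2| ≤
        C₁ * h ^ 4 / ‖m‖ ^ 2 := by
    rw [abs_div, abs_of_nonneg (by positivity : 0 ≤ ‖m‖ ^ 2)]
    gcongr
  have e1 : (C₁ + 2 * (M * B) ^ 2) / ‖m‖ ^ 2 * h ^ 4 =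
      C₁ * h ^ 4 / ‖m‖ ^ 2 + 2 * ((M * B) ^ 2 / ‖m‖ ^ 2 * h ^ 4) := by ring
  rw [sub_div, sub_div] at hc'
  rw [e1]
  rw [abs_le] at *
  constructor <;> linarith

end IsKeplerSolution

/-! ### Conclusion for both precession rates -/

theorem mainTheorem1 (X V : ℝ → Plane) (hX : IsKeplerSolution X V)
    (a b T : ℝ) (horbit : IsEllipse (Set.range X) a b) (hba : b < a)
    (hT : IsMinimalPeriod X T) (K : ℝ) :
    ∃ C h₀ : ℝ, 0 < h₀ ∧ ∀ h : ℝ, 0 < h → h < h₀ →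
      (∀ x : ℕ → Plane, IsStormerVerlet h x →
        ‖x 0 - X 0‖ ≤ K * h ^ 2 → ‖svMomentum h x 0 - V 0‖ ≤ K * h ^ 2 →
        |svPrecession h x T -
            -(Real.sign (angularMomentum (X 0) (V 0)) * (Real.pi / 24) *
              (15 * (a ^ 3 / b ^ 6) - 3 * (a / b ^ 4)) * h ^ 2)| ≤ C * h ^ 4) ∧
      (∀ (x v : ℝ → Plane) (θ : ℝ → ℝ), IsEulerLagrangeSolution (svModLagrangian h) T x v →
        ‖x 0 - X 0‖ ≤ K * h ^ 2 → ‖v 0 - V 0‖ ≤ K * h ^ 2 → IsLrlAngle T x v θ →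
        |θ T - θ 0 -
            -(Real.sign (angularMomentum (X 0) (V 0)) * (Real.pi / 24) *
              (15 * (a ^ 3 / b ^ 6) - 3 * (a / b ^ 4)) * h ^ 2)| ≤ C * h ^ 4) := by
  have hb : 0 < b := horbit.1
  have ha : 0 < a := hb.trans hba
  have hT0 : 0 ≤ T := hT.1.1.le
  obtain ⟨hL2, hm2⟩ := hX.angularMomentum_sq_and_norm_lrlVector_sq horbit hba
  have hL : angularMomentum (X 0) (V 0) ≠ 0 := fun h0 => by
    have : 0 < b ^ 2 / a := by positivity
    rw [← hL2, h0] at this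
    simp at this
  -- This is where `b < a` rules out the circle, whose LRL vector vanishes and has no angle.
  have hm : lrlVector (X 0) (V 0) ≠ 0 := fun h0 => by
    have : b ^ 2 / a ^ 2 < 1 := by
      rw [div_lt_one (by positivity)]
      gcongr
    rw [h0, norm_zero] at hm2
    linarith
  obtain ⟨W, hW, hWT⟩ := hX.exists_primitive_dipoleHessian hL hT
  obtain ⟨C₁, hC₁, h₁, hh₁, H₁⟩ := hX.exists_svPrecession_bound K T hT0 hm hW
  obtain ⟨C₂, hC₂, h₂, hh₂, H₂⟩ := hX.exists_modified_precession_bound K T hT0 hT.1.2 hm hW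
  refine ⟨max C₁ C₂, min h₁ h₂, lt_min hh₁ hh₂, fun h hh hh₀ => ?_⟩
  rw [← precession_coefficient hb hba hL2 hm2 hWT h]
  have hh4 : 0 ≤ h ^ 4 := by positivity
  exact ⟨fun x hx hx0 hv0 => (H₁ h hh (hh₀.trans_le (min_le_left _ _)) x hx hx0 hv0).trans
      (mul_le_mul_of_nonneg_right (le_max_left _ _) hh4),
    fun x v θ hx hx0 hv0 hθ => (H₂ h hh (hh₀.trans_le (min_le_right _ _)) x v θ hx hx0 hv0 hθ).trans
      (mul_le_mul_of_nonneg_right (le_max_right _ _) hh4)⟩
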